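/- Let $M$ be a closed, connected, orientable Haken $3$-manifold, and let $W=\mathcal T_1\cup\dots\cup\mathcal T_q$ (possibly empty) be its JSJ family of tori: a minimal finite family of disjoint two-sided essential tori such that each piece (component of $M$ cut along $W$) is Seifert fibred or atoroidal. Let $(\mathcal G,X)$ be the associated graph of groups. Its vertices $v$ are the pieces $M(v)$. Each torus $\mathcal T_j$, with its two copies $\mathcal T_j^-$ and $\mathcal T_j^+$ in the boundary of the pieces, gives an edge $e_j$ from the piece containing $\mathcal T_j^-$ to the piece containing $\mathcal T_j^+$, and the inverse edge $\bar e_j$. The vertex groups are $G(v)=\pi_1(M(v),*_v)$, and the edge groups are $G(e)=G(\bar e)=\pi_1(S^1\times S^1)\cong\mathbb Z^2$. The monomorphisms $c\mapsto c^-\in G(\mathbf o(e))$ and $c\mapsto c^+\in G(\mathbf e(e))$, with images $G(e)^-$ and $G(e)^+$, are induced by the inclusions of the boundary tori, via chosen paths in the pieces from the base points $*_v$ to the base points of the tori. Let $t_e$ be the class of the path in $M$ from $*_{\mathbf o(e)}$ to $*_{\mathbf e(e)}$ which follows the chosen paths and crosses the torus of $e$ once. A cyclically reduced form $(\mathcal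 C,\mu)$ is one of the following: * (length $0$) a vertex $\mathcal C=(v)$ with a label $\mu_1\in G(v)$, $\mu_1\neq1$; * (length $n\ge1$) a loop $\mathcal C=(v_1,e_1,\dots,v_n,e_n)$ in $X$ (with $\mathbf o(e_i)=v_i$, $\mathbf e(e_i)=v_{i+1}$, indices mod $n$) and labels $\mu_i\in G(v_i)$, such that $\mu_{i+1}\notin G(e_i)^+$ whenever $e_{i+1}=\bar e_i$ (indices mod $n$). Its label is $\omega=\mu_1$, respectively $\omega=\mu_1t_{e_1}\mu_2t_{e_2}\cdots\mu_nt_{e_n}$, an element of $\pi_1(M,*_{v_1})$ (with $v_1=v$ in length $0$). Labels based at different points are compared in $\pi_1(M)$ along paths in $M$ between the base points; write $\sim$ for conjugacy. **Theorem.** Suppose $(\mathcal C,\mu)$ and $(\mathcal C',\mu')$ are cyclically reduced forms whose labels $\omega$ and $\omega'$ are conjugate in $\pi_1(M)$. Then they have the same length, and one of the following holds. 1. The length is $0$, $\mathcal C=\mathcal C'=(v)$, and $\omega\sim\omega'$ in $G(v)$. 2. The length is $0$, and there are a path $(w_0,f_1,w_1,\dots,f_p,w_p)$ in $X$ with $p\ge1$,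 $\mathcal C=(w_0)$, $\mathcal C'=(w_p)$, and elements $c_i\in G(f_i)$ $(1\le i\le p)$ such that $\omega\sim c_1^-$ in $G(w_0)$, $\omega'\sim c_p^+$ in $G(w_p)$, and $c_i^+\sim c_{i+1}^-$ in $G(w_i)$ for $1\le i\le p-1$. 3. The length is $n\ge1$ and, after a cyclic permutation of $(\mathcal C',\mu')$, $\mathcal C=\mathcal C'=(v_1,e_1,\dots,v_n,e_n)$ and there are $c_i\in G(e_i)$ $(1\le i\le n)$ with $$\mu_1=c_n^+\,\mu_1'\,(c_1^-)^{-1}\ \text{in } G(v_1),\qquad \mu_i=c_{i-1}^+\,\mu_i'\,(c_i^-)^{-1}\ \text{in } G(v_i)\quad(2\le i\le n).$$ In particular $\omega=c_n^+\,\omega'\,(c_n^+)^{-1}$ in $\pi_1(M)$, where $\omega'$ is the label of the permuted form. -/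

import Mathlib

open scoped Manifold ContDiff
open Set Topology

namespace HakenJSJ

/-! ### Homotopy classes of loops -/

/-- The fundamental group of `X` at `x`, as the set of homotopy classes of loops. It is the
carrier of `FundamentalGroup X x`; products are written as concatenations of classes of paths,
`p ⬝ q` being "first `p`, then `q`" (Mathlib's `*` on `FundamentalGroup` is the opposite
product), and `p.symm` is the inverse of `p`. -/
abbrev Pi1 {X : Type*} [TopologicalSpace X] (x : X) : Type _ := Path.Homotopic.Quotient x x

infixl:70 " ⬝ " => Path.Homotopic.Quotient.trans

/-- `a = g b g⁻¹` for some class of paths `g` from `x` to `y`. For `x = y` this is conjugacy in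
the fundamental group at `x`; for `x ≠ y` it is conjugacy after the identification of the two
fundamental groups along a path (it does not depend on that path). -/
def LoopConj {X : Type*} [TopologicalSpace X] {x y : X} (a : Pi1 x) (b : Pi1 y) : Prop :=
  ∃ g : Path.Homotopic.Quotient x y, a = g ⬝ b ⬝ g.symm

/-- The map induces injections on all fundamental groups. -/
def PiOneInjective {X Y : Type*} [TopologicalSpace X] [TopologicalSpace Y] (f : C(X, Y)) : Prop :=
  ∀ x : X, Function.Injective (fun p : Pi1 x => p.map f)

/-! ### Two-sided surfaces, Haken manifolds -/

/-- A two-sided embedding of `F` (the image of `F × {0}`), given with an open product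
neighbourhood. -/
structure TwoSided (F P : Type*) [TopologicalSpace F] [TopologicalSpace P] where
  toFun : F × ℝ → P
  isOpenEmbedding : IsOpenEmbedding toFun

/-- The embedding of the surface itself. -/
def TwoSided.core {F P : Type*} [TopologicalSpace F] [TopologicalSpace P] (f : TwoSided F P) :
    C(F, P) :=
  ⟨fun x => f.toFun (x, 0), f.isOpenEmbedding.continuous.comp (by fun_prop)⟩

/-- Euclidean `n`-space. -/
abbrev E (n : ℕ) : Type := EuclideanSpace ℝ (Fin n)

/-- The torus `S¹ × S¹`. -/
abbrev Torus : Type := Circle × Circle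

/-- The edge group of every edge of the graph of groups: the fundamental group of `S¹ × S¹`. -/
abbrev EdgeGroup : Type := Pi1 (1 : Torus)

/-- A smooth 3-manifold is orientable: it has an atlas of charts of its smooth structure whose
changes of coordinates have positive Jacobian determinant. -/
def IsOrientable (M : Type*) [TopologicalSpace M] [ChartedSpace (E 3) M] : Prop :=
  ∃ A ⊆ IsManifold.maximalAtlas (𝓡 3) ∞ M,
    (∀ x : M, ∃ e ∈ A, x ∈ e.source) ∧
    ∀ e ∈ A, ∀ e' ∈ A, ∀ x ∈ (e.symm.trans e').source,
      0 < (fderiv ℝ (e.symm.trans e') x).det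

/-- Every two-sided 2-sphere bounds a 3-ball. -/
def IsIrreducible (M : Type*) [TopologicalSpace M] : Prop :=
  ∀ f : TwoSided (Metric.sphere (0 : E 3) 1) M,
    ∃ b : C(Metric.closedBall (0 : E 3) 1, M), Function.Injective b ∧
      b '' {x | ‖(x : E 3)‖ = 1} = range f.core

/-- A closed manifold is Haken: it is irreducible and contains a two-sided incompressible closed
surface, that is, a connected closed surface which is not simply connected and whose fundamental
group injects. -/
def IsHaken (M : Type*) [TopologicalSpace M] : Prop :=
  IsIrreducible M ∧
    ∃ (F : Type) (_ : TopologicalSpace F) (_ : ChartedSpace (E 2) F),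
      T2Space F ∧ CompactSpace F ∧ ConnectedSpace F ∧ ¬ SimplyConnectedSpace F ∧
        ∃ f : TwoSided F M, PiOneInjective f.core

/-! ### Seifert fibrations -/

/-- `P` has a Seifert fibration: a partition (the classes of `r` are the fibres) such that every
fibre has a neighbourhood `N` which is a union of fibres and is fibre-preservingly homeomorphic to
a fibred solid torus, i.e. to `D² × S¹` with fibres the orbits of the circle action
`u · (z, w) = (u ^ q z, u ^ p w)`, with `p ≥ 1` and `p`, `q` coprime. -/
def IsSeifertFibered (P : Type*) [TopologicalSpace P] : Prop :=
  ∃ r : Setoid P, ∀ x : P, ∃ N : Set P,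
    (∀ y, r x y → N ∈ 𝓝 y) ∧ (∀ y ∈ N, ∀ z, r y z → z ∈ N) ∧
    ∃ (p : ℕ) (q : ℤ) (h : N ≃ₜ Metric.closedBall (0 : ℂ) 1 × Circle),
      1 ≤ p ∧ IsCoprime (p : ℤ) q ∧
      ∀ y z : N, r y z ↔ ∃ u : Circle,
        ((h z).1 : ℂ) = ((u ^ q : Circle) : ℂ) * ((h y).1 : ℂ) ∧ (h z).2 = u ^ p * (h y).2

/-! ### Systems of tori and the pieces they cut out -/

/-- A finite family of disjoint two-sided tori `𝒯_j` in `M`, with disjoint product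
neighbourhoods. -/
structure TorusSystem (M : Type*) [TopologicalSpace M] where
  ι : Type
  finite : Finite ι
  collar : ι → TwoSided Torus M
  disjoint : Pairwise fun i j => Disjoint (range (collar i).toFun) (range (collar j).toFun)

namespace TorusSystem

variable {M : Type*} [TopologicalSpace M] (S : TorusSystem M)

/-- The subfamily indexed by `J`. -/
def restrict (J : Set S.ι) : TorusSystem M where
  ι := J
  finite := haveI := S.finite; inferInstance
  collar j := S.collar j
  disjoint _ _ h := S.disjoint (fun h' => h (Subtype.ext h'))

/-- `M` cut along the tori: the complement of the open regular neighbourhoods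
`𝒯_j × (-1, 1)`. -/
def cut : Set M := (⋃ j, (S.collar j).toFun '' (univ ×ˢ Ioo (-1 : ℝ) 1))ᶜ

/-- The vertices of the graph: the connected components of the cut manifold. -/
abbrev Vertex : Type _ := ConnectedComponents S.cut

/-- The piece `M(v)`. -/
def piece (v : S.Vertex) : Set M := Subtype.val '' {x : S.cut | (x : S.Vertex) = v}

/-- `-1` or `1`. -/
noncomputable def sgn (s : Bool) : ℝ := if s then 1 else -1

/-- The two boundary tori arising from `𝒯_j`: `𝒯_j⁻` for `s = false`, `𝒯_j⁺` for `s = true`. -/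
noncomputable def side (j : S.ι) (s : Bool) (t : Torus) : M := (S.collar j).toFun (t, sgn s)

/-- The boundary torus `𝒯_j^±` lies in the piece `M(v)`. -/
def LiesIn (j : S.ι) (s : Bool) (v : S.Vertex) : Prop := ∀ t, S.side j s t ∈ S.piece v

/-- The boundary torus `𝒯_j^±` as a map into the piece which contains it. -/
noncomputable def sideMap (j : S.ι) (s : Bool) {v : S.Vertex} (h : S.LiesIn j s v) : C(Torus, S.piece v) :=
  ⟨fun t => ⟨S.side j s t, h t⟩, Continuous.subtype_mk
    ((S.collar j).isOpenEmbedding.continuous.comp (by fun_prop)) _⟩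

/-- The inclusion of a piece into `M`. -/
def incl (v : S.Vertex) : C(S.piece v, M) := ⟨Subtype.val, continuous_subtype_val⟩

/-- The piece is atoroidal: every two-sided torus in it whose fundamental group injects is parallel
to a boundary torus, i.e. cobounds with it an embedded `S¹ × S¹ × I`. -/
def IsAtoroidal (v : S.Vertex) : Prop :=
  ∀ f : TwoSided Torus (S.piece v), PiOneInjective f.core →
    ∃ h : C(Torus × unitInterval, S.piece v), Function.Injective h ∧
      (range fun t => h (t, 0)) = range f.core ∧
      ∃ (j : S.ι) (s : Bool), (range fun t => (h (t, 1) : M)) = range (S.side j s)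

/-- The tori are essential (incompressible) and each piece is Seifert fibred or atoroidal. -/
def IsDecomposition : Prop :=
  (∀ j, PiOneInjective (S.collar j).core) ∧
    ∀ v, IsSeifertFibered (S.piece v) ∨ S.IsAtoroidal v

/-- A JSJ decomposition: a minimal family of tori of this kind. -/
def IsJSJ : Prop :=
  S.IsDecomposition ∧ ∀ J : Set S.ι, J ≠ univ → ¬ (S.restrict J).IsDecomposition

/-! ### The graph of groups -/

/-- An oriented edge of the graph from `a` to `b`: a torus `𝒯_j` with a direction of crossing it.
For `pos = true` this is the edge `e_j`, from the piece containing `𝒯_j⁻` to the piece containing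
`𝒯_j⁺`; for `pos = false` it is the inverse edge. -/
structure Edge (a b : S.Vertex) where
  torus : S.ι
  pos : Bool
  src : S.LiesIn torus (!pos) a
  tgt : S.LiesIn torus pos b

/-- The choices which define the graph of groups: base points `*_v` of the pieces, and in the
pieces, paths from them to the base points of their boundary tori. -/
structure Basing where
  base : ∀ v : S.Vertex, S.piece v
  arc : ∀ (j : S.ι) (s : Bool) (v : S.Vertex) (h : S.LiesIn j s v),
    Path (base v) (S.sideMap j s h 1)

variable {S}

/-- The same edge, with its extremity renamed. -/
def Edge.castTgt {a b b' : S.Vertex} (e : S.Edge a b) (h : b = b') : S.Edge a b' :=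
  ⟨e.torus, e.pos, e.src, h ▸ e.tgt⟩

/-- `e'` is the inverse edge of `e`. -/
def Edge.IsReverse {a b d : S.Vertex} (e' : S.Edge b d) (e : S.Edge a b) : Prop :=
  e'.torus = e.torus ∧ e'.pos = !e.pos

namespace Basing

variable (B : S.Basing)

/-- The base point of a piece as a point of `M`. -/
def pt (v : S.Vertex) : M := S.incl v (B.base v)

/-- The vertex group `G(v)`, the fundamental group of the piece `M(v)` at `*_v`. -/
abbrev VertexGroup (v : S.Vertex) : Type _ := Pi1 (B.base v)

/-- An element of a vertex group as an element of the fundamental group of `M` at `*_v`. -/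
noncomputable def toM {v : S.Vertex} (g : B.VertexGroup v) : Pi1 (B.pt v) := g.map (S.incl v)

/-- The homomorphism from an edge group to the vertex group of the piece containing `𝒯_j^±`,
induced by the inclusion and the chosen path. -/
noncomputable def sideHom (j : S.ι) (s : Bool) {v : S.Vertex} (h : S.LiesIn j s v) (c : EdgeGroup) :
    B.VertexGroup v :=
  .mk (B.arc j s v h) ⬝ c.map (S.sideMap j s h) ⬝ (.symm (.mk (B.arc j s v h)))

/-- `c⁻ = φ_e⁻(c)`, in the vertex group of the origin of `e`. -/
noncomputable def minus {a b : S.Vertex} (e : S.Edge a b) (c : EdgeGroup) : B.VertexGroup a :=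
  B.sideHom e.torus (!e.pos) e.src c

/-- `c⁺ = φ_e⁺(c)`, in the vertex group of the extremity of `e`. -/
noncomputable def plus {a b : S.Vertex} (e : S.Edge a b) (c : EdgeGroup) : B.VertexGroup b :=
  B.sideHom e.torus e.pos e.tgt c

/-- The path which crosses the product neighbourhood of the torus of `e` along `e`. -/
noncomputable def crossing {a b : S.Vertex} (e : S.Edge a b) :
    Path (S.side e.torus (!e.pos) 1) (S.side e.torus e.pos 1) where
  toFun t := (S.collar e.torus).toFun
    (1, (1 - (t : ℝ)) * sgn (!e.pos) + (t : ℝ) * sgn e.pos)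
  continuous_toFun := (S.collar e.torus).isOpenEmbedding.continuous.comp (by fun_prop)
  source' := by simp [side]
  target' := by simp [side]

/-- The stable letter `t_e`: the class in `M` of the path from `*_a` to `*_b` which crosses the
torus of `e` once. It satisfies `t_e c⁺ t_e⁻¹ = c⁻`. -/
noncomputable def stable {a b : S.Vertex} (e : S.Edge a b) : Path.Homotopic.Quotient (B.pt a) (B.pt b) :=
  Path.Homotopic.Quotient.map (.mk (B.arc e.torus (!e.pos) a e.src)) (S.incl a) ⬝
    Path.Homotopic.Quotient.mk (crossing e) ⬝
    (Path.Homotopic.Quotient.map (.mk (B.arc e.torus e.pos b e.tgt)) (S.incl b)).symm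

/-! ### Cyclically reduced forms -/

/-- A word of type a loop `(v_0, e_0, v_1, e_1, …, v_m, e_m)` of positive length `n = m + 1`, with
labels `μ_i` in `G(v_i)`; the last vertex of the loop, whose label is `1`, is omitted. Indices are
taken modulo `n`. -/
structure LoopWord (m : ℕ) where
  v : ZMod (m + 1) → S.Vertex
  e : ∀ i, S.Edge (v i) (v (i + 1))
  μ : ∀ i, B.VertexGroup (v i)

namespace LoopWord

variable {B} {m : ℕ} (F : B.LoopWord m)

/-- The word and all its cyclic conjugates are reduced: whenever two cyclically consecutive edges
are inverse to each other, the label between them is not in the edge subgroup. -/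
def IsCyclicallyReduced : Prop :=
  ∀ i, (F.e (i + 1)).IsReverse (F.e i) → F.μ (i + 1) ∉ range (B.plus (F.e i))

/-- The product `μ_0 t_{e_0} μ_1 t_{e_1} ⋯ μ_{k-1} t_{e_{k-1}}`, a class of paths in `M`. -/
noncomputable def prefixLabel : ∀ k : ℕ, Path.Homotopic.Quotient (B.pt (F.v 0)) (B.pt (F.v (k : ZMod (m + 1))))
  | 0 => (Path.Homotopic.Quotient.refl (B.pt (F.v 0))).cast rfl (by rw [Nat.cast_zero])
  | k + 1 => (prefixLabel k ⬝ B.toM (F.μ k) ⬝ B.stable (F.e k)).cast rfl (by rw [Nat.cast_succ])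

/-- The label `μ_0 t_{e_0} μ_1 t_{e_1} ⋯ μ_m t_{e_m}`, in the fundamental group of `M`. -/
noncomputable def label : Pi1 (B.pt (F.v 0)) :=
  (F.prefixLabel (m + 1)).cast rfl (by rw [← ZMod.natCast_self (m + 1)])

/-- The cyclic conjugate starting at the index `k`. -/
def rotate (k : ZMod (m + 1)) : B.LoopWord m where
  v i := F.v (i + k)
  e i := (F.e (i + k)).castTgt (by rw [add_right_comm])
  μ i := F.μ (i + k)

/-- The same loop with other labels. -/
def withLabels (μ' : ∀ i, B.VertexGroup (F.v i)) : B.LoopWord m := ⟨F.v, F.e, μ'⟩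

/-- The last edge `e_m` of the loop, as an edge with extremity `v_0`. -/
def lastEdge : S.Edge (F.v (-1)) (F.v 0) := (F.e (-1)).castTgt (by rw [neg_add_cancel])

end LoopWord

/-- Cyclically reduced forms: those of length `0`, given by a vertex and a nontrivial label, and
those of positive length. -/
inductive CyclicForm where
  | point (v : S.Vertex) (g : B.VertexGroup v) (hg : g ≠ .refl _) : CyclicForm
  | loop (m : ℕ) (F : B.LoopWord m) (hF : F.IsCyclicallyReduced) : CyclicForm

namespace CyclicForm

variable {B}

/-- The length of the underlying loop in the graph. -/
def length : B.CyclicForm → ℕ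
  | point _ _ _ => 0
  | loop m _ _ => m + 1

/-- The vertex at which the underlying loop is based. -/
def start : B.CyclicForm → S.Vertex
  | point v _ _ => v
  | loop _ F _ => F.v 0

/-- The label, an element of the fundamental group of `M`. -/
noncomputable def label : ∀ Φ : B.CyclicForm, Pi1 (B.pt Φ.start)
  | point _ g _ => B.toM g
  | loop _ F _ => F.label

end CyclicForm

end Basing

end TorusSystem

end HakenJSJ

open HakenJSJ

/-! `M` is a graph of spaces, glued from the pieces and the collars `S¹ × S¹ × ℝ`, and two facts
about its fundamental groupoid at the base points carry the theorem. Generation: every path class is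
a product of elements of vertex groups and stable letters (`isWord`), hence the value of a reduced
word (`Word.exists_isReduced`). Normal form: reduced words with equal values have the same length
and cross the same tori in the same directions, and their coefficients differ by edge elements moved
across the letters (`Word.length_eq`, `Word.shape_eq`, `Word.snoc_eq`).

The normal form is proved by mapping the groupoid to a group where Britton's lemma holds.
`LocalLabelling.transport` is the existence half of van Kampen's theorem: compatible labels of the
paths in pieces and collars extend to all paths by subdivision. A `Realization` supplies such
labels. Its target is an HNN extension of the product of all vertex groups with one letter per
torus. This group is found inside an HNN extension with a single letter, over the wreath product of
that product with the free group on the tori: the associated subgroups of different tori are placed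
in different coordinates, so one letter serves them all. Incompressibility of the tori makes the
edge homomorphisms injective (`sideHom_injective`).

For the conjugacy statement let `ω = g ω' g⁻¹` with `g` reduced. If `ω'` is the label of a loop, a
cancellation at either end of the loop shortens `g` and rotates the loop, while without cancellation
the product is reduced and longer than the loop (`exists_rotate_or_longer`). So a reduced word
conjugate to a cyclically reduced loop is at least as long as it; by symmetry the lengths agree, and
`g` may be taken in a vertex group. Comparing the two reduced words edge by edge from the end then
gives the `c_i`, and the closing comparison shows that `g` itself is `c_n⁺`. If `ω` and `ω'` lie in
vertex groups, every edge of `g` has to cancel against its inverse around the element in the middle,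
which is therefore conjugate into the edge group and passes to the next piece (`linked_of_word`). -/

namespace HakenJSJ

local notation "PC" => Path.Homotopic.Quotient

/-! ### Calculus of path classes -/

section PathClass

variable {X Y : Type*} [TopologicalSpace X] [TopologicalSpace Y] {x y z w : X}

attribute [simp] Path.Homotopic.Quotient.refl_trans Path.Homotopic.Quotient.trans_refl
  Path.Homotopic.Quotient.trans_symm Path.Homotopic.Quotient.symm_trans

@[simp] lemma symm_trans_cancel (p : PC x y) (q : PC y z) : p.symm ⬝ (p ⬝ q) = q := by
  rw [← Path.Homotopic.Quotient.trans_assoc]; simp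

@[simp] lemma trans_symm_cancel (p : PC y x) (q : PC y z) : p ⬝ (p.symm ⬝ q) = q := by
  rw [← Path.Homotopic.Quotient.trans_assoc]; simp

lemma trans_left_cancel {p : PC x y} {q r : PC y z} (h : p ⬝ q = p ⬝ r) : q = r := by
  rw [← symm_trans_cancel p q, h, symm_trans_cancel]

lemma trans_right_cancel {p q : PC x y} {r : PC y z} (h : p ⬝ r = q ⬝ r) : p = q := by
  have := congrArg (fun s => s ⬝ r.symm) h
  simpa [Path.Homotopic.Quotient.trans_assoc] using this

lemma eq_symm_of_trans_eq_refl {p : PC x y} {q : PC y x} (h : p ⬝ q = .refl x) : q = p.symm := by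
  apply trans_left_cancel (p := p); rw [h]; simp

@[simp] lemma quotient_symm_symm (p : PC x y) : p.symm.symm = p :=
  (eq_symm_of_trans_eq_refl (by simp)).symm

@[simp] lemma symm_of_trans (p : PC x y) (q : PC y z) : (p ⬝ q).symm = q.symm ⬝ p.symm :=
  (eq_symm_of_trans_eq_refl (by simp [Path.Homotopic.Quotient.trans_assoc])).symm

@[simp] lemma symm_of_refl (x : X) :
    (Path.Homotopic.Quotient.refl x).symm = Path.Homotopic.Quotient.refl x :=
  (eq_symm_of_trans_eq_refl (by simp)).symm

@[simp] lemma map_of_trans (f : C(X, Y)) (p : PC x y) (q : PC y z) :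
    (p ⬝ q).map f = p.map f ⬝ q.map f := by
  rcases p with ⟨p⟩; rcases q with ⟨q⟩
  exact congr_arg Quotient.mk'' (p.map_trans q f.continuous)

@[simp] lemma map_of_refl (f : C(X, Y)) (x : X) :
    (Path.Homotopic.Quotient.refl x).map f = Path.Homotopic.Quotient.refl (f x) := rfl

@[simp] lemma map_of_symm (f : C(X, Y)) (p : PC x y) : (p.symm).map f = (p.map f).symm :=
  eq_symm_of_trans_eq_refl (by rw [← map_of_trans]; simp)

/-- Uniqueness of path classes in a simply connected space. -/
lemma pathClass_unique [SimplyConnectedSpace X] (p q : PC x y) : p = q := by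
  rcases p with ⟨p⟩; rcases q with ⟨q⟩
  exact Quotient.sound (SimplyConnectedSpace.paths_homotopic p q)

/-- In `X × Y` with `Y` simply connected, a path class is determined by its first projection. -/
lemma pathClass_prod_ext [SimplyConnectedSpace Y] {a b : X × Y} {p q : PC a b}
    (h : Path.Homotopic.projLeft p = Path.Homotopic.projLeft q) : p = q := by
  obtain ⟨a1, a2⟩ := a
  obtain ⟨b1, b2⟩ := b
  rw [← Path.Homotopic.prod_projLeft_projRight p, ← Path.Homotopic.prod_projLeft_projRight q, h,
    pathClass_unique (Path.Homotopic.projRight p) (Path.Homotopic.projRight q)]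

lemma map_mk_congr {p q : Path x y} (h : ∀ t, p t = q t) :
    Path.Homotopic.Quotient.mk p = Path.Homotopic.Quotient.mk q := by
  congr 1; ext t; exact h t

/-- The subpaths over the steps of a subdivision: a predicate which is closed under composition and
holds for the pieces of a path holds for the path. -/
lemma pathClass_induction {ι : Type*} (U : ι → Set X) (hU : ∀ i, IsOpen (U i))
    (hcov : ∀ x, ∃ i, x ∈ U i) (Q : ∀ x y : X, PC x y → Prop)
    (htrans : ∀ x y z (p : PC x y) (q : PC y z), Q x y p → Q y z q → Q x z (p ⬝ q))
    (hsmall : ∀ x y (γ : Path x y) i, (∀ t, γ t ∈ U i) → Q x y (.mk γ))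
    (p : PC x y) : Q x y p := by
  rcases p with ⟨γ⟩
  change Q x y (.mk γ)
  obtain ⟨t, ht0, hmono, ⟨N, hN⟩, hsub⟩ := exists_monotone_Icc_subset_open_cover_unitInterval
    (c := fun i => γ ⁻¹' U i) (fun i => (hU i).preimage γ.continuous)
    (fun s _ => mem_iUnion.2 (hcov (γ s)))
  have key : ∀ n, Q (γ (t 0)) (γ (t n)) (.mk (γ.subpath (t 0) (t n))) := by
    have step : ∀ n, Q (γ (t n)) (γ (t (n + 1))) (.mk (γ.subpath (t n) (t (n + 1)))) := by
      intro n
      obtain ⟨i, hi⟩ := hsub n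
      refine hsmall _ _ _ i fun s => ?_
      have : γ.subpath (t n) (t (n + 1)) s ∈ range (γ.subpath (t n) (t (n + 1))) := ⟨s, rfl⟩
      rw [Path.range_subpath_of_le _ _ _ (hmono n.le_succ)] at this
      obtain ⟨r, hr, hr'⟩ := this
      rw [← hr']
      exact hi hr
    intro n
    induction n with
    | zero =>
      obtain ⟨i, hi⟩ := hcov (γ (t 0))
      refine hsmall _ _ _ i fun s => ?_
      simpa using hi
    | succ n ih =>
      have h := htrans _ _ _ _ _ ih (step n)
      rwa [← Path.Homotopic.Quotient.mk_trans, Path.Homotopic.Quotient.eq.2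
        ⟨Path.Homotopy.subpathTransSubpath γ (t 0) (t n) (t (n + 1))⟩] at h
  have h := key N
  rw [ht0, hN N le_rfl, Path.subpath_zero_one] at h
  -- The endpoints of the subpath equal `x` and `y` only propositionally; generalising them lets the
  -- casts be substituted away.
  have : ∀ {a b : X} (ha : a = x) (hb : b = y), Q a b (.mk (γ.cast ha hb)) → Q x y (.mk γ) := by
    rintro a b rfl rfl h; exact h
  exact this _ _ h

end PathClass

/-! ### Extending a locally defined labelling of paths -/

section Transport

open unitInterval

set_option linter.checkUnivs false in
/-- Data for the construction of a homomorphism from a fundamental groupoid to a group: spaces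
over `X`, which have local sections, and compatible labellings of their path classes. -/
structure LocalLabelling (X : Type*) [TopologicalSpace X] (H : Type*) [Group H] where
  Idx : Type*
  Y : Idx → Type*
  top : ∀ i, TopologicalSpace (Y i)
  f : ∀ i, C(Y i, X)
  L : ∀ i {a b : Y i}, PC a b → H
  L_trans : ∀ i {a b c : Y i} (p : PC a b) (q : PC b c), L i (p ⬝ q) = L i p * L i q
  compat : ∀ i k {a b : Y i} {c d : Y k} (γ : Path a b) (δ : Path c d),
    (∀ t, f i (γ t) = f k (δ t)) → L i (.mk γ) = L k (.mk δ)
  -- Local sections replace an open cover: a piece is in general not open in `M`, but it has a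
  -- section over its part outside the collars.
  sec : ∀ x : X, ∃ U : Set X, IsOpen U ∧ x ∈ U ∧ ∃ i, ∃ s : C(U, Y i), ∀ u, f i (s u) = u

namespace LocalLabelling

variable {X : Type*} [TopologicalSpace X] {H : Type*} [Group H] (Λ : LocalLabelling X H)

attribute [instance] LocalLabelling.top

/-- The label of a path which lifts to one of the spaces over `X`. -/
def IsLabel (c : I → X) (h : H) : Prop :=
  ∃ i, ∃ (a b : Λ.Y i) (γ : Path a b), (∀ t, Λ.f i (γ t) = c t) ∧ h = Λ.L i (.mk γ)

-- By `compat` the choice of a lift does not matter. The default 1 for paths without a lift plays no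
-- role, since only fine subdivisions count.
open Classical in
noncomputable def label (c : I → X) : H := if h : ∃ g, Λ.IsLabel c g then h.choose else 1

lemma label_eq {i} {a b : Λ.Y i} (γ : Path a b) (c : I → X) (h : ∀ t, Λ.f i (γ t) = c t) :
    Λ.label c = Λ.L i (.mk γ) := by
  have hex : ∃ g, Λ.IsLabel c g := ⟨_, i, a, b, γ, h, rfl⟩
  rw [label, dif_pos hex]
  obtain ⟨k, a', b', δ, hδ, he⟩ := hex.choose_spec
  rw [he]
  exact Λ.compat _ _ _ _ fun t => by rw [hδ, h]

lemma L_refl (i) (a : Λ.Y i) : Λ.L i (.refl a) = 1 := by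
  have := Λ.L_trans i (.refl a) (.refl a)
  simpa using this

/-! ### Labels of segments and of subdivisions -/

variable {E : Type*} [NormedAddCommGroup E] [NormedSpace ℝ E]

/-- The label of the image of a segment. -/
noncomputable def seg (f : E → X) (p q : E) : H := Λ.label fun t => f (Path.segment p q t)

/-- The open set `U` is small: one of the spaces over `X` has a section over it. -/
def Small (U : Set X) : Prop := ∃ i, ∃ s : C(U, Λ.Y i), ∀ u, Λ.f i (s u) = u

lemma segment_mem {D : Set E} (hD : Convex ℝ D) {p q : E} (hp : p ∈ D) (hq : q ∈ D) (t : I) :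
    Path.segment p q t ∈ D := by
  have : Path.segment p q t = AffineMap.lineMap p q (t : ℝ) := rfl
  rw [this]
  exact hD.lineMap_mem hp hq ⟨t.2.1, t.2.2⟩

/-- A single section over `U` lifts all three segments. They are images of path classes in the
contractible set `D`, where the broken path and the direct segment are the same class. -/
lemma seg_trans {f : E → X} (hf : Continuous f) {D : Set E} (hD : Convex ℝ D) {U : Set X}
    (hU : Λ.Small U) (hDU : MapsTo f D U) {p q r : E} (hp : p ∈ D) (hq : q ∈ D) (hr : r ∈ D) :
    Λ.seg f p q * Λ.seg f q r = Λ.seg f p r := by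
  obtain ⟨i, s, hs⟩ := hU
  have : ContractibleSpace D := hD.contractibleSpace ⟨p, hp⟩
  let g : C(D, Λ.Y i) := s.comp ⟨fun x => ⟨f x, hDU x.2⟩, by fun_prop⟩
  have hg : ∀ x, Λ.f i (g x) = f x := fun x => hs _
  let sg : ∀ a b : D, Path a b := fun a b =>
    { toFun := fun t => ⟨Path.segment (a : E) b t, segment_mem hD a.2 b.2 t⟩
      continuous_toFun := by fun_prop
      source' := by simp
      target' := by simp }
  have key : ∀ a b : D, Λ.seg f a b = Λ.L i ((Path.Homotopic.Quotient.mk (sg a b)).map g) := by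
    intro a b
    rw [← Path.Homotopic.Quotient.mk_map]
    exact Λ.label_eq _ _ fun t => hg _
  have := key ⟨p, hp⟩ ⟨q, hq⟩
  have h2 := key ⟨q, hq⟩ ⟨r, hr⟩
  have h3 := key ⟨p, hp⟩ ⟨r, hr⟩
  simp only at this h2 h3
  rw [this, h2, h3, ← Λ.L_trans, ← map_of_trans]
  congr 2
  exact pathClass_unique _ _

lemma exists_ball_small {E : Type*} [PseudoMetricSpace E] {f : E → X} (hf : Continuous f) {K : Set E} (hK : IsCompact K) :
    ∃ δ > 0, ∀ p ∈ K, ∃ U, Λ.Small U ∧ MapsTo f (Metric.ball p δ) U := by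
  choose U hUo hxU hs using Λ.sec
  obtain ⟨δ, hδ, h⟩ := lebesgue_number_lemma_of_metric hK (c := fun x => f ⁻¹' U x)
    (fun x => (hUo x).preimage hf) (fun p _ => mem_iUnion.2 ⟨f p, hxU _⟩)
  refine ⟨δ, hδ, fun p hp => ?_⟩
  obtain ⟨x, hx⟩ := h p hp
  exact ⟨U x, hs x, hx⟩

/-- The product of the labels of the steps of the subdivision of `[0, 1]` into `n` equal parts. -/
noncomputable def stepProd (f : ℝ → X) (n : ℕ) : H :=
  ((List.range n).map fun k : ℕ => Λ.seg f ((k : ℝ) / n) (((k + 1 : ℕ) : ℝ) / n)).prod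

lemma prod_map_range_succ {H : Type*} [Group H] (a : ℕ → H) (n : ℕ) :
    ((List.range (n + 1)).map a).prod = ((List.range n).map a).prod * a n := by
  rw [List.range_succ]; simp

lemma prod_map_range_add {H : Type*} [Group H] (a : ℕ → H) (m n : ℕ) :
    ((List.range (m + n)).map a).prod =
      ((List.range m).map a).prod * ((List.range n).map fun k => a (m + k)).prod := by
  induction n with
  | zero => simp
  | succ n ih => rw [← add_assoc, prod_map_range_succ, ih, prod_map_range_succ, mul_assoc]

/-- The vertical edge is pushed through the row, one commuting square at a time. -/
lemma grid_row {H : Type*} [Group H] (a b : ℕ → ℕ → H) (n j : ℕ)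
    (h : ∀ k < n, a j k * b j (k + 1) = b j k * a (j + 1) k) (m : ℕ) (hm : m ≤ n) :
    ((List.range m).map (a j)).prod * b j m =
      b j 0 * ((List.range m).map (a (j + 1))).prod := by
  induction m with
  | zero => simp
  | succ m ih =>
    rw [prod_map_range_succ, prod_map_range_succ, mul_assoc, h m hm, ← mul_assoc, ih (by omega),
      mul_assoc]

lemma dist_grid {δ : ℝ} {n : ℕ} (hn : 0 < n) (hδ : 1 / (n : ℝ) < δ) (k : ℕ) :
    |((k + 1 : ℕ) : ℝ) / n - (k : ℝ) / n| < δ := by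
  have : (0 : ℝ) < n := by exact_mod_cast hn
  have h : ((k + 1 : ℕ) : ℝ) / n - (k : ℝ) / n = 1 / n := by push_cast; ring
  rw [h, abs_of_pos (by positivity)]
  exact hδ

lemma grid_mem {n : ℕ} (hn : 0 < n) {k : ℕ} (hk : k ≤ n) : (k : ℝ) / n ∈ Icc (0 : ℝ) 1 := by
  have : (0 : ℝ) < n := by exact_mod_cast hn
  refine ⟨by positivity, ?_⟩
  rw [div_le_one this]; exact_mod_cast hk

/-- Each of the `n` steps stays in one small set, where labels of segments are additive, so cutting
it into `m` parts changes nothing. -/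
lemma stepProd_mul {f : ℝ → X} (hf : Continuous f) {δ : ℝ}
    (hδ : ∀ p ∈ Icc (0 : ℝ) 1, ∃ U, Λ.Small U ∧ MapsTo f (Metric.ball p δ) U)
    {n m : ℕ} (hn : 0 < n) (hm : 0 < m) (hnδ : 1 / (n : ℝ) < δ) :
    Λ.stepProd f (n * m) = Λ.stepProd f n := by
  have hn' : (0 : ℝ) < n := by exact_mod_cast hn
  have hm' : (0 : ℝ) < m := by exact_mod_cast hm
  have hδ0 : 0 < δ := lt_trans (by positivity) hnδ
  set A : ℕ → H := fun k => Λ.seg f ((k : ℝ) / (n * m : ℕ)) (((k + 1 : ℕ) : ℝ) / (n * m : ℕ))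
    with hA
  set B : ℕ → H := fun k => Λ.seg f ((k : ℝ) / n) (((k + 1 : ℕ) : ℝ) / n) with hB
  have inner : ∀ k < n, ∀ l ≤ m, ((List.range l).map fun i => A (k * m + i)).prod =
      Λ.seg f ((k : ℝ) / n) (((k * m + l : ℕ) : ℝ) / (n * m : ℕ)) := by
    intro k hk l hl
    obtain ⟨U, hU, hfU⟩ := hδ ((k : ℝ) / n) (grid_mem hn hk.le)
    have hmem : ∀ l ≤ m, ((k * m + l : ℕ) : ℝ) / (n * m : ℕ) ∈ Metric.ball ((k : ℝ) / n) δ := by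
      intro l hl
      rw [Metric.mem_ball, Real.dist_eq]
      have : ((k * m + l : ℕ) : ℝ) / (n * m : ℕ) - (k : ℝ) / n = (l / m) * (1 / n) := by
        push_cast; field_simp; ring
      rw [this, abs_of_nonneg (by positivity)]
      refine lt_of_le_of_lt ?_ hnδ
      have : (l : ℝ) / m ≤ 1 := by rw [div_le_one hm']; exact_mod_cast hl
      have h0 : (0 : ℝ) ≤ 1 / n := by positivity
      nlinarith
    have h0 : (k : ℝ) / n = ((k * m + 0 : ℕ) : ℝ) / (n * m : ℕ) := by
      push_cast; field_simp; ring
    induction l with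
    | zero =>
      rw [h0]
      -- The label of a degenerate segment is idempotent, hence 1.
      have := Λ.seg_trans hf (convex_ball _ δ) hU hfU (hmem 0 (Nat.zero_le _))
        (hmem 0 (Nat.zero_le _)) (hmem 0 (Nat.zero_le _))
      rw [mul_eq_left] at this
      simpa using this.symm
    | succ l ih =>
      rw [prod_map_range_succ, ih (by omega), hA]
      exact Λ.seg_trans hf (convex_ball _ δ) hU hfU (Metric.mem_ball_self hδ0)
        (hmem l (by omega)) (hmem (l + 1) hl)
  have outer : ∀ k ≤ n, ((List.range (k * m)).map A).prod = ((List.range k).map B).prod := by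
    intro k hk
    induction k with
    | zero => simp
    | succ k ih =>
      rw [Nat.succ_mul, prod_map_range_add, prod_map_range_succ, ih (by omega),
        inner k (by omega) m le_rfl, hB]
      congr 2
      push_cast; field_simp
  exact outer n le_rfl

/-- The label of a map from the interval, defined by a sufficiently fine subdivision. -/
lemma exists_total {f : ℝ → X} (hf : Continuous f) :
    ∃ h, ∃ N : ℕ, ∀ n ≥ N, Λ.stepProd f n = h := by
  obtain ⟨δ, hδ0, hδ⟩ := Λ.exists_ball_small hf (isCompact_Icc (a := (0 : ℝ)) (b := 1))
  obtain ⟨N, hN⟩ := exists_nat_one_div_lt hδ0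
  have hbig : ∀ n ≥ N + 1, 0 < n ∧ 1 / (n : ℝ) < δ := by
    intro n hn
    refine ⟨by omega, lt_of_le_of_lt ?_ hN⟩
    apply one_div_le_one_div_of_le
    · positivity
    · exact_mod_cast hn
  refine ⟨Λ.stepProd f (N + 1), N + 1, fun n hn => ?_⟩
  -- Both subdivisions are compared with their common refinement into `n * (N + 1)` parts.
  rw [← Λ.stepProd_mul hf hδ (hbig n hn).1 (Nat.succ_pos N) (hbig n hn).2, mul_comm,
    Λ.stepProd_mul hf hδ (Nat.succ_pos N) (hbig n hn).1 (hbig _ le_rfl).2]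

/-! ### The total label of a path and its homotopy invariance -/

variable {x y z : X}

noncomputable def total (γ : Path x y) : H := (Λ.exists_total γ.continuous_extend).choose

lemma total_spec (γ : Path x y) : ∃ N : ℕ, ∀ n ≥ N, Λ.stepProd γ.extend n = Λ.total γ :=
  (Λ.exists_total γ.continuous_extend).choose_spec

lemma seg_real_apply (p q : ℝ) (t : I) : Path.segment p q t = (1 - (t : ℝ)) * p + t * q := by
  have : Path.segment p q t = AffineMap.lineMap p q (t : ℝ) := rfl
  rw [this, AffineMap.lineMap_apply_ring']; ring

/-- The concatenation runs at double speed, so its subdivision into `n + n` parts consists of the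
subdivisions of the two paths into `n` parts. -/
lemma total_trans (γ : Path x y) (δ : Path y z) :
    Λ.total (γ.trans δ) = Λ.total γ * Λ.total δ := by
  obtain ⟨N₁, h₁⟩ := Λ.total_spec γ
  obtain ⟨N₂, h₂⟩ := Λ.total_spec δ
  obtain ⟨N₃, h₃⟩ := Λ.total_spec (γ.trans δ)
  set n := N₁ + N₂ + N₃ + 1 with hn
  have hn' : (0 : ℝ) < n := by rw [hn]; positivity
  rw [← h₁ n (by omega), ← h₂ n (by omega), ← h₃ (n + n) (by omega)]
  unfold stepProd
  rw [prod_map_range_add]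
  have hk : ∀ (t : I) (k : ℕ), k < n → 0 ≤ (1 - (t : ℝ)) * (k / n) + t * (((k + 1 : ℕ) : ℝ) / n) ∧
      (1 - (t : ℝ)) * (k / n) + t * (((k + 1 : ℕ) : ℝ) / n) ≤ 1 := by
    intro t k hk
    have h1 := grid_mem (by omega : 0 < n) hk.le
    have h2 := grid_mem (by omega : 0 < n) (Nat.succ_le_of_lt hk)
    have := (convex_Icc (0 : ℝ) 1) h1 h2 (sub_nonneg.2 t.2.2) t.2.1 (by ring)
    exact this
  congr 2
  · refine List.map_congr_left fun k hk' => ?_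
    have hkn : k < n := by simpa using hk'
    unfold seg
    congr 1
    funext t
    rw [seg_real_apply, seg_real_apply]
    have e : (1 - (t : ℝ)) * ((k : ℝ) / (n + n : ℕ)) + t * (((k + 1 : ℕ) : ℝ) / (n + n : ℕ)) =
        ((1 - (t : ℝ)) * (k / n) + t * (((k + 1 : ℕ) : ℝ) / n)) / 2 := by
      push_cast; field_simp; ring
    rw [e]
    obtain ⟨h0, h1⟩ := hk t k hkn
    set r := (1 - (t : ℝ)) * (k / n) + t * (((k + 1 : ℕ) : ℝ) / n)
    rw [Path.extend_apply _ ⟨by linarith, by linarith⟩, Path.trans_apply, dif_pos (by simp; linarith),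
      Path.extend_apply _ ⟨h0, h1⟩]
    congr 1; ext; simp; ring
  · refine List.map_congr_left fun k hk' => ?_
    have hkn : k < n := by simpa using hk'
    unfold seg
    congr 1
    funext t
    rw [seg_real_apply, seg_real_apply]
    have e : (1 - (t : ℝ)) * (((n + k : ℕ) : ℝ) / (n + n : ℕ)) +
        t * (((n + k + 1 : ℕ) : ℝ) / (n + n : ℕ)) =
        (1 + ((1 - (t : ℝ)) * (k / n) + t * (((k + 1 : ℕ) : ℝ) / n))) / 2 := by
      push_cast; field_simp; ring
    rw [e]
    obtain ⟨h0, h1⟩ := hk t k hkn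
    set r := (1 - (t : ℝ)) * (k / n) + t * (((k + 1 : ℕ) : ℝ) / n)
    rw [Path.extend_apply _ ⟨by linarith, by linarith⟩, Path.extend_apply _ ⟨h0, h1⟩,
      Path.trans_apply]
    split_ifs with hle
    -- This happens only at the junction, where `Path.trans` still uses the first path and both
    -- paths give `y`.
    · have hr : r = 0 := by simp at hle; linarith
      simp [hr]
    · congr 1; ext; simp; ring

/-- The square of the homotopy is cut into a fine grid. Each cell lies in a small set, so its two
boundary routes have the same label, and the sides of the square are constant; hence all rows have
the same product. -/
lemma total_homotopic {γ δ : Path x y} (h : γ.Homotopic δ) : Λ.total γ = Λ.total δ := by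
  obtain ⟨F⟩ := h
  obtain ⟨N₁, h₁⟩ := Λ.total_spec γ
  obtain ⟨N₂, h₂⟩ := Λ.total_spec δ
  let f : ℝ × ℝ → X := fun p => F (projIcc 0 1 zero_le_one p.1, projIcc 0 1 zero_le_one p.2)
  have hf : Continuous f := F.continuous.comp
    ((continuous_projIcc.comp continuous_fst).prodMk (continuous_projIcc.comp continuous_snd))
  obtain ⟨ε, hε0, hε⟩ := Λ.exists_ball_small hf
    ((isCompact_Icc (a := (0 : ℝ)) (b := 1)).prod (isCompact_Icc (a := (0 : ℝ)) (b := 1)))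
  obtain ⟨N, hN⟩ := exists_nat_one_div_lt hε0
  set n := N₁ + N₂ + N + 1 with hn
  have hn0 : 0 < n := by omega
  have hnε : 1 / (n : ℝ) < ε := by
    refine lt_of_le_of_lt (one_div_le_one_div_of_le (by positivity) ?_) hN
    rw [hn]; push_cast; linarith [(Nat.cast_nonneg N₁ : (0 : ℝ) ≤ N₁), (Nat.cast_nonneg N₂ : (0 : ℝ) ≤ N₂)]
  let c : ℕ → ℝ := fun k => (k : ℝ) / n
  let a : ℕ → ℕ → H := fun j k => Λ.seg f (c j, c k) (c j, c (k + 1))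
  let b : ℕ → ℕ → H := fun j k => Λ.seg f (c j, c k) (c (j + 1), c k)
  have hab : ∀ j < n, ∀ k < n, a j k * b j (k + 1) = b j k * a (j + 1) k := by
    intro j hj k hk
    obtain ⟨U, hU, hfU⟩ := hε (c j, c k) ⟨grid_mem hn0 hj.le, grid_mem hn0 hk.le⟩
    have hmem : ∀ u v, |u - c j| < ε → |v - c k| < ε → (u, v) ∈ Metric.ball (c j, c k) ε := by
      intro u v hu hv
      rw [Metric.mem_ball, Prod.dist_eq, Real.dist_eq, Real.dist_eq]
      exact max_lt hu hv
    have z : ∀ r : ℝ, |r - r| < ε := by simpa using hε0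
    have hcj := dist_grid hn0 hnε j
    have hck := dist_grid hn0 hnε k
    have m00 := hmem _ _ (z (c j)) (z (c k))
    have m01 := hmem _ _ (z (c j)) hck
    have m10 := hmem _ _ hcj (z (c k))
    have m11 := hmem _ _ hcj hck
    have e1 := Λ.seg_trans hf (convex_ball _ ε) hU hfU m00 m01 m11
    have e2 := Λ.seg_trans hf (convex_ball _ ε) hU hfU m00 m10 m11
    exact e1.trans e2.symm
  -- A vertical edge in a side of the square is a constant path, which lifts to a constant path in
  -- any local section.
  have const : ∀ (k j : ℕ) (w : X), (∀ s, f (s, c k) = w) → b j k = 1 := by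
    intro k j w hw
    obtain ⟨U, hU, hfU⟩ := hε (0, 0) ⟨⟨le_rfl, zero_le_one⟩, ⟨le_rfl, zero_le_one⟩⟩
    obtain ⟨V, hVo, hwV, i, s, hs⟩ := Λ.sec w
    have : b j k = Λ.L i (.mk (Path.refl (s ⟨w, hwV⟩))) := by
      refine Λ.label_eq _ _ fun t => ?_
      have hfst : Path.segment (c j, c k) (c (j + 1), c k) t =
          ((Path.segment (c j, c k) (c (j + 1), c k) t).1, c k) := by
        refine Prod.ext rfl ?_
        have : Path.segment (c j, c k) (c (j + 1), c k) t =
          AffineMap.lineMap (c j, c k) (c (j + 1), c k) (t : ℝ) := rfl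
        rw [this]
        simp [AffineMap.lineMap_apply]
      rw [hfst, hw]
      simp [hs]
    rw [this, Path.Homotopic.Quotient.mk_refl, L_refl]
  have c0 : projIcc (0 : ℝ) 1 zero_le_one (c 0) = 0 := by simp [c]
  have c1 : projIcc (0 : ℝ) 1 zero_le_one (c n) = 1 := by
    have : c n = 1 := by simp only [c]; field_simp
    rw [this]; simp
  have rows : ∀ j ≤ n, ((List.range n).map (a j)).prod = ((List.range n).map (a 0)).prod := by
    intro j hj
    induction j with
    | zero => rfl
    | succ j ih =>
      rw [← ih (by omega)]
      have := grid_row a b n j (hab j (by omega)) n le_rfl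
      rw [const n j y (by intro s; simp only [f, c1]; exact F.target _),
        const 0 j x (by intro s; simp only [f, c0]; exact F.source _)] at this
      simpa using this.symm
  have edge : ∀ (j : ℕ) (ρ : Path x y), (∀ t : ℝ, f (c j, t) = ρ.extend t) →
      ((List.range n).map (a j)).prod = Λ.stepProd ρ.extend n := by
    intro j ρ hρ
    unfold stepProd
    congr 1
    refine List.map_congr_left fun k _ => ?_
    simp only [a, seg]
    congr 1
    funext t
    have hseg : Path.segment (c j, c k) (c j, c (k + 1)) t =
        (c j, Path.segment (c k) (c (k + 1)) t) := by
      have e1 : Path.segment (c j, c k) (c j, c (k + 1)) t =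
        AffineMap.lineMap (c j, c k) (c j, c (k + 1)) (t : ℝ) := rfl
      have e2 : Path.segment (c k) (c (k + 1)) t =
        AffineMap.lineMap (c k) (c (k + 1)) (t : ℝ) := rfl
      rw [e1, e2]
      refine Prod.ext ?_ ?_ <;> simp [AffineMap.lineMap_apply]
    rw [hseg, hρ]
  rw [← h₁ n (by omega), ← h₂ n (by omega)]
  rw [← edge 0 γ, ← edge n δ, rows n le_rfl]
  · intro t; simp only [f, c1]; rw [F.apply_one]; rfl
  · intro t; simp only [f, c0]; rw [F.apply_zero]; rfl

/-- The homomorphism from the fundamental groupoid defined by a local labelling. -/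
noncomputable def transport (p : PC x y) : H :=
  Quotient.lift (fun γ : Path x y => Λ.total γ) (fun _ _ h => Λ.total_homotopic h) p

lemma transport_trans (p : PC x y) (q : PC y z) :
    Λ.transport (p ⬝ q) = Λ.transport p * Λ.transport q := by
  rcases p with ⟨p⟩; rcases q with ⟨q⟩
  exact Λ.total_trans p q

lemma transport_refl (x : X) : Λ.transport (.refl x) = 1 := by
  have := Λ.transport_trans (.refl x) (.refl x)
  simpa using this

lemma transport_symm (p : PC x y) : Λ.transport p.symm = (Λ.transport p)⁻¹ := by
  rw [eq_inv_iff_mul_eq_one, ← transport_trans]; simp [transport_refl]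

/-- The steps of a path which lifts have lifts that are consecutive parts of a single path in `Y i`,
so the product telescopes for every subdivision. -/
lemma transport_map (i) {a b : Λ.Y i} (p : PC a b) : Λ.transport (p.map (Λ.f i)) = Λ.L i p := by
  rcases p with ⟨γ⟩
  change Λ.total (γ.map (Λ.f i).continuous) = Λ.L i (.mk γ)
  obtain ⟨N, hN⟩ := Λ.total_spec (γ.map (Λ.f i).continuous)
  -- `N + 1` parts rather than `N`, so that the step length is not a division by zero.
  rw [← hN (N + 1) (by omega)]
  have hstep : ∀ k : ℕ, Λ.seg (γ.map (Λ.f i).continuous).extend ((k : ℝ) / (N + 1 : ℕ))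
      (((k + 1 : ℕ) : ℝ) / (N + 1 : ℕ)) = Λ.L i ((Path.Homotopic.Quotient.mk
        (Path.segment ((k : ℝ) / (N + 1 : ℕ)) (((k + 1 : ℕ) : ℝ) / (N + 1 : ℕ)))).map
          ⟨γ.extend, γ.continuous_extend⟩) := by
    intro k
    rw [← Path.Homotopic.Quotient.mk_map]
    exact Λ.label_eq _ _ fun t => rfl
  have key : ∀ m : ℕ, ((List.range m).map fun k : ℕ =>
      Λ.seg (γ.map (Λ.f i).continuous).extend ((k : ℝ) / (N + 1 : ℕ))
        (((k + 1 : ℕ) : ℝ) / (N + 1 : ℕ))).prod = Λ.L i ((Path.Homotopic.Quotient.mk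
        (Path.segment (((0 : ℕ) : ℝ) / (N + 1 : ℕ)) ((m : ℝ) / (N + 1 : ℕ)))).map
          ⟨γ.extend, γ.continuous_extend⟩) := by
    intro m
    induction m with
    | zero =>
      rw [pathClass_unique (Path.Homotopic.Quotient.mk _) (.refl _), map_of_refl, L_refl]; simp
    | succ m ih =>
      rw [prod_map_range_succ, ih, hstep, ← Λ.L_trans, ← map_of_trans]
      congr 2
      exact pathClass_unique _ _
  unfold stepProd
  rw [key (N + 1), ← Path.Homotopic.Quotient.mk_map, ← Λ.label_eq γ _ fun t => rfl]
  rw [← Λ.label_eq _ _ fun t => rfl]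
  congr 1
  funext t
  have : Path.segment (((0 : ℕ) : ℝ) / (N + 1 : ℕ)) (((N + 1 : ℕ) : ℝ) / (N + 1 : ℕ)) t = t := by
    rw [seg_real_apply]
    have : ((N + 1 : ℕ) : ℝ) ≠ 0 := by positivity
    field_simp
    simp
  change Λ.f i (γ.extend _) = _
  rw [this]
  simp

end LocalLabelling

end Transport

/-! ### Topology of the pieces -/

namespace TorusSystem

@[simp] lemma sgn_true : sgn true = 1 := rfl
@[simp] lemma sgn_false : sgn false = -1 := rfl

/-- The closed half-line `[1, ∞)` for `s = true`, `(-∞, -1]` for `s = false`. -/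
abbrev Ray (s : Bool) : Type := {r : ℝ // 1 ≤ sgn s * r}

/-- The end of the half-line. -/
noncomputable def Ray.tip (s : Bool) : Ray s := ⟨sgn s, by cases s <;> norm_num [sgn]⟩

instance (s : Bool) : ContractibleSpace (Ray s) := by
  have hc : Convex ℝ {r : ℝ | 1 ≤ sgn s * r} := by
    have : {r : ℝ | 1 ≤ sgn s * r} = (fun r => sgn s • r) ⁻¹' Ici 1 := by ext; simp
    rw [this]
    exact (convex_Ici 1).is_linear_preimage (IsLinearMap.isLinearMap_smul _)
  exact hc.contractibleSpace ⟨sgn s, (Ray.tip s).2⟩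

lemma one_le_abs_iff {r : ℝ} : r ∉ Ioo (-1 : ℝ) 1 ↔ ∃ s, 1 ≤ sgn s * r := by
  simp only [mem_Ioo, Bool.exists_bool, sgn_false, sgn_true]
  constructor
  · intro h
    by_cases h1 : r < 1
    · left
      by_contra h2
      exact h ⟨by linarith, h1⟩
    · right; linarith
  · rintro (h | h) ⟨h1, h2⟩ <;> linarith

variable {M : Type*} [TopologicalSpace M] (S : TorusSystem M)

/-- The product neighbourhood of a torus, as a continuous map. -/
def collarMap (j : S.ι) : C(Torus × ℝ, M) :=
  ⟨(S.collar j).toFun, (S.collar j).isOpenEmbedding.continuous⟩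

variable {S}

lemma collarMap_injective (j : S.ι) : Function.Injective (S.collarMap j) :=
  (S.collar j).isOpenEmbedding.injective

lemma eq_of_collarMap_eq {j k : S.ι} {p q : Torus × ℝ} (h : S.collarMap j p = S.collarMap k q) :
    j = k := by
  by_contra hjk
  exact (Set.disjoint_left.1 (S.disjoint hjk)) ⟨p, rfl⟩ ⟨q, h.symm⟩

lemma collarMap_mem_cut {j : S.ι} {p : Torus × ℝ} :
    S.collarMap j p ∈ S.cut ↔ ∃ s, 1 ≤ sgn s * p.2 := by
  rw [← one_le_abs_iff]
  simp only [cut, mem_compl_iff, mem_iUnion, not_exists]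
  constructor
  · exact fun h hp => h j ⟨p, ⟨mem_univ _, hp⟩, rfl⟩
  · rintro h k ⟨q, ⟨-, hq⟩, he⟩
    have := eq_of_collarMap_eq (S := S) (j := k) (k := j) he
    subst this
    rw [collarMap_injective k he] at hq
    exact h hq

lemma mem_piece {v : S.Vertex} {x : M} : x ∈ S.piece v ↔ ∃ h : x ∈ S.cut, ((⟨x, h⟩ : S.cut) : S.Vertex) = v := by
  constructor
  · rintro ⟨y, hy, rfl⟩; exact ⟨y.2, hy⟩
  · rintro ⟨h, e⟩; exact ⟨⟨x, h⟩, e, rfl⟩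

lemma piece_subset_cut (v : S.Vertex) : S.piece v ⊆ S.cut := fun _ h => (mem_piece.1 h).1

lemma eq_of_mem_piece {v w : S.Vertex} {x : M} (hv : x ∈ S.piece v) (hw : x ∈ S.piece w) :
    v = w := by
  obtain ⟨h, rfl⟩ := mem_piece.1 hv
  exact (mem_piece.1 hw).2

/-- A connected space mapped to the cut manifold goes to one piece. -/
lemma mem_piece_of_preconnected {Z : Type*} [TopologicalSpace Z] [PreconnectedSpace Z] (f : C(Z, M))
    (hf : ∀ z, f z ∈ S.cut) {v : S.Vertex} {z₀ : Z} (h : f z₀ ∈ S.piece v) (z : Z) :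
    f z ∈ S.piece v := by
  obtain ⟨h₀, rfl⟩ := mem_piece.1 h
  refine mem_piece.2 ⟨hf z, ?_⟩
  let g : Z → S.cut := fun z => ⟨f z, hf z⟩
  have hg : Continuous g := by fun_prop
  have := (isPreconnected_range hg).subset_connectedComponent (x := g z₀) ⟨z₀, rfl⟩ ⟨z, rfl⟩
  exact ConnectedComponents.coe_eq_coe'.2 this

/-- The half of the collar beyond the boundary torus. -/
noncomputable def halfCollar (j : S.ι) (s : Bool) : C(Torus × Ray s, M) :=
  (S.collarMap j).comp ⟨fun p => (p.1, p.2.1), by fun_prop⟩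

lemma halfCollar_mem_cut (j : S.ι) (s : Bool) (p : Torus × Ray s) : halfCollar j s p ∈ S.cut :=
  collarMap_mem_cut.2 ⟨s, p.2.2⟩

lemma LiesIn.halfCollar_mem {j : S.ι} {s : Bool} {v : S.Vertex} (h : S.LiesIn j s v)
    (p : Torus × Ray s) : halfCollar j s p ∈ S.piece v :=
  mem_piece_of_preconnected (halfCollar j s) (halfCollar_mem_cut j s) (z₀ := (1, Ray.tip s)) (h 1) p

/-- The half-collar is connected, so one of its points decides in which piece it lies. -/
lemma liesIn_of_mem {j : S.ι} {s : Bool} {v : S.Vertex} {p : Torus × Ray s}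
    (h : halfCollar j s p ∈ S.piece v) : S.LiesIn j s v := fun t =>
  mem_piece_of_preconnected (halfCollar j s) (halfCollar_mem_cut j s) h (t, Ray.tip s)

lemma LiesIn.unique {j : S.ι} {s : Bool} {v w : S.Vertex} (hv : S.LiesIn j s v)
    (hw : S.LiesIn j s w) : v = w := eq_of_mem_piece (hv 1) (hw 1)

lemma exists_liesIn (j : S.ι) (s : Bool) : ∃ v, S.LiesIn j s v :=
  ⟨_, liesIn_of_mem (p := (1, Ray.tip s)) (mem_piece.2 ⟨halfCollar_mem_cut j s _, rfl⟩)⟩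

/-- The half of the collar beyond the boundary torus, as a map into the piece. -/
noncomputable def halfMap (j : S.ι) (s : Bool) {v : S.Vertex} (h : S.LiesIn j s v) :
    C(Torus × Ray s, S.piece v) :=
  ⟨fun p => ⟨halfCollar j s p, h.halfCollar_mem p⟩, by fun_prop⟩

lemma Edge.ext_data {a b : S.Vertex} {e f : S.Edge a b} (h : e.torus = f.torus)
    (h' : e.pos = f.pos) : e = f := by
  cases e; cases f; simp at h h'; subst h h'; rfl

/-- The inverse edge. -/
def Edge.rev {a b : S.Vertex} (e : S.Edge a b) : S.Edge b a :=
  ⟨e.torus, !e.pos, by simpa using e.tgt, e.src⟩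

/-- The points of a collar which are in a piece. -/
lemma exists_halfMap_eq {j : S.ι} {p : Torus × ℝ} {v : S.Vertex} (h : S.collarMap j p ∈ S.piece v) :
    ∃ (s : Bool) (hs : 1 ≤ sgn s * p.2), S.LiesIn j s v ∧
      halfCollar j s (p.1, ⟨p.2, hs⟩) = S.collarMap j p := by
  obtain ⟨s, hs⟩ := collarMap_mem_cut.1 (piece_subset_cut v h)
  exact ⟨s, hs, liesIn_of_mem (p := (p.1, ⟨p.2, hs⟩)) h, rfl⟩

variable (S) in
/-- The closed regular neighbourhood of the tori. -/
def closedCollar : Set M := ⋃ j, (S.collarMap j) '' (univ ×ˢ Icc (-1 : ℝ) 1)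

lemma compl_closedCollar_subset : (S.closedCollar)ᶜ ⊆ S.cut := by
  intro x hx hx'
  apply hx
  obtain ⟨j, hj⟩ := mem_iUnion.1 hx'
  refine mem_iUnion.2 ⟨j, ?_⟩
  obtain ⟨p, ⟨h1, h2⟩, rfl⟩ := hj
  exact ⟨p, ⟨h1, Ioo_subset_Icc_self h2⟩, rfl⟩

variable (S) in
/-- The part of a piece outside the collars. -/
def innerPiece (v : S.Vertex) : Set M := S.piece v ∩ S.closedCollarᶜ

/-- The open cover used for subdivisions: the pieces, which contain boundary tori, are replaced by
their parts outside the closed collars. -/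
lemma exists_cover (x : M) : (∃ v, x ∈ S.innerPiece v) ∨ ∃ j, x ∈ range (S.collarMap j) := by
  by_cases hx : x ∈ S.closedCollar
  · right
    obtain ⟨j, p, -, rfl⟩ := mem_iUnion.1 hx
    exact ⟨j, p, rfl⟩
  · left
    exact ⟨_, mem_piece.2 ⟨compl_closedCollar_subset hx, rfl⟩, hx⟩

variable [T2Space M]

lemma isClosed_closedCollar : IsClosed S.closedCollar := by
  have := S.finite
  refine isClosed_iUnion_of_finite fun j => ?_
  exact ((isCompact_univ.prod isCompact_Icc).image (S.collarMap j).continuous).isClosed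

variable [LocallyPathConnectedSpace M]

/-- Every point outside the collars has a neighbourhood in its piece whose points are joined to it
within the piece. -/
lemma exists_nhds_joined {v : S.Vertex} {x : M} (hx : x ∈ S.piece v) (hx' : x ∉ S.closedCollar) :
    ∃ V ∈ 𝓝 x, V ⊆ S.closedCollarᶜ ∧ ∀ y ∈ V, JoinedIn (S.piece v) x y := by
  obtain ⟨V, ⟨hV, hVc⟩, hVsub⟩ := (LocallyPathConnectedSpace.path_connected_basis x).mem_iff.1
    ((isClosed_closedCollar (S := S)).isOpen_compl.mem_nhds hx')
  refine ⟨V, hV, hVsub, fun y hy => ?_⟩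
  obtain ⟨γ, hγ⟩ := hVc.joinedIn x (mem_of_mem_nhds hV) y hy
  refine ⟨γ, fun t => mem_piece_of_preconnected γ.toContinuousMap
    (fun t => compl_closedCollar_subset (hVsub (hγ t))) (z₀ := 0) ?_ t⟩
  simpa using hx

lemma isOpen_innerPiece (v : S.Vertex) : IsOpen (S.innerPiece v) := by
  rw [isOpen_iff_mem_nhds]
  rintro x ⟨hx, hx'⟩
  obtain ⟨V, hV, hVs, hj⟩ := exists_nhds_joined hx hx'
  exact Filter.mem_of_superset hV fun y hy => ⟨(hj y hy).target_mem, hVs hy⟩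

/-- A piece is connected, so it suffices that each point is joined to all points near it. Off the
closed collars this comes from the local path-connectedness of `M`; at the boundary tori and in the
collars it comes from the product structure of a half-collar. -/
instance (v : S.Vertex) : PathConnectedSpace (S.piece v) := by
  have hne : Nonempty (S.piece v) := by
    obtain ⟨x, rfl⟩ := ConnectedComponents.surjective_coe v
    exact ⟨⟨x, mem_piece.2 ⟨x.2, rfl⟩⟩⟩
  have hpre : PreconnectedSpace (S.piece v) := by
    obtain ⟨x, rfl⟩ := ConnectedComponents.surjective_coe v
    have : S.piece (x : S.Vertex) = Subtype.val '' connectedComponent x := by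
      unfold piece
      congr 1
      ext y
      exact ConnectedComponents.coe_eq_coe'
    rw [this]
    exact isPreconnected_iff_preconnectedSpace.1
      (isPreconnected_connectedComponent.image _ continuous_subtype_val.continuousOn)
  have hloc : ∀ x : S.piece v, ∃ N ∈ 𝓝 x, ∀ y ∈ N, Joined x y := by
    rintro ⟨x, hx⟩
    by_cases hx' : x ∈ S.closedCollar
    · obtain ⟨j, p, ⟨-, hp⟩, rfl⟩ := mem_iUnion.1 hx'
      obtain ⟨s, hs, hl, he⟩ := exists_halfMap_eq hx
      -- This open half of the collar meets the piece only in points with collar coordinate beyond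
      -- `±1` on the side `s`, that is, in one half-collar.
      have hopen : IsOpen (S.collarMap j '' {q | 0 < sgn s * q.2}) :=
        (S.collar j).isOpenEmbedding.isOpenMap _
          (isOpen_lt continuous_const (by fun_prop))
      refine ⟨Subtype.val ⁻¹' (S.collarMap j '' {q | 0 < sgn s * q.2}),
        (hopen.preimage continuous_subtype_val).mem_nhds ⟨p, ?_, rfl⟩, ?_⟩
      · simp only [mem_ofPred_eq]; linarith
      · rintro ⟨y, hy⟩ ⟨q, hq, rfl⟩
        obtain ⟨s', hs', hl', he'⟩ := exists_halfMap_eq hy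
        have : s' = s := by
          simp only [mem_ofPred_eq] at hq
          cases s <;> cases s' <;> simp at hq hs' ⊢ <;> linarith
        subst this
        obtain ⟨γ⟩ := PathConnectedSpace.joined ((p.1, ⟨p.2, hs⟩) : Torus × Ray s')
          (q.1, ⟨q.2, hs'⟩)
        exact ⟨(γ.map (halfMap j s' hl).continuous).cast (Subtype.ext he.symm) (Subtype.ext he'.symm)⟩
    · obtain ⟨V, hV, -, hj⟩ := exists_nhds_joined hx hx'
      refine ⟨Subtype.val ⁻¹' V, continuous_subtype_val.continuousAt.preimage_mem_nhds hV, ?_⟩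
      rintro ⟨y, hy⟩ hyV
      exact (joinedIn_iff_joined hx hy).1 (hj y hyV)
  refine ⟨hne, fun x y => ?_⟩
  have hclopen : IsClopen (pathComponent x) := by
    constructor
    · rw [← isOpen_compl_iff, isOpen_iff_mem_nhds]
      intro z hz
      obtain ⟨N, hN, hj⟩ := hloc z
      exact Filter.mem_of_superset hN fun w hw hxw => hz (hxw.trans (hj w hw).symm)
    · rw [isOpen_iff_mem_nhds]
      intro z hz
      obtain ⟨N, hN, hj⟩ := hloc z
      exact Filter.mem_of_superset hN fun w hw => Joined.trans hz (hj w hw)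
  have := (isClopen_iff.1 hclopen).resolve_left (Nonempty.ne_empty ⟨x, Joined.refl x⟩)
  have hy : y ∈ pathComponent x := this ▸ mem_univ y
  exact hy

end TorusSystem

/-! ### Vertex groups, edge groups and stable letters in the fundamental groupoid -/

section ProdLift

variable {X Y : Type*} [TopologicalSpace X] [TopologicalSpace Y] [SimplyConnectedSpace Y]

/-- The class in `X × Y`, `Y` simply connected, which lifts a class in `X`. -/
noncomputable def prodLift {x y : X} (c : PC x y) (a b : Y) : PC (x, a) (y, b) :=
  Path.Homotopic.prod c (.mk (PathConnectedSpace.somePath a b))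

@[simp] lemma projLeft_prodLift {x y : X} (c : PC x y) (a b : Y) :
    (prodLift c a b).map ⟨Prod.fst, continuous_fst⟩ = c :=
  Path.Homotopic.projLeft_prod _ _

lemma map_prodMk {x y : X} (c : PC x y) (a : Y) :
    c.map ⟨fun x => (x, a), by fun_prop⟩ = prodLift c a a := by
  apply pathClass_prod_ext
  change _ = (prodLift c a a).map ⟨Prod.fst, continuous_fst⟩
  rw [projLeft_prodLift]
  rcases c with ⟨c⟩
  rfl

end ProdLift

/-- The fundamental group, with concatenation as product. -/
noncomputable instance pi1Group {X : Type*} [TopologicalSpace X] (x : X) : Group (Pi1 x) where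
  mul p q := p ⬝ q
  one := .refl x
  inv p := p.symm
  mul_assoc := Path.Homotopic.Quotient.trans_assoc
  one_mul := Path.Homotopic.Quotient.refl_trans
  mul_one := Path.Homotopic.Quotient.trans_refl
  inv_mul_cancel := Path.Homotopic.Quotient.symm_trans

lemma pi1_mul_def {X : Type*} [TopologicalSpace X] {x : X} (p q : Pi1 x) : p * q = p ⬝ q := rfl
lemma pi1_one_def {X : Type*} [TopologicalSpace X] {x : X} : (1 : Pi1 x) = .refl x := rfl
lemma pi1_inv_def {X : Type*} [TopologicalSpace X] {x : X} (p : Pi1 x) : p⁻¹ = p.symm := rfl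

namespace TorusSystem

variable {M : Type*} [TopologicalSpace M] {S : TorusSystem M}

namespace Basing

variable (B : S.Basing)

/-- The class of the arc to a boundary torus. -/
noncomputable def arcC (j : S.ι) (s : Bool) {v : S.Vertex} (h : S.LiesIn j s v) :
    PC (B.base v) (halfMap j s h (1, Ray.tip s)) := .mk (B.arc j s v h)

/-- The class of the arc to a boundary torus, in `M`. -/
noncomputable def arcM (j : S.ι) (s : Bool) {v : S.Vertex} (h : S.LiesIn j s v) :
    PC (B.pt v) (S.collarMap j (1, sgn s)) := (B.arcC j s h).map (S.incl v)

/-- The loop is moved into the half-collar, whose second factor is contractible, so that path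
classes there can be compared through their torus component. -/
lemma sideHom_eq (j : S.ι) (s : Bool) {v : S.Vertex} (h : S.LiesIn j s v) (c : EdgeGroup) :
    B.sideHom j s h c = B.arcC j s h ⬝ (prodLift c (Ray.tip s) (Ray.tip s)).map (halfMap j s h) ⬝
      (B.arcC j s h).symm := by
  rw [← map_prodMk, ← Path.Homotopic.Quotient.map_comp]
  rfl

/-- The map from the half-collar to the collar. -/
noncomputable def rayIncl (s : Bool) : C(Torus × Ray s, Torus × ℝ) :=
  ⟨fun p => (p.1, p.2.1), by fun_prop⟩

lemma map_halfMap_incl {j : S.ι} {s : Bool} {v : S.Vertex} (h : S.LiesIn j s v)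
    {p q : Torus × Ray s} (c : PC p q) :
    (c.map (halfMap j s h)).map (S.incl v) = (c.map (rayIncl s)).map (S.collarMap j) := by
  rw [← Path.Homotopic.Quotient.map_comp, ← Path.Homotopic.Quotient.map_comp]
  rfl

lemma map_rayIncl_prodLift {s : Bool} {x y : Torus} (c : PC x y) (a b : Ray s) :
    (prodLift c a b).map (rayIncl s) = prodLift c (a : ℝ) (b : ℝ) := by
  apply pathClass_prod_ext
  change ((prodLift c a b).map (rayIncl s)).map _ = (prodLift c (a : ℝ) (b : ℝ)).map _
  rw [projLeft_prodLift, ← Path.Homotopic.Quotient.map_comp]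
  exact projLeft_prodLift c a b

lemma toM_sideHom (j : S.ι) (s : Bool) {v : S.Vertex} (h : S.LiesIn j s v) (c : EdgeGroup) :
    B.toM (B.sideHom j s h c) = B.arcM j s h ⬝
      (prodLift c (sgn s) (sgn s)).map (S.collarMap j) ⬝ (B.arcM j s h).symm := by
  rw [toM, sideHom_eq, map_of_trans, map_of_trans, map_halfMap_incl, map_rayIncl_prodLift,
    map_of_symm]
  rfl

lemma mk_crossing {a b : S.Vertex} (e : S.Edge a b) :
    Path.Homotopic.Quotient.mk (crossing e) =
      (prodLift (.refl (1 : Torus)) (sgn (!e.pos)) (sgn e.pos)).map (S.collarMap e.torus) := by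
  have : Path.Homotopic.Quotient.mk (crossing e) =
      (Path.Homotopic.prod (.refl (1 : Torus))
        (.mk (Path.segment (sgn (!e.pos)) (sgn e.pos)))).map (S.collarMap e.torus) := by
    refine map_mk_congr fun t => ?_
    change (S.collar e.torus).toFun _ = (S.collar e.torus).toFun (1, Path.segment _ _ t)
    rw [LocalLabelling.seg_real_apply]
  rw [this]
  congr 1
  apply pathClass_prod_ext
  rw [Path.Homotopic.projLeft_prod]
  exact (projLeft_prodLift _ _ _).symm

lemma stable_eq {a b : S.Vertex} (e : S.Edge a b) :
    B.stable e = B.arcM e.torus (!e.pos) e.src ⬝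
      (prodLift (.refl (1 : Torus)) (sgn (!e.pos)) (sgn e.pos)).map (S.collarMap e.torus) ⬝
      (B.arcM e.torus e.pos e.tgt).symm := by
  rw [← mk_crossing]
  rfl

lemma collar_ext {a b : Torus × ℝ} {p q : PC a b}
    (h : p.map ⟨Prod.fst, continuous_fst⟩ = q.map ⟨Prod.fst, continuous_fst⟩) : p = q :=
  pathClass_prod_ext h

lemma toM_trans {v : S.Vertex} (g h : B.VertexGroup v) : B.toM (g ⬝ h) = B.toM g ⬝ B.toM h :=
  map_of_trans _ _ _

lemma toM_symm {v : S.Vertex} (g : B.VertexGroup v) : B.toM g.symm = (B.toM g).symm :=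
  map_of_symm _ _

/-- `c⁻ t_e = t_e c⁺`. -/
lemma minus_stable {a b : S.Vertex} (e : S.Edge a b) (c : EdgeGroup) :
    B.toM (B.minus e c) ⬝ B.stable e = B.stable e ⬝ B.toM (B.plus e c) := by
  rw [minus, plus, toM_sideHom, toM_sideHom, stable_eq]
  simp only [Path.Homotopic.Quotient.trans_assoc, symm_trans_cancel]
  congr 1
  simp only [← Path.Homotopic.Quotient.trans_assoc]
  congr 1
  rw [← map_of_trans, ← map_of_trans]
  congr 1
  apply collar_ext
  simp

lemma prodLift_symm {x y : Torus} (c : PC x y) (a b : ℝ) :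
    (prodLift c a b).symm = prodLift c.symm b a := by
  apply collar_ext
  rw [map_of_symm, projLeft_prodLift, projLeft_prodLift]

lemma stable_rev {a b : S.Vertex} (e : S.Edge a b) : B.stable e.rev = (B.stable e).symm := by
  obtain ⟨j, s, src, tgt⟩ := e
  rw [stable_eq, stable_eq]
  simp only [symm_of_trans, quotient_symm_symm, Path.Homotopic.Quotient.trans_assoc,
    ← map_of_symm, prodLift_symm, symm_of_refl]
  cases s <;> rfl

lemma plus_rev {a b : S.Vertex} (e : S.Edge a b) (c : EdgeGroup) :
    B.plus e.rev c = B.minus e c := rfl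

lemma minus_rev {a b : S.Vertex} (e : S.Edge a b) (c : EdgeGroup) :
    B.minus e.rev c = B.plus e c := by
  obtain ⟨j, s, src, tgt⟩ := e
  cases s <;> rfl

/-- `sideHom` as a homomorphism. -/
noncomputable def sideMonoidHom (j : S.ι) (s : Bool) {v : S.Vertex} (h : S.LiesIn j s v) :
    EdgeGroup →* B.VertexGroup v :=
  MonoidHom.mk' (B.sideHom j s h) fun a b => by
    simp only [sideHom, pi1_mul_def, map_of_trans, Path.Homotopic.Quotient.trans_assoc,
      symm_trans_cancel]

@[simp] lemma sideMonoidHom_apply (j : S.ι) (s : Bool) {v : S.Vertex} (h : S.LiesIn j s v)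
    (c : EdgeGroup) : B.sideMonoidHom j s h c = B.sideHom j s h c := rfl

/-- Sliding along the collar from level `±1` to level `0` recovers the class of `c` on the core
torus from `sideHom`, and the core torus is incompressible. -/
lemma sideHom_injective {j : S.ι} (hj : PiOneInjective (S.collar j).core) (s : Bool)
    {v : S.Vertex} (h : S.LiesIn j s v) : Function.Injective (B.sideHom j s h) := by
  intro c d hcd
  apply hj 1
  have key : ∀ c : EdgeGroup, c.map (S.collar j).core =
      (prodLift (.refl (1 : Torus)) 0 (sgn s)).map (S.collarMap j) ⬝
      ((B.arcM j s h).symm ⬝ B.toM (B.sideHom j s h c) ⬝ B.arcM j s h) ⬝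
      (prodLift (.refl (1 : Torus)) (sgn s) 0).map (S.collarMap j) := by
    intro c
    rw [toM_sideHom]
    simp only [Path.Homotopic.Quotient.trans_assoc, symm_trans_cancel]
    rw [← map_of_trans, ← map_of_trans]
    have : c.map (S.collar j).core = (prodLift c (0 : ℝ) 0).map (S.collarMap j) := by
      rw [← map_prodMk, ← Path.Homotopic.Quotient.map_comp]; rfl
    rw [this]
    congr 1
    apply collar_ext
    simp
  change c.map _ = d.map _
  rw [key, key, hcd]

end Basing

end TorusSystem

namespace TorusSystem

variable {M : Type*} [TopologicalSpace M] {S : TorusSystem M}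

namespace Basing

variable (B : S.Basing)

/-! ### Generation of the fundamental groupoid -/

/-- Products of elements of vertex groups and stable letters. -/
inductive IsWord : ∀ {v w : S.Vertex}, PC (B.pt v) (B.pt w) → Prop
  | vertex {v : S.Vertex} (g : B.VertexGroup v) : IsWord (B.toM g)
  | stable {v w : S.Vertex} (e : S.Edge v w) : IsWord (B.stable e)
  | trans {u v w : S.Vertex} {p : PC (B.pt u) (B.pt v)} {q : PC (B.pt v) (B.pt w)} :
      IsWord p → IsWord q → IsWord (p ⬝ q)

variable {B}

lemma IsWord.symm {v w : S.Vertex} {p : PC (B.pt v) (B.pt w)} (h : B.IsWord p) :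
    B.IsWord p.symm := by
  induction h with
  | vertex g => rw [← toM_symm]; exact .vertex _
  | stable e => rw [← stable_rev]; exact .stable _
  | trans _ _ h1 h2 => rw [symm_of_trans]; exact .trans h2 h1

lemma IsWord.of_eq {v w : S.Vertex} {p q : PC (B.pt v) (B.pt w)} (h : B.IsWord p) (e : p = q) :
    B.IsWord q := e ▸ h

/-- As `ℝ` is simply connected, a path class in the collar amounts to a loop in the torus and the
two end levels. Equal levels give an element of a vertex group, opposite levels such an element
followed by a stable letter. -/
lemma isWord_arc (j : S.ι) (s s' : Bool) {v w : S.Vertex} (h : S.LiesIn j s v)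
    (h' : S.LiesIn j s' w) (q : PC ((1 : Torus), sgn s) ((1 : Torus), sgn s')) :
    B.IsWord (B.arcM j s h ⬝ q.map (S.collarMap j) ⬝ (B.arcM j s' h').symm) := by
  let c : EdgeGroup := q.map ⟨Prod.fst, continuous_fst⟩
  by_cases hs : s = s'
  · subst hs
    obtain rfl := h.unique h'
    have : q = prodLift c (sgn s) (sgn s) := collar_ext (by rw [projLeft_prodLift])
    rw [this, ← toM_sideHom]
    exact .vertex _
  · have hs' : s = !s' := by cases s <;> cases s' <;> simp at hs ⊢
    subst hs'
    have : q = prodLift c (sgn (!s')) (sgn (!s')) ⬝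
        prodLift (.refl (1 : Torus)) (sgn (!s')) (sgn s') := collar_ext (by
      rw [map_of_trans, projLeft_prodLift, projLeft_prodLift]
      exact (Path.Homotopic.Quotient.trans_refl c).symm)
    have e : B.arcM j (!s') h ⬝ q.map (S.collarMap j) ⬝ (B.arcM j s' h').symm =
        B.toM (B.sideHom j (!s') h c) ⬝ B.stable ⟨j, s', h, h'⟩ := by
      rw [toM_sideHom, stable_eq, this, map_of_trans]
      simp only [Path.Homotopic.Quotient.trans_assoc, symm_trans_cancel]
    rw [e]
    exact .trans (.vertex _) (.stable _)

variable (B) in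
/-- Classes of paths from base points which run in a piece, or along an arc and then in a collar. -/
def IsAccess {v : S.Vertex} {x : M} (a : PC (B.pt v) x) : Prop :=
  (∃ (y : S.piece v) (hy : x = S.incl v y) (q : PC (B.base v) y),
    a = (q.map (S.incl v)).cast rfl hy) ∨
  ∃ (j : S.ι) (s : Bool) (h : S.LiesIn j s v) (p : Torus × ℝ) (hp : x = S.collarMap j p)
    (q : PC ((1 : Torus), sgn s) p), a = (B.arcM j s h ⬝ q.map (S.collarMap j)).cast rfl hp

/-- The common point lies in a half-collar of the piece. A detour to the base point of the piece,
through that half-collar and along the arc of its boundary torus, splits the loop into a loop in the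
piece and a path in the collar. -/
lemma isWord_piece_collar {v w : S.Vertex} (y : S.piece v) (q : PC (B.base v) y) (j : S.ι)
    (s : Bool) (h : S.LiesIn j s w) (p : Torus × ℝ) (hp : S.incl v y = S.collarMap j p)
    (r : PC ((1 : Torus), sgn s) p) :
    B.IsWord (q.map (S.incl v) ⬝
      ((B.arcM j s h ⬝ r.map (S.collarMap j)).cast rfl hp).symm) := by
  have hmem : S.collarMap j p ∈ S.piece v := by rw [← hp]; exact y.2
  obtain ⟨s', hs', hl, he⟩ := exists_halfMap_eq hmem
  obtain rfl : y = halfMap j s' hl (p.1, ⟨p.2, hs'⟩) := Subtype.ext (hp.trans he.symm)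
  let ρ : PC ((1 : Torus), Ray.tip s') (p.1, (⟨p.2, hs'⟩ : Ray s')) :=
    prodLift (.mk (PathConnectedSpace.somePath _ _)) _ _
  have h1 : B.IsWord (B.toM (q ⬝ (ρ.map (halfMap j s' hl)).symm ⬝ (B.arcC j s' hl).symm)) :=
    .vertex _
  have h2 : B.IsWord (B.arcM j s' hl ⬝ (ρ.map (rayIncl s') ⬝ r.symm).map (S.collarMap j) ⬝
    (B.arcM j s h).symm) := isWord_arc _ _ _ _ _ _
  have e1 : B.toM (q ⬝ (ρ.map (halfMap j s' hl)).symm ⬝ (B.arcC j s' hl).symm) =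
      q.map (S.incl v) ⬝ ((ρ.map (rayIncl s')).map (S.collarMap j)).symm ⬝
        (B.arcM j s' hl).symm := by
    rw [← map_halfMap_incl hl]
    simp only [toM, map_of_trans, map_of_symm]
    rfl
  have e2 : (ρ.map (rayIncl s') ⬝ r.symm).map (S.collarMap j) =
      (ρ.map (rayIncl s')).map (S.collarMap j) ⬝ (r.map (S.collarMap j)).symm := by
    exact (map_of_trans (S.collarMap j) (ρ.map (rayIncl s')) r.symm).trans
      (congrArg _ (map_of_symm _ _))
  have h3 := h1.trans h2
  rw [e1, e2] at h3
  have aux : ∀ {a c m n k y y' : M} (hp : y = y') (q : PC a y) (ρ : PC m y) (ρ' : PC m y')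
      (α : PC c m) (β : PC n k) (δ : PC k y'), ρ' = ρ.cast rfl hp.symm →
      (q ⬝ ρ.symm ⬝ α.symm) ⬝ (α ⬝ (ρ' ⬝ δ.symm) ⬝ β.symm) = q ⬝ ((β ⬝ δ).cast rfl hp).symm := by
    rintro a c m n k y _ rfl q ρ _ α β δ rfl
    simp [Path.Homotopic.Quotient.trans_assoc]
  exact h3.of_eq (aux hp (q.map (S.incl v)) ((ρ.map (rayIncl s')).map (S.collarMap j))
    ((ρ.map (rayIncl s')).map (S.collarMap j)) (B.arcM j s' hl) (B.arcM j s h)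
    (r.map (S.collarMap j)) (Path.Homotopic.Quotient.cast_rfl_rfl _).symm)

/-- This makes the choice of an access path to a point immaterial. -/
lemma IsAccess.isWord {v w : S.Vertex} {x : M} {a : PC (B.pt v) x} {b : PC (B.pt w) x}
    (ha : B.IsAccess a) (hb : B.IsAccess b) : B.IsWord (a ⬝ b.symm) := by
  rcases ha with ⟨y, rfl, q, rfl⟩ | ⟨j, s, h, p, rfl, r, rfl⟩
  · rw [Path.Homotopic.Quotient.cast_rfl_rfl]
    rcases hb with ⟨y', hy', q', rfl⟩ | ⟨j, s, h, p, hp, r, rfl⟩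
    · have hy'' : (y : M) = y' := hy'
      obtain rfl : v = w := eq_of_mem_piece y.2 (hy'' ▸ y'.2)
      obtain rfl : y = y' := Subtype.ext hy''
      rw [Path.Homotopic.Quotient.cast_rfl_rfl]
      have : B.IsWord (B.toM (q ⬝ q'.symm)) := .vertex _
      exact this.of_eq ((map_of_trans _ _ _).trans (congrArg _ (map_of_symm _ _)))
    · exact isWord_piece_collar _ _ _ _ _ _ hp _
  · rw [Path.Homotopic.Quotient.cast_rfl_rfl]
    rcases hb with ⟨y, hy, q, rfl⟩ | ⟨j', s', h', p', hp', r', rfl⟩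
    · have aux : ∀ {a b x x' : M} (h : x = x') (h' : x' = x) (p : PC a x) (q : PC b x'),
          (q ⬝ (p.cast rfl h').symm).symm = p ⬝ (q.cast rfl h).symm := by
        rintro a b x _ rfl _ p q; simp
      exact (isWord_piece_collar y q j s h p hy.symm r).symm.of_eq (aux hy _ _ _)
    · obtain rfl := eq_of_collarMap_eq hp'
      obtain rfl := collarMap_injective j hp'
      rw [Path.Homotopic.Quotient.cast_rfl_rfl]
      have := isWord_arc (B := B) j s s' h h' (r ⬝ r'.symm)
      simpa only [map_of_trans, map_of_symm, symm_of_trans,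
        Path.Homotopic.Quotient.trans_assoc] using this

variable [T2Space M] [LocallyPathConnectedSpace M]

lemma exists_isAccess (x : M) : ∃ (v : S.Vertex) (a : PC (B.pt v) x), B.IsAccess a := by
  rcases exists_cover (S := S) x with ⟨v, hx⟩ | ⟨j, p, hp⟩
  · exact ⟨v, _, .inl ⟨⟨x, hx.1⟩, rfl, .mk (PathConnectedSpace.somePath _ _), rfl⟩⟩
  · obtain ⟨v, h⟩ := exists_liesIn (S := S) j true
    exact ⟨v, _, .inr ⟨j, true, h, p, hp.symm, .mk (PathConnectedSpace.somePath _ _), rfl⟩⟩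

/-- Every path class between base points is a product of elements of vertex groups and stable
letters. -/
theorem isWord {v w : S.Vertex} (p : PC (B.pt v) (B.pt w)) : B.IsWord p := by
  have key := pathClass_induction (X := M)
    (U := Sum.elim S.innerPiece fun j => range (S.collarMap j))
    (by
      rintro (v | j)
      · exact isOpen_innerPiece v
      · exact (S.collar j).isOpenEmbedding.isOpen_range)
    (fun x => (exists_cover x).elim (fun ⟨v, h⟩ => ⟨.inl v, h⟩) (fun ⟨j, h⟩ => ⟨.inr j, h⟩))
    -- Subdivision points are arbitrary, so the induction is on paths closed up by access paths, for
    -- all choices of these.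
    (fun x y p => ∀ (v w : S.Vertex) (a : PC (B.pt v) x) (b : PC (B.pt w) y), B.IsAccess a →
      B.IsAccess b → B.IsWord (a ⬝ p ⬝ b.symm))
    (by
      intro x y z p q hp hq v w a b ha hb
      obtain ⟨u, c, hc⟩ := exists_isAccess (B := B) y
      have := (hp v u a c ha hc).trans (hq u w c b hc hb)
      simpa only [Path.Homotopic.Quotient.trans_assoc, symm_trans_cancel] using this)
    (by
      intro x y γ i hγ v w a b ha hb
      -- One access path that remains an access path after following `γ` is enough; other choices
      -- differ from it by words.
      suffices h : ∃ (u : S.Vertex) (c : PC (B.pt u) x), B.IsAccess c ∧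
          B.IsAccess (c ⬝ .mk γ) by
        obtain ⟨u, c, hc, hc'⟩ := h
        have := (ha.isWord hc).trans (hc'.isWord hb)
        simpa only [Path.Homotopic.Quotient.trans_assoc, symm_trans_cancel] using this
      rcases i with u | j
      · have hmem : ∀ t, γ t ∈ S.piece u := fun t => (hγ t).1
        let δ : Path (⟨x, by simpa using hmem 0⟩ : S.piece u) ⟨y, by simpa using hmem 1⟩ :=
          { toFun := fun t => ⟨γ t, hmem t⟩
            source' := by simp
            target' := by simp }
        let q : PC (B.base u) ⟨x, by simpa using hmem 0⟩ := .mk (PathConnectedSpace.somePath _ _)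
        refine ⟨u, q.map (S.incl u), ?_, ?_⟩
        · exact .inl ⟨_, rfl, q, (Path.Homotopic.Quotient.cast_rfl_rfl _).symm⟩
        · have : q.map (S.incl u) ⬝ .mk γ = (q ⬝ .mk δ).map (S.incl u) := by
            rw [map_of_trans]; rfl
          exact .inl ⟨_, rfl, q ⬝ .mk δ,
            this.trans (Path.Homotopic.Quotient.cast_rfl_rfl _).symm⟩
      · obtain ⟨u, h⟩ := exists_liesIn (S := S) j true
        have hemb := (S.collar j).isOpenEmbedding.toIsEmbedding
        let g := hemb.toHomeomorph.symm
        have hg : ∀ z, S.collarMap j (g z) = z := fun z =>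
          congrArg Subtype.val (hemb.toHomeomorph.apply_symm_apply z)
        have hx : x ∈ range (S.collarMap j) := by simpa using hγ 0
        have hy : y ∈ range (S.collarMap j) := by simpa using hγ 1
        let δ : Path (g ⟨x, hx⟩) (g ⟨y, hy⟩) :=
          { toFun := fun t => g ⟨γ t, hγ t⟩
            continuous_toFun := g.continuous.comp (by fun_prop)
            source' := by simp
            target' := by simp }
        let q : PC ((1 : Torus), sgn true) (g ⟨x, hx⟩) := .mk (PathConnectedSpace.somePath _ _)
        refine ⟨u, _, .inr ⟨j, true, h, _, (hg ⟨x, hx⟩).symm, q, rfl⟩, ?_⟩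
        have : ((B.arcM j true h ⬝ q.map (S.collarMap j)).cast rfl (hg ⟨x, hx⟩).symm) ⬝ .mk γ =
            (B.arcM j true h ⬝ (q ⬝ .mk δ).map (S.collarMap j)).cast rfl (hg ⟨y, hy⟩).symm := by
          have hδ : Path.Homotopic.Quotient.mk γ = ((Path.Homotopic.Quotient.mk δ).map
              (S.collarMap j)).cast (hg ⟨x, hx⟩).symm (hg ⟨y, hy⟩).symm :=
            map_mk_congr fun t => (hg ⟨γ t, hγ t⟩).symm
          rw [hδ, map_of_trans]
          have aux : ∀ {a b c d b' d' : M} (p : PC a b) (q : PC b c) (r : PC c d) (h : b' = c)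
              (h' : d' = d), ((p ⬝ q).cast rfl h) ⬝ r.cast h h' = (p ⬝ (q ⬝ r)).cast rfl h' := by
            rintro a b c d _ _ p q r rfl rfl
            simp [Path.Homotopic.Quotient.trans_assoc]
          exact aux _ _ _ _ _
        exact .inr ⟨j, true, h, _, (hg ⟨y, hy⟩).symm, _, this⟩)
    p v w (.refl _) (.refl _) (.inl ⟨B.base v, rfl, .refl _, rfl⟩)
    (.inl ⟨B.base w, rfl, .refl _, rfl⟩)
  simpa using key

end Basing

end TorusSystem

namespace TorusSystem

universe u

variable {M : Type u} [TopologicalSpace M] {S : TorusSystem M}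

namespace Basing

variable (B : S.Basing)

/-! ### The universal property of the fundamental groupoid -/

/-- A homomorphism from the graph of groups to a group `H`. -/
structure Realization (H : Type*) [Group H] where
  hom : ∀ v : S.Vertex, B.VertexGroup v →* H
  letter : S.ι → H
  rel : ∀ (j : S.ι) {v w : S.Vertex} (hv : S.LiesIn j false v) (hw : S.LiesIn j true w)
    (c : EdgeGroup), hom v (B.sideHom j false hv c) * letter j =
      letter j * hom w (B.sideHom j true hw c)

/-- Classes of paths from the base points, used to turn path classes into loops. -/
structure Connectors where
  piece : ∀ v (x : S.piece v), PC (B.base v) x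
  piece_base : ∀ v, piece v (B.base v) = .refl _
  torus : ∀ x : Torus, PC (1 : Torus) x
  torus_one : torus 1 = .refl 1
  vert : S.ι → Bool → S.Vertex
  liesIn : ∀ j s, S.LiesIn j s (vert j s)

variable {B}

/-- Prefixing the inverse of the loop chosen at `x` normalises the choice at `x` itself. -/
lemma exists_connector {X : Type*} [TopologicalSpace X] [PathConnectedSpace X] (x : X) :
    ∃ κ : ∀ y, PC x y, κ x = .refl x :=
  ⟨fun y => (Path.Homotopic.Quotient.mk (PathConnectedSpace.somePath x x)).symm ⬝
    .mk (PathConnectedSpace.somePath x y), by simp⟩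

lemma Connectors.nonempty [T2Space M] [LocallyPathConnectedSpace M] : Nonempty B.Connectors := by
  choose κ hκ using fun v => exists_connector (B.base v)
  obtain ⟨κT, hκT⟩ := exists_connector (1 : Torus)
  choose vert hl using fun j s => exists_liesIn (S := S) j s
  exact ⟨⟨κ, hκ, κT, hκT, vert, hl⟩⟩

/-! ### From a homomorphism of the graph of groups to a local labelling of `M` -/

namespace Realization

variable {H : Type*} [Group H] (R : B.Realization H) (K : B.Connectors)

/-- The label of a path class in a piece. -/
noncomputable def pieceLabel (v : S.Vertex) {a b : S.piece v} (q : PC a b) : H :=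
  R.hom v (K.piece v a ⬝ q ⬝ (K.piece v b).symm)

/-- The element of the vertex group comparing the two connections of a point of a half-collar with
the base point of the piece. -/
noncomputable def _root_.HakenJSJ.TorusSystem.Basing.Connectors.correction (K : B.Connectors)
    (j : S.ι) (s : Bool) (p : Torus × Ray s) : B.VertexGroup (K.vert j s) :=
  K.piece _ (halfMap j s (K.liesIn j s) p) ⬝
    ((prodLift (K.torus p.1) (Ray.tip s) p.2).map (halfMap j s (K.liesIn j s))).symm ⬝
    (B.arcC j s (K.liesIn j s)).symm

open Classical in
/-- The factor attached to a point of a collar. -/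
noncomputable def factor (j : S.ι) (p : Torus × ℝ) : H :=
  if h : 1 ≤ sgn true * p.2 then
    -- Loops in the collar are read in the piece on the negative side; the factor `(R.letter j)⁻¹`
    -- makes a crossing to the positive side pick up the letter.
    R.hom _ (K.correction j true (p.1, ⟨p.2, h⟩)) * (R.letter j)⁻¹
  else if h : 1 ≤ sgn false * p.2 then R.hom _ (K.correction j false (p.1, ⟨p.2, h⟩))
  -- No piece meets the open middle of the collar, so any value serves there.
  else 1

lemma factor_true (j : S.ι) (p : Torus × ℝ) (h : 1 ≤ sgn true * p.2) : R.factor K j p =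
    R.hom _ (K.correction j true (p.1, ⟨p.2, h⟩)) * (R.letter j)⁻¹ := dif_pos h

lemma factor_false (j : S.ι) (p : Torus × ℝ) (h : 1 ≤ sgn false * p.2) : R.factor K j p =
    R.hom _ (K.correction j false (p.1, ⟨p.2, h⟩)) := by
  have h1 : ¬ 1 ≤ sgn true * p.2 := by simp at h ⊢; linarith
  rw [factor, dif_neg h1, dif_pos h]

/-- The loop in the torus defined by a path class in a collar. -/
noncomputable def torusLoop {p q : Torus × ℝ} (c : PC p q) : EdgeGroup :=
  K.torus p.1 ⬝ c.map ⟨Prod.fst, continuous_fst⟩ ⬝ (K.torus q.1).symm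

/-- The label of a path class in a collar. -/
noncomputable def collarLabel (j : S.ι) {p q : Torus × ℝ} (c : PC p q) : H :=
  R.factor K j p * R.hom _ (B.sideHom j false (K.liesIn j false) (torusLoop K c)) *
    (R.factor K j q)⁻¹

lemma pieceLabel_trans (v : S.Vertex) {a b c : S.piece v} (p : PC a b) (q : PC b c) :
    R.pieceLabel K v (p ⬝ q) = R.pieceLabel K v p * R.pieceLabel K v q := by
  rw [pieceLabel, pieceLabel, pieceLabel, ← map_mul, pi1_mul_def]
  simp only [Path.Homotopic.Quotient.trans_assoc, symm_trans_cancel]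

lemma collarLabel_trans (j : S.ι) {a b c : Torus × ℝ} (p : PC a b) (q : PC b c) :
    R.collarLabel K j (p ⬝ q) = R.collarLabel K j p * R.collarLabel K j q := by
  have : torusLoop K (p ⬝ q) = torusLoop K p * torusLoop K q := by
    simp only [torusLoop, pi1_mul_def, Path.Homotopic.Quotient.trans_assoc, symm_trans_cancel]
    rw [map_of_trans]
    simp only [Path.Homotopic.Quotient.trans_assoc]
  have h2 := (B.sideMonoidHom j false (K.liesIn j false)).map_mul (torusLoop K p) (torusLoop K q)
  simp only [sideMonoidHom_apply] at h2
  rw [collarLabel, this, h2, map_mul, collarLabel, collarLabel]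
  group

/-- The two labels of a path class in a half-collar agree. -/
lemma pieceLabel_halfMap (j : S.ι) (s : Bool) {p q : Torus × Ray s} (c : PC p q) :
    R.pieceLabel K (K.vert j s) (c.map (halfMap j s (K.liesIn j s))) =
      R.collarLabel K j (c.map (rayIncl s)) := by
  obtain ⟨x, r⟩ := p
  obtain ⟨y, r'⟩ := q
  set e := torusLoop K (c.map (rayIncl s)) with he
  -- The class is rewritten through the base point of the boundary torus, which isolates its torus
  -- loop `e`.
  have hc : c = (prodLift (K.torus x) (Ray.tip s) r).symm ⬝ prodLift e (Ray.tip s) (Ray.tip s) ⬝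
      prodLift (K.torus y) (Ray.tip s) r' := by
    apply pathClass_prod_ext
    have h1 : (c.map (rayIncl s)).map ⟨Prod.fst, continuous_fst⟩ =
        c.map ⟨Prod.fst, continuous_fst⟩ := by
      rw [← Path.Homotopic.Quotient.map_comp]; rfl
    change c.map ⟨Prod.fst, continuous_fst⟩ = Path.Homotopic.Quotient.map _
      (⟨Prod.fst, continuous_fst⟩ : C(Torus × Ray s, Torus))
    rw [map_of_trans, map_of_trans, map_of_symm, projLeft_prodLift, projLeft_prodLift,
      projLeft_prodLift, he, torusLoop, h1]
    have aux : ∀ {o x y : Torus} (k : PC o x) (l : PC o y) (c : PC x y),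
        c = k.symm ⬝ (k ⬝ c ⬝ l.symm) ⬝ l := by
      intros; simp [Path.Homotopic.Quotient.trans_assoc]
    exact aux _ _ _
  have key : R.pieceLabel K (K.vert j s) (c.map (halfMap j s (K.liesIn j s))) =
      R.hom _ (K.correction j s (x, r)) * R.hom _ (B.sideHom j s (K.liesIn j s) e) *
        (R.hom _ (K.correction j s (y, r')))⁻¹ := by
    rw [pieceLabel, ← map_inv, ← map_mul, ← map_mul, sideHom_eq]
    congr 1
    simp only [pi1_mul_def, pi1_inv_def, Connectors.correction, symm_of_trans, quotient_symm_symm,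
      Path.Homotopic.Quotient.trans_assoc, symm_trans_cancel]
    congr 1
    have h2 : c.map (halfMap j s (K.liesIn j s)) =
        ((prodLift (K.torus x) (Ray.tip s) r).map (halfMap j s (K.liesIn j s))).symm ⬝
        (prodLift e (Ray.tip s) (Ray.tip s)).map (halfMap j s (K.liesIn j s)) ⬝
        (prodLift (K.torus y) (Ray.tip s) r').map (halfMap j s (K.liesIn j s)) := by
      conv_lhs => rw [hc]
      rw [map_of_trans, map_of_trans, map_of_symm]
    rw [h2]
    simp only [Path.Homotopic.Quotient.trans_assoc]
  rw [key, collarLabel, ← he]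
  cases s with
  | false =>
    have hf : ∀ (x : Torus) (r : Ray false), R.factor K j (rayIncl false (x, r)) =
        R.hom _ (K.correction j false (x, r)) := fun x r => R.factor_false K j (x, r) r.2
    rw [hf, hf]
  | true =>
    have hf : ∀ (x : Torus) (r : Ray true), R.factor K j (rayIncl true (x, r)) =
        R.hom _ (K.correction j true (x, r)) * (R.letter j)⁻¹ :=
      fun x r => R.factor_true K j (x, r) r.2
    rw [hf, hf]
    -- Only on the positive side is the edge relation needed: it turns the image of `e` there into
    -- the image on the negative side used by `collarLabel`.
    have := R.rel j (K.liesIn j false) (K.liesIn j true) e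
    have h3 : R.hom _ (B.sideHom j true (K.liesIn j true) e) =
        (R.letter j)⁻¹ * R.hom _ (B.sideHom j false (K.liesIn j false) e) * R.letter j := by
      rw [mul_assoc, this]; group
    rw [h3]
    group

lemma pathLabel_congr {Y H : Type*} [TopologicalSpace Y] (L : ∀ {a b : Y}, PC a b → H)
    {a b c d : Y} (γ : Path a b) (δ : Path c d) (h : ∀ t, γ t = δ t) :
    L (.mk γ) = L (.mk δ) := by
  obtain rfl : a = c := by simpa using h 0
  obtain rfl : b = d := by simpa using h 1
  rw [map_mk_congr h]

lemma compat_piece_piece (v w : S.Vertex) {a b : S.piece v} {c d : S.piece w} (γ : Path a b)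
    (δ : Path c d) (h : ∀ t, S.incl v (γ t) = S.incl w (δ t)) :
    R.pieceLabel K v (.mk γ) = R.pieceLabel K w (.mk δ) := by
  have h' : ∀ t, (γ t : M) = δ t := h
  obtain rfl : v = w := eq_of_mem_piece (γ 0).2 (by rw [h' 0]; exact (δ 0).2)
  exact pathLabel_congr (fun {a b} c => R.pieceLabel K v c) γ δ fun t => Subtype.ext (h' t)

/-- A path lying in both a piece and a collar stays in a single half-collar, where the two labels
agree by `pieceLabel_halfMap`. -/
lemma compat_piece_collar (v : S.Vertex) (j : S.ι) {a b : S.piece v} {p q : Torus × ℝ}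
    (γ : Path a b) (δ : Path p q) (h : ∀ t, S.incl v (γ t) = S.collarMap j (δ t)) :
    R.pieceLabel K v (.mk γ) = R.collarLabel K j (.mk δ) := by
  have hmem : ∀ t, S.collarMap j (δ t) ∈ S.piece v := fun t => by rw [← h]; exact (γ t).2
  obtain ⟨s, hs, hl, -⟩ := exists_halfMap_eq (hmem 0)
  obtain rfl := hl.unique (K.liesIn j s)
  -- The collar coordinate is never in `(-1, 1)`, so by the intermediate value theorem it cannot
  -- change sign.
  have hray : ∀ t, 1 ≤ sgn s * (δ t).2 := by
    intro t
    obtain ⟨s', hs', -, -⟩ := exists_halfMap_eq (hmem t)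
    by_contra hne
    have hle : sgn s * (δ t).2 ≤ 0 := by
      cases s <;> cases s' <;> simp at hs' hne ⊢ <;> linarith
    have hcont : Continuous fun t => sgn s * (δ t).2 := by fun_prop
    obtain ⟨u, hu⟩ := mem_range_of_exists_le_of_exists_ge hcont ⟨t, hle⟩
      ⟨0, (zero_le_one.trans hs)⟩
    obtain ⟨s'', hs'', -, -⟩ := exists_halfMap_eq (hmem u)
    cases s <;> cases s'' <;> simp at hs'' hu <;> linarith
  have hp : 1 ≤ sgn s * p.2 := by simpa using hray 0
  have hq : 1 ≤ sgn s * q.2 := by simpa using hray 1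
  let δ' : Path ((p.1, ⟨p.2, hp⟩) : Torus × Ray s) (q.1, ⟨q.2, hq⟩) :=
    { toFun := fun t => ((δ t).1, ⟨(δ t).2, hray t⟩)
      source' := by simp
      target' := by simp }
  have h1 := R.pieceLabel_halfMap K j s (.mk δ')
  rw [← Path.Homotopic.Quotient.mk_map, ← Path.Homotopic.Quotient.mk_map] at h1
  have h2 := pathLabel_congr (fun {a b} c => R.pieceLabel K (K.vert j s) c) γ
    (δ'.map (halfMap j s (K.liesIn j s)).continuous) fun t => Subtype.ext (h t)
  have h3 := pathLabel_congr (fun {a b} c => R.collarLabel K j c) δ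
    (δ'.map (rayIncl s).continuous) fun t => rfl
  exact h2.trans (h1.trans h3.symm)

/-- The projection from the universe lift of `S¹ × S¹ × ℝ`. -/
abbrev unlift : C(ULift.{u} (Torus × ℝ), Torus × ℝ) := ⟨ULift.down, continuous_uliftDown⟩

variable (S) in
/-- The pieces and the collars. -/
def Patch : S.Vertex ⊕ S.ι → Type u
  | .inl v => S.piece v
  | .inr _ => ULift.{u} (Torus × ℝ)

instance (i : S.Vertex ⊕ S.ι) : TopologicalSpace (Patch S i) :=
  match i with
  | .inl v => inferInstanceAs (TopologicalSpace (S.piece v))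
  | .inr _ => inferInstanceAs (TopologicalSpace (ULift (Torus × ℝ)))

variable (S) in
/-- The inclusions of the pieces and the collars. -/
noncomputable def patchMap : ∀ i : S.Vertex ⊕ S.ι, C(Patch S i, M)
  | .inl v => S.incl v
  | .inr j => (S.collarMap j).comp unlift

/-- The labels of the path classes in pieces and collars. -/
noncomputable def patchLabel : ∀ (i : S.Vertex ⊕ S.ι) {a b : Patch S i}, PC a b → H
  | .inl v, _, _, q => R.pieceLabel K v q
  | .inr j, _, _, q => R.collarLabel K j
      (Path.Homotopic.Quotient.map q unlift)

lemma patchLabel_compat (i k : S.Vertex ⊕ S.ι) {a b : Patch S i} {c d : Patch S k} (γ : Path a b)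
    (δ : Path c d) (h : ∀ t, patchMap S i (γ t) = patchMap S k (δ t)) :
    R.patchLabel K i (.mk γ) = R.patchLabel K k (.mk δ) := by
  rcases i with v | j <;> rcases k with w | k
  · exact R.compat_piece_piece K v w γ δ h
  · exact R.compat_piece_collar K v k γ (Path.map δ unlift.continuous) h
  · exact (R.compat_piece_collar K w j δ (Path.map γ unlift.continuous)
      fun t => (h t).symm).symm
  · obtain rfl := eq_of_collarMap_eq (h 0)
    exact pathLabel_congr (fun {a b} c => R.collarLabel K j c) (Path.map γ unlift.continuous)
      (Path.map δ unlift.continuous) fun t => collarMap_injective j (h t)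

variable [T2Space M] [LocallyPathConnectedSpace M]

/-- The local labelling of `M` defined by a homomorphism from the graph of groups. -/
noncomputable def localLabelling : LocalLabelling M H where
  Idx := S.Vertex ⊕ S.ι
  Y := Patch S
  top := inferInstance
  f := patchMap S
  L := R.patchLabel K
  L_trans i := match i with
    | .inl v => fun p q => R.pieceLabel_trans K v p q
    | .inr j => fun p q => (congrArg (R.collarLabel K j) (map_of_trans _ p q)).trans
        (R.collarLabel_trans K j _ _)
  compat := R.patchLabel_compat K
  sec x := by
    rcases exists_cover (S := S) x with ⟨v, hx⟩ | ⟨j, hx⟩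
    · exact ⟨S.innerPiece v, isOpen_innerPiece v, hx, .inl v,
        ⟨fun u => ⟨u, u.2.1⟩, Continuous.subtype_mk continuous_subtype_val _⟩, fun u => rfl⟩
    · have hemb := (S.collar j).isOpenEmbedding.toIsEmbedding
      refine ⟨range (S.collarMap j), (S.collar j).isOpenEmbedding.isOpen_range, hx, .inr j,
        ⟨fun u => ULift.up (hemb.toHomeomorph.symm u),
          continuous_uliftUp.comp hemb.toHomeomorph.symm.continuous⟩, fun u => ?_⟩
      exact congrArg Subtype.val (hemb.toHomeomorph.apply_symm_apply u)

/-- The homomorphism from the fundamental groupoid. -/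
noncomputable def value {x y : M} (p : PC x y) : H := (R.localLabelling K).transport p

lemma value_trans {x y z : M} (p : PC x y) (q : PC y z) :
    R.value K (p ⬝ q) = R.value K p * R.value K q := LocalLabelling.transport_trans _ _ _

lemma value_symm {x y : M} (p : PC x y) : R.value K p.symm = (R.value K p)⁻¹ :=
  LocalLabelling.transport_symm _ _

lemma value_incl (v : S.Vertex) {a b : S.piece v} (q : PC a b) :
    R.value K (q.map (S.incl v)) = R.pieceLabel K v q :=
  (R.localLabelling K).transport_map (.inl v) q

lemma value_collar (j : S.ι) {p q : Torus × ℝ} (c : PC p q) :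
    R.value K (c.map (S.collarMap j)) = R.collarLabel K j c := by
  have := (R.localLabelling K).transport_map (.inr j)
    (c.map (⟨ULift.up, continuous_uliftUp⟩ : C(Torus × ℝ, ULift (Torus × ℝ))))
  rcases c with ⟨c⟩
  exact this

lemma value_toM {v : S.Vertex} (g : B.VertexGroup v) : R.value K (B.toM g) = R.hom v g := by
  refine (R.value_incl K v g).trans ?_
  rw [pieceLabel, K.piece_base]
  simp

/-- The corrections contributed by the two arcs cancel those in the factors at the ends of the
crossing, and only the letter remains. -/
lemma value_stable {v w : S.Vertex} (e : S.Edge v w) : R.value K (B.stable e) =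
    if e.pos then R.letter e.torus else (R.letter e.torus)⁻¹ := by
  obtain ⟨j, s, src, tgt⟩ := e
  rw [stable_eq, value_trans, value_trans, value_symm, value_collar]
  have harc : ∀ (s : Bool) {v : S.Vertex} (h : S.LiesIn j s v), R.value K (B.arcM j s h) =
      (R.hom _ (K.correction j s (1, Ray.tip s)))⁻¹ := by
    intro s v h
    obtain rfl := h.unique (K.liesIn j s)
    have : R.value K (B.arcM j s h) = R.pieceLabel K _ (B.arcC j s h) := value_incl _ _ _ _
    rw [this, pieceLabel, K.piece_base, Connectors.correction, K.torus_one, ← map_inv]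
    congr 1
    have h1 : prodLift (Path.Homotopic.Quotient.refl (1 : Torus)) (Ray.tip s) (Ray.tip s) =
        .refl (1, Ray.tip s) := by
      apply pathClass_prod_ext
      exact projLeft_prodLift _ _ _
    simp only [h1, pi1_inv_def, map_of_refl, symm_of_trans, quotient_symm_symm, symm_of_refl,
      Path.Homotopic.Quotient.refl_trans]
  have hloop : torusLoop K (prodLift (.refl (1 : Torus)) (sgn (!s)) (sgn s)) = 1 := by
    rw [torusLoop, projLeft_prodLift, K.torus_one]
    simp [pi1_one_def]
  have hone : B.sideHom j false (K.liesIn j false) 1 = 1 :=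
    (B.sideMonoidHom j false (K.liesIn j false)).map_one
  have hpos : R.factor K j ((1 : Torus), sgn true) =
      R.hom _ (K.correction j true (1, Ray.tip true)) * (R.letter j)⁻¹ :=
    R.factor_true K j (1, sgn true) (Ray.tip true).2
  have hneg : R.factor K j ((1 : Torus), sgn false) =
      R.hom _ (K.correction j false (1, Ray.tip false)) :=
    R.factor_false K j (1, sgn false) (Ray.tip false).2
  rw [harc, harc, collarLabel, hloop, hone, map_one]
  cases s with
  | true =>
    change (R.hom (K.vert j false) (K.correction j false (1, Ray.tip false)))⁻¹ *
      (R.factor K j ((1 : Torus), sgn false) * 1 * (R.factor K j ((1 : Torus), sgn true))⁻¹) *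
      _ = R.letter j
    rw [hpos, hneg]; group
  | false =>
    change (R.hom (K.vert j true) (K.correction j true (1, Ray.tip true)))⁻¹ *
      (R.factor K j ((1 : Torus), sgn true) * 1 * (R.factor K j ((1 : Torus), sgn false))⁻¹) *
      _ = (R.letter j)⁻¹
    rw [hpos, hneg]; group

end Realization

end Basing

end TorusSystem

/-! ### HNN extensions with several stable letters -/

namespace MultiHNN

variable {ι C D : Type*} [Group C] [Group D]

/-- The base group of the auxiliary HNN extension with one stable letter. -/
abbrev Wreath (ι D : Type*) [Group D] : Type _ := RegularWreathProduct D (FreeGroup ι)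

/-- The shift which moves the first coordinate to that of `j`. -/
def shift (D : Type*) [Group D] (j : ι) : Wreath ι D := RegularWreathProduct.inl (FreeGroup.of j)

open Classical in
/-- The first coordinate. -/
noncomputable def coord (ι D : Type*) [Group D] : D →* Wreath ι D where
  toFun x := ⟨Pi.mulSingle 1 x, 1⟩
  map_one' := by ext <;> simp
  map_mul' x y := by ext <;> simp [Pi.mulSingle_mul]

variable (φ : Bool → ι → C →* D)

/-- The product of the subgroups `φ s j (C)`, each in its own coordinate. -/
noncomputable def sub (s : Bool) : (ι → C) →* Wreath ι D where
  toFun c := ⟨Function.extend FreeGroup.of (fun j => φ s j (c j)) 1, 1⟩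
  map_one' := by
    ext q
    · by_cases h : ∃ j, FreeGroup.of j = q
      · obtain ⟨j, rfl⟩ := h
        exact (FreeGroup.of_injective.extend_apply (fun j => φ s j ((1 : ι → C) j)) 1 j).trans
          (map_one (φ s j))
      · exact Function.extend_apply' (fun j => φ s j ((1 : ι → C) j)) (1 : FreeGroup ι → D) q h
    · simp
  map_mul' a b := by
    ext q
    · by_cases h : ∃ j, FreeGroup.of j = q
      · obtain ⟨j, rfl⟩ := h
        simp [FreeGroup.of_injective.extend_apply]
      · simp [Function.extend_apply' _ _ _ h]
    · simp

lemma sub_left (s : Bool) (c : ι → C) (j : ι) :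
    (sub φ s c).left (FreeGroup.of j) = φ s j (c j) :=
  FreeGroup.of_injective.extend_apply (fun j => φ s j (c j)) 1 j

lemma sub_injective (hφ : ∀ s j, Function.Injective (φ s j)) (s : Bool) :
    Function.Injective (sub φ s) := by
  intro a b h
  funext j
  apply hφ s j
  rw [← sub_left, ← sub_left, h]

lemma coord_injective : Function.Injective (coord ι D) := by
  classical
  intro x y h
  have := congrArg RegularWreathProduct.left h
  exact Pi.mulSingle_injective _ this

lemma shift_conj_left [DecidableEq (FreeGroup ι)] (j : ι) (x : D) :
    (shift D j * coord ι D x * (shift D j)⁻¹).left = Pi.mulSingle (FreeGroup.of j) x := by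
  funext q
  have hc (y : FreeGroup ι) : (coord ι D x).left y = (Pi.mulSingle 1 x : FreeGroup ι → D) y := by
    simp only [coord, MonoidHom.coe_mk, OneHom.coe_mk]
    congr!
  simp only [RegularWreathProduct.mul_left, RegularWreathProduct.inv_left, Pi.mul_apply, hc]
  simp only [shift, coord,
    RegularWreathProduct.left_inl, RegularWreathProduct.right_inl, MonoidHom.coe_mk, OneHom.coe_mk,
    Pi.one_apply, inv_one, one_mul, mul_one]
  by_cases h : q = FreeGroup.of j
  · subst h; simp
  · rw [Pi.mulSingle_eq_of_ne h, Pi.mulSingle_eq_of_ne]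
    intro h'
    exact h (inv_mul_eq_one.1 h').symm

lemma shift_conj_right (j k : ι) (x : D) :
    (shift D j * coord ι D x * (shift D k)⁻¹).right = FreeGroup.of j * (FreeGroup.of k)⁻¹ := by
  simp [shift, coord]

/-- The point of the wreath product: the free group component has to be trivial, which forces `j =
k`, and then the coordinate at the generator of `j` is `x` itself. -/
lemma mem_sub_range {s : Bool} {j k : ι} {x : D}
    (h : shift D j * coord ι D x * (shift D k)⁻¹ ∈ (sub φ s).range) :
    j = k ∧ x ∈ range (φ s j) := by
  classical
  obtain ⟨c, hc⟩ := h
  have h1 := congrArg RegularWreathProduct.right hc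
  rw [shift_conj_right] at h1
  have h2 : (1 : FreeGroup ι) = FreeGroup.of j * (FreeGroup.of k)⁻¹ := h1
  have hjk : j = k := FreeGroup.of_injective (mul_inv_eq_one.1 h2.symm)
  subst hjk
  refine ⟨rfl, c j, ?_⟩
  have h3 := congrFun (congrArg RegularWreathProduct.left hc) (FreeGroup.of j)
  rw [sub_left, shift_conj_left] at h3
  simpa using h3

lemma sub_mulSingle [DecidableEq ι] (s : Bool) (j : ι) (c : C) :
    sub φ s (Pi.mulSingle j c) = shift D j * coord ι D (φ s j c) * (shift D j)⁻¹ := by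
  classical
  ext q
  · rw [shift_conj_left]
    by_cases h : ∃ k, FreeGroup.of k = q
    · obtain ⟨k, rfl⟩ := h
      rw [sub_left]
      by_cases hk : k = j
      · subst hk; simp
      · have : (FreeGroup.of k : FreeGroup ι) ≠ FreeGroup.of j :=
          fun h => hk (FreeGroup.of_injective h)
        simp [hk, this]
    · have h1 : (sub φ s (Pi.mulSingle j c)).left q = 1 := 
        Function.extend_apply' (fun j' => φ s j' ((Pi.mulSingle j c : ι → C) j')) (1 : FreeGroup ι → D) q h
      rw [h1, Pi.mulSingle_eq_of_ne]
      exact fun h' => h ⟨j, h'.symm⟩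
  · rw [shift_conj_right]; simp [sub]

variable (hφ : ∀ s j, Function.Injective (φ s j))

/-- The isomorphism between the two associated subgroups. -/
noncomputable def iso : (sub φ true).range ≃* (sub φ false).range :=
  (MonoidHom.ofInjective (sub_injective φ hφ true)).symm.trans
    (MonoidHom.ofInjective (sub_injective φ hφ false))

/-- A group which contains `D` and in which `letter j` conjugates `φ true j` to `φ false j`. -/
abbrev Ext : Type _ := HNNExtension (Wreath ι D) _ _ (iso φ hφ)

noncomputable def base : D →* Ext φ hφ := HNNExtension.of.comp (coord ι D)

noncomputable def letter (j : ι) : Ext φ hφ :=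
  (HNNExtension.of (shift D j))⁻¹ * HNNExtension.t * HNNExtension.of (shift D j)

lemma base_injective : Function.Injective (base φ hφ) :=
  (HNNExtension.of_injective _).comp coord_injective

/-- The single stable letter acts on the tuple concentrated at `j`, and conjugation by `shift D j`
brings this tuple back to the first coordinate. -/
lemma rel (j : ι) (c : C) :
    base φ hφ (φ false j c) * letter φ hφ j = letter φ hφ j * base φ hφ (φ true j c) := by
  classical
  have h := HNNExtension.t_mul_of (φ := iso φ hφ)
    (MonoidHom.ofInjective (sub_injective φ hφ true) (Pi.mulSingle j c))
  have h1 : iso φ hφ (MonoidHom.ofInjective (sub_injective φ hφ true) (Pi.mulSingle j c)) =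
      MonoidHom.ofInjective (sub_injective φ hφ false) (Pi.mulSingle j c) := by
    simp [iso]
  rw [h1] at h
  simp only [MonoidHom.ofInjective_apply, sub_mulSingle, map_mul, map_inv] at h
  simp only [base, letter, MonoidHom.comp_apply]
  set a : Ext φ hφ := HNNExtension.of (shift D j)
  set x : Ext φ hφ := HNNExtension.of (coord ι D (φ true j c))
  set y : Ext φ hφ := HNNExtension.of (coord ι D (φ false j c))
  set t : Ext φ hφ := HNNExtension.t
  have : y * (a⁻¹ * t * a) = a⁻¹ * ((a * y * a⁻¹) * t) * a := by group
  rw [this, ← h]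
  group

/-! ### Reduced products and Britton's lemma -/

/-- A stable letter or its inverse. -/
noncomputable def letterPow (j : ι) (s : Bool) : Ext φ hφ :=
  if s then letter φ hφ j else (letter φ hφ j)⁻¹

/-- The product of a sequence of signed letters with coefficients. -/
noncomputable def listProd : List (ι × Bool × D) → Ext φ hφ
  | [] => 1
  | (j, s, g) :: L => letterPow φ hφ j s * base φ hφ g * listProd L

/-- No coefficient between inverse letters lies in the associated subgroup. -/
def IsReduced (L : List (ι × Bool × D)) : Prop :=
  L.IsChain fun a b => a.1 = b.1 → b.2.1 = !a.2.1 → a.2.2 ∉ range (φ a.2.1 a.1)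

/-- The shift before the first letter. -/
def pre : List (ι × Bool × D) → Wreath ι D
  | [] => 1
  | a :: _ => (shift D a.1)⁻¹

def unitSign (s : Bool) : ℤˣ := if s then 1 else -1

lemma unitSign_injective : Function.Injective unitSign := by decide

lemma neg_unitSign (s : Bool) : -unitSign s = unitSign (!s) := by cases s <;> rfl

lemma toSubgroup_unitSign (s : Bool) :
    HNNExtension.toSubgroup (sub φ true).range (sub φ false).range (unitSign s) =
      (sub φ s).range := by
  cases s <;> rfl

/-- The corresponding sequence for the HNN extension with one stable letter. -/
noncomputable def wreathList : List (ι × Bool × D) → List (ℤˣ × Wreath ι D)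
  | [] => []
  | a :: L => (unitSign a.2.1, shift D a.1 * coord ι D a.2.2 * pre L) :: wreathList L

/-- The coefficient between two occurrences of `t` is a coordinate element flanked by two shifts, so
by `mem_sub_range` a pinch in the wreath list is a pinch of the original list. -/
lemma isChain_wreathList : ∀ {L : List (ι × Bool × D)}, IsReduced φ L →
    (wreathList L).IsChain fun a b =>
      a.2 ∈ HNNExtension.toSubgroup (sub φ true).range (sub φ false).range a.1 → a.1 = b.1
  | [], _ => List.isChain_nil
  | [a], _ => List.isChain_singleton _
  | a :: b :: L, h => by
    have h' := List.isChain_cons_cons.1 h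
    refine List.isChain_cons_cons.2 ⟨fun hmem => ?_, isChain_wreathList h'.2⟩
    by_contra hne
    simp only [toSubgroup_unitSign] at hmem
    obtain ⟨hj, hr⟩ := mem_sub_range φ hmem
    refine h'.1 hj ?_ hr
    have : b.2.1 ≠ a.2.1 := fun he => hne (by rw [he])
    cases hb : b.2.1 <;> cases ha : a.2.1 <;> simp_all

/-- The reduced word for the HNN extension with one stable letter. -/
noncomputable def reducedWord (h : D) {L : List (ι × Bool × D)} (hL : IsReduced φ L) :
    HNNExtension.NormalWord.ReducedWord (Wreath ι D) (sub φ true).range (sub φ false).range :=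
  ⟨coord ι D h * pre L, wreathList L, isChain_wreathList φ hL⟩

lemma letterPow_eq (j : ι) (s : Bool) : letterPow φ hφ j s =
    (HNNExtension.of (shift D j))⁻¹ * HNNExtension.t ^ (unitSign s : ℤ) *
      HNNExtension.of (shift D j) := by
  cases s <;> simp [letterPow, letter, unitSign, mul_assoc]

/-- Each signed letter is a power of `t` between a shift and its inverse. The left shift is absorbed
by the preceding coefficient, which is what `pre` records. -/
lemma of_pre_mul_prod (L : List (ι × Bool × D)) :
    HNNExtension.of (pre L) * ((wreathList L).map fun x =>
      (HNNExtension.t : Ext φ hφ) ^ (x.1 : ℤ) * HNNExtension.of x.2).prod = listProd φ hφ L := by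
  induction L with
  | nil => simp [pre, wreathList, listProd]
  | cons a L ih =>
    obtain ⟨j, s, g⟩ := a
    rw [listProd, ← ih, letterPow_eq]
    simp [pre, wreathList, base, mul_assoc]

lemma prod_reducedWord (h : D) {L : List (ι × Bool × D)} (hL : IsReduced φ L) :
    (reducedWord φ h hL).prod (iso φ hφ) = base φ hφ h * listProd φ hφ L := by
  rw [HNNExtension.NormalWord.ReducedWord.prod, ← of_pre_mul_prod]
  simp [reducedWord, base, mul_assoc]

lemma map_fst_wreathList (L : List (ι × Bool × D)) :
    (wreathList L).map Prod.fst = L.map fun a => unitSign a.2.1 := by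
  induction L with
  | nil => rfl
  | cons a L ih => simp [wreathList, ih]

/-- Two equal reduced products have the same number of letters. -/
theorem length_eq {h h' : D} {L L' : List (ι × Bool × D)} (hL : IsReduced φ L)
    (hL' : IsReduced φ L')
    (e : base φ hφ h * listProd φ hφ L = base φ hφ h' * listProd φ hφ L') :
    L.length = L'.length := by
  rw [← prod_reducedWord φ hφ h hL, ← prod_reducedWord φ hφ h' hL'] at e
  have := (HNNExtension.ReducedWord.map_fst_eq_and_of_prod_eq _ e).1
  simp only [reducedWord, map_fst_wreathList] at this
  simpa using congrArg List.length this

/-- Two equal reduced products begin with the same letter. -/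
theorem head_eq {h h' : D} {a a' : ι × Bool × D} {L L' : List (ι × Bool × D)}
    (hL : IsReduced φ (a :: L)) (hL' : IsReduced φ (a' :: L'))
    (e : base φ hφ h * listProd φ hφ (a :: L) = base φ hφ h' * listProd φ hφ (a' :: L')) :
    a.1 = a'.1 ∧ a.2.1 = a'.2.1 ∧ h⁻¹ * h' ∈ range (φ (!a.2.1) a.1) := by
  rw [← prod_reducedWord φ hφ h hL, ← prod_reducedWord φ hφ h' hL'] at e
  obtain ⟨h1, h2⟩ := HNNExtension.ReducedWord.map_fst_eq_and_of_prod_eq _ e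
  simp only [reducedWord, map_fst_wreathList, List.map_cons, List.cons.injEq] at h1
  -- The heads can differ only by an element which passes through the first letter from its left,
  -- hence the opposite sign.
  have h3 := h2 (unitSign a.2.1) (by simp [reducedWord, wreathList])
  rw [neg_unitSign, toSubgroup_unitSign] at h3
  have h4 : (reducedWord φ h hL).head⁻¹ * (reducedWord φ h' hL').head =
      shift D a.1 * coord ι D (h⁻¹ * h') * (shift D a'.1)⁻¹ := by
    simp [reducedWord, pre, mul_assoc]
  rw [h4] at h3
  obtain ⟨hj, hr⟩ := mem_sub_range φ h3
  exact ⟨hj, unitSign_injective h1.1, hr⟩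

end MultiHNN

namespace TorusSystem

variable {M : Type*} [TopologicalSpace M] {S : TorusSystem M}

namespace Basing

variable (B : S.Basing)

/-! ### Words in the graph of groups -/

/-- Words `g_0 t_{e_1} g_1 ⋯ t_{e_r} g_r` of type a path in the graph. -/
inductive Word (a : S.Vertex) : S.Vertex → Type _
  | nil (g : B.VertexGroup a) : Word a a
  | snoc {b d : S.Vertex} (w : Word a b) (e : S.Edge b d) (g : B.VertexGroup d) : Word a d

variable {B}

lemma minus_eq_plus {a b d : S.Vertex} {e : S.Edge a b} {f : S.Edge b d} (h : f.IsReverse e)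
    (c : EdgeGroup) : B.minus f c = B.plus e c := by
  obtain ⟨j, s, _, _⟩ := e
  obtain ⟨k, s', _, _⟩ := f
  obtain rfl : k = j := h.1
  obtain rfl : s' = !s := h.2
  cases s <;> rfl

lemma stable_of_isReverse {a b : S.Vertex} {e : S.Edge a b} {f : S.Edge b a} (h : f.IsReverse e) :
    B.stable f = (B.stable e).symm := by
  rw [← stable_rev]
  congr 1
  exact Edge.ext_data h.1 h.2

lemma _root_.HakenJSJ.TorusSystem.Edge.IsReverse.tgt_eq {a b d : S.Vertex} {e : S.Edge a b}
    {f : S.Edge b d} (h : f.IsReverse e) : d = a := by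
  obtain ⟨j, s, hs, _⟩ := e
  obtain ⟨k, s', _, ht⟩ := f
  obtain rfl : k = j := h.1
  obtain rfl : s' = !s := h.2
  exact ht.unique hs

namespace Word

variable {a b d : S.Vertex}

/-- The class of paths defined by a word. -/
noncomputable def val : ∀ {b : S.Vertex}, B.Word a b → PC (B.pt a) (B.pt b)
  | _, nil g => B.toM g
  | _, snoc w e g => w.val ⬝ B.stable e ⬝ B.toM g

/-- The number of edges. -/
def length : ∀ {b : S.Vertex}, B.Word a b → ℕ
  | _, nil _ => 0
  | _, snoc w _ _ => w.length + 1

/-- The tori crossed, with directions, in reverse order. -/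
def shape : ∀ {b : S.Vertex}, B.Word a b → List (S.ι × Bool)
  | _, nil _ => []
  | _, snoc w e _ => (e.torus, e.pos) :: w.shape

/-- An edge can be appended without a cancellation. -/
def Admits : ∀ {b : S.Vertex}, B.Word a b → ∀ {d : S.Vertex}, S.Edge b d → Prop
  | _, nil _, _, _ => True
  | _, snoc _ e g, _, f => f.IsReverse e → g ∉ range (B.plus e)

/-- The reduced words. -/
def IsReduced : ∀ {b : S.Vertex}, B.Word a b → Prop
  | _, nil _ => True
  | _, snoc w e _ => w.Admits e ∧ w.IsReduced

/-- Right multiplication by an element of a vertex group. -/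
noncomputable def rmul : ∀ {b : S.Vertex}, B.Word a b → B.VertexGroup b → B.Word a b
  | _, nil g, x => nil (g * x)
  | _, snoc w e g, x => snoc w e (g * x)

@[simp] lemma val_nil (g : B.VertexGroup a) : (nil g : B.Word a a).val = B.toM g := rfl

@[simp] lemma val_snoc (w : B.Word a b) (e : S.Edge b d) (g : B.VertexGroup d) :
    (snoc w e g).val = w.val ⬝ B.stable e ⬝ B.toM g := rfl

@[simp] lemma val_rmul (w : B.Word a b) (x : B.VertexGroup b) :
    (w.rmul x).val = w.val ⬝ B.toM x := by
  cases w with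
  | nil g => exact B.toM_trans g x
  | snoc w e g =>
    change w.val ⬝ B.stable e ⬝ B.toM (g ⬝ x) = _
    rw [toM_trans, val_snoc]
    simp only [Path.Homotopic.Quotient.trans_assoc]

@[simp] lemma length_rmul (w : B.Word a b) (x : B.VertexGroup b) :
    (w.rmul x).length = w.length := by cases w <;> rfl

@[simp] lemma shape_rmul (w : B.Word a b) (x : B.VertexGroup b) :
    (w.rmul x).shape = w.shape := by cases w <;> rfl

lemma IsReduced.rmul {w : B.Word a b} (h : w.IsReduced) (x : B.VertexGroup b) :
    (w.rmul x).IsReduced := by cases w <;> exact h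

lemma length_shape (w : B.Word a b) : w.shape.length = w.length := by
  induction w with
  | nil => rfl
  | snoc w e g ih => simp [shape, length, ih]

/-- The obstruction is a pinch `t_f c⁺ t_f⁻¹ = c⁻`; the preceding coefficient absorbs `c⁻` and the
edge disappears. -/
lemma val_snoc_of_not_admits {w : B.Word a b} (hw : w.IsReduced) {e : S.Edge b d}
    (h : ¬ w.Admits e) : ∃ w' : B.Word a d, w'.IsReduced ∧ w'.length + 1 = w.length ∧
      w'.val = w.val ⬝ B.stable e := by
  cases w with
  | nil g => exact (h trivial).elim
  | snoc w f g =>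
    simp only [Admits, not_forall, not_not] at h
    obtain ⟨hr, c, rfl⟩ := h
    obtain rfl := hr.tgt_eq
    refine ⟨w.rmul (B.minus f c), hw.2.rmul _, by simp [length], ?_⟩
    rw [val_rmul, val_snoc, stable_of_isReverse hr, Path.Homotopic.Quotient.trans_assoc w.val,
      ← minus_stable]
    simp only [Path.Homotopic.Quotient.trans_assoc, Path.Homotopic.Quotient.trans_symm,
      Path.Homotopic.Quotient.trans_refl]

/-- Every class of paths between base points is defined by a reduced word. -/
lemma exists_isReduced [T2Space M] [LocallyPathConnectedSpace M] (p : PC (B.pt a) (B.pt b)) :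
    ∃ w : B.Word a b, w.IsReduced ∧ w.val = p := by
  have key : ∀ {u v : S.Vertex} {q : PC (B.pt u) (B.pt v)}, B.IsWord q → ∀ w : B.Word a u,
      w.IsReduced → ∃ w' : B.Word a v, w'.IsReduced ∧ w'.val = w.val ⬝ q := by
    intro u v q hq
    induction hq with
    | vertex g => exact fun w hw => ⟨w.rmul g, hw.rmul g, val_rmul _ _⟩
    | stable e =>
      intro w hw
      by_cases h : w.Admits e
      · refine ⟨snoc w e 1, ⟨h, hw⟩, ?_⟩
        exact Path.Homotopic.Quotient.trans_refl _
      · obtain ⟨w', h1, -, h2⟩ := val_snoc_of_not_admits hw h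
        exact ⟨w', h1, h2⟩
    | trans _ _ h1 h2 =>
      intro w hw
      obtain ⟨w1, hw1, e1⟩ := h1 w hw
      obtain ⟨w2, hw2, e2⟩ := h2 w1 hw1
      exact ⟨w2, hw2, by rw [e2, e1, Path.Homotopic.Quotient.trans_assoc]⟩
  obtain ⟨w, hw, e⟩ := key (B.isWord p) (nil 1) trivial
  exact ⟨w, hw, e.trans (Path.Homotopic.Quotient.refl_trans p)⟩

end Word

/-! ### Normal forms -/

namespace Connectors

variable (K : B.Connectors)

open Classical in
/-- The embeddings of the edge groups into the product of the vertex groups. -/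
noncomputable def sideEmb (s : Bool) (j : S.ι) : EdgeGroup →* (∀ v, B.VertexGroup v) :=
  (MonoidHom.mulSingle B.VertexGroup (K.vert j s)).comp (B.sideMonoidHom j s (K.liesIn j s))

open Classical in
lemma sideEmb_eq {s : Bool} {j : S.ι} {v : S.Vertex} (h : S.LiesIn j s v) (c : EdgeGroup) :
    K.sideEmb s j c = MonoidHom.mulSingle B.VertexGroup v (B.sideHom j s h c) := by
  obtain rfl := (K.liesIn j s).unique h
  rfl

lemma sideEmb_injective (hS : ∀ j, PiOneInjective (S.collar j).core) (s : Bool) (j : S.ι) :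
    Function.Injective (K.sideEmb s j) := by
  classical
  intro c d h
  rw [K.sideEmb_eq (K.liesIn j s), K.sideEmb_eq (K.liesIn j s)] at h
  exact B.sideHom_injective (hS j) s _ (Pi.mulSingle_injective _ h)

variable (hS : ∀ j, PiOneInjective (S.collar j).core)

open Classical in
/-- The realization in a multiple HNN extension of the product of the vertex groups. -/
noncomputable def realization :
    B.Realization (MultiHNN.Ext K.sideEmb (K.sideEmb_injective hS)) where
  hom v := (MultiHNN.base K.sideEmb _).comp (MonoidHom.mulSingle B.VertexGroup v)
  letter := MultiHNN.letter K.sideEmb _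
  rel j v w hv hw c := by
    simp only [MonoidHom.comp_apply, ← K.sideEmb_eq]
    exact MultiHNN.rel _ _ j c

end Connectors

namespace Word

variable {a b d : S.Vertex}

/-- The last coefficient. -/
def last : ∀ {b : S.Vertex}, B.Word a b → B.VertexGroup b
  | _, nil g => g
  | _, snoc _ _ g => g

open Classical in
/-- The first coefficient of the inverse word. -/
noncomputable def head (w : B.Word a b) : ∀ v, B.VertexGroup v :=
  MonoidHom.mulSingle B.VertexGroup b w.last⁻¹

/-- The remaining coefficients and the letters of the inverse word. -/
noncomputable def tail : ∀ {b : S.Vertex}, B.Word a b →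
    List (S.ι × Bool × ∀ v, B.VertexGroup v)
  | _, nil _ => []
  | _, snoc w e _ => (e.torus, !e.pos, w.head) :: w.tail

lemma length_tail (w : B.Word a b) : w.tail.length = w.length := by
  induction w with
  | nil => rfl
  | snoc w e g ih => simp [tail, length, ih]

/-- An associated subgroup lies in a single factor of the product, that of the vertex between the
two edges, so a pinch in the list is a pinch in the word. Coefficients and signs are inverted in the
list. -/
lemma isReduced_tail (K : B.Connectors) : ∀ {b : S.Vertex} {w : B.Word a b}, w.IsReduced →
    MultiHNN.IsReduced K.sideEmb w.tail
  | _, nil _, _ => List.isChain_nil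
  | _, snoc (nil _) _ _, _ => List.isChain_singleton _
  | _, snoc (snoc w e g) f x, h => by
    classical
    refine List.isChain_cons_cons.2 ⟨?_, isReduced_tail K h.2⟩
    intro h1 h2
    have hr : f.IsReverse e := ⟨h1, by simpa using h2.symm⟩
    rintro ⟨c, hc⟩
    refine h.1 hr ⟨c⁻¹, ?_⟩
    have hc : K.sideEmb (!f.pos) f.torus c = MonoidHom.mulSingle B.VertexGroup _ g⁻¹ := by
      convert hc
      simp only [head]
      congr!
    rw [K.sideEmb_eq f.src] at hc
    have h3 : B.minus f c = g⁻¹ := Pi.mulSingle_injective _ hc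
    rw [minus_eq_plus hr] at h3
    have h4 := map_inv (B.sideMonoidHom e.torus e.pos e.tgt) c
    exact h4.trans ((congrArg _ h3).trans (inv_inv g))

variable (hS : ∀ j, PiOneInjective (S.collar j).core) [T2Space M] [LocallyPathConnectedSpace M]

/-- Words grow on the right and `listProd` on the left. Passing to the inverse matches them, so that
`MultiHNN.head_eq` speaks of the last edge of a word. -/
lemma value_val (K : B.Connectors) (w : B.Word a b) :
    ((K.realization hS).value K w.val)⁻¹ =
      MultiHNN.base _ _ w.head * MultiHNN.listProd _ _ w.tail := by
  classical
  induction w with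
  | nil g =>
    rw [val_nil, Realization.value_toM, ← map_inv, head, tail, MultiHNN.listProd, mul_one]
    rfl
  | snoc w e g ih =>
    rw [val_snoc, Realization.value_trans, Realization.value_trans, mul_inv_rev, mul_inv_rev, ih,
      Realization.value_toM, Realization.value_stable, ← map_inv, head, tail, MultiHNN.listProd,
      mul_assoc]
    refine congrArg₂ (· * ·) rfl (congrArg₂ (· * ·) ?_ rfl)
    cases h : e.pos <;> simp [MultiHNN.letterPow, Connectors.realization]

include hS

/-- The vertex groups inject into the fundamental group of `M`. -/
theorem toM_injective {x y : B.VertexGroup a} (h : B.toM x = B.toM y) : x = y := by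
  obtain ⟨K⟩ := Connectors.nonempty (B := B)
  have h1 := congrArg ((K.realization hS).value K) h
  rw [Realization.value_toM, Realization.value_toM] at h1
  classical
  exact Pi.mulSingle_injective _ (MultiHNN.base_injective _ _ h1)

/-- Reduced words defining the same class have the same length. -/
theorem length_eq {w w' : B.Word a b} (hw : w.IsReduced) (hw' : w'.IsReduced)
    (h : w.val = w'.val) : w.length = w'.length := by
  obtain ⟨K⟩ := Connectors.nonempty (B := B)
  rw [← length_tail, ← length_tail]
  apply MultiHNN.length_eq K.sideEmb (K.sideEmb_injective hS) (isReduced_tail K hw)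
    (isReduced_tail K hw') (h := w.head) (h' := w'.head)
  rw [← value_val hS, ← value_val hS, h]

/-- Reduced words defining the same class end with the same edge. -/
theorem snoc_edge_eq {b' : S.Vertex} {w : B.Word a b} {w' : B.Word a b'} {e : S.Edge b d}
    {e' : S.Edge b' d} {g g' : B.VertexGroup d} (hw : (snoc w e g).IsReduced)
    (hw' : (snoc w' e' g').IsReduced) (h : (snoc w e g).val = (snoc w' e' g').val) :
    e.torus = e'.torus ∧ e.pos = e'.pos ∧ ∃ c, g = B.plus e c ⬝ g' := by
  classical
  obtain ⟨K⟩ := Connectors.nonempty (B := B)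
  have h1 := value_val hS K (snoc w e g)
  rw [h, value_val hS K (snoc w' e' g')] at h1
  obtain ⟨h2, h3, c, hc⟩ := MultiHNN.head_eq K.sideEmb (K.sideEmb_injective hS)
    (isReduced_tail K hw) (isReduced_tail K hw') h1.symm
  refine ⟨h2, by simpa using h3, c, ?_⟩
  have h4 : K.sideEmb (! !e.pos) e.torus c =
      MonoidHom.mulSingle B.VertexGroup d (B.sideHom e.torus (! !e.pos) (by simpa using e.tgt) c) :=
    K.sideEmb_eq _ c
  have h5 : B.sideHom e.torus (! !e.pos) (by simpa using e.tgt) c = B.plus e c := by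
    obtain ⟨j, s, _, _⟩ := e
    cases s <;> rfl
  have h6 : (MonoidHom.mulSingle B.VertexGroup d g⁻¹)⁻¹ * MonoidHom.mulSingle B.VertexGroup d g'⁻¹ =
      MonoidHom.mulSingle B.VertexGroup d (g * g'⁻¹) := by
    rw [← map_inv, ← map_mul, inv_inv]
  have hc' : K.sideEmb (! !e.pos) e.torus c =
      (MonoidHom.mulSingle B.VertexGroup d g⁻¹)⁻¹ * MonoidHom.mulSingle B.VertexGroup d g'⁻¹ := by
    refine hc.trans (congrArg₂ (fun x y => x⁻¹ * y) ?_ ?_) <;> simp only [head] <;> congr!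
  have h7 : B.plus e c = g * g'⁻¹ := by
    rw [← h5]
    exact Pi.mulSingle_injective d (h4.symm.trans (hc'.trans h6))
  change g = B.plus e c * g'
  rw [h7]; group

/-- The element relating the last coefficients moves back across `t_e` by `minus_stable`; cancelling
the letter leaves a comparison of shorter words, the inductive step for all that follows. -/
theorem snoc_eq {w w' : B.Word a b} {e : S.Edge b d} {g g' : B.VertexGroup d}
    (hw : (snoc w e g).IsReduced) (hw' : (snoc w' e g').IsReduced)
    (h : (snoc w e g).val = (snoc w' e g').val) :
    ∃ c, g = B.plus e c ⬝ g' ∧ (w.rmul (B.minus e c)).val = w'.val := by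
  obtain ⟨-, -, c, rfl⟩ := snoc_edge_eq hS hw hw' h
  refine ⟨c, rfl, ?_⟩
  rw [val_snoc, val_snoc, toM_trans, ← Path.Homotopic.Quotient.trans_assoc] at h
  have h1 := trans_right_cancel h
  rw [Path.Homotopic.Quotient.trans_assoc, ← minus_stable,
    ← Path.Homotopic.Quotient.trans_assoc] at h1
  rw [val_rmul]
  exact trans_right_cancel h1

/-- Edges are removed from the end: `snoc_edge_eq` identifies the last ones, and `snoc_eq` equates
the values of the rest after a change of the last coefficient, which does not affect the shape. -/
theorem shape_eq {w w' : B.Word a b} (hw : w.IsReduced) (hw' : w'.IsReduced)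
    (h : w.val = w'.val) : w.shape = w'.shape := by
  induction w' with
  | nil g =>
    have := length_eq hS hw hw' h
    rw [← length_shape, ← length_shape] at this
    exact List.length_eq_zero_iff.1 this
  | @snoc b' d w' e' g' ih =>
    generalize hv : (snoc w' e' g').val = v at h
    cases w with
    | nil g =>
      subst hv
      exact absurd (length_eq hS hw hw' h) (by simp [length])
    | @snoc b _ w e g =>
      subst hv
      obtain ⟨h1, h2, -⟩ := snoc_edge_eq hS hw hw' h
      obtain ⟨j, s, hsrc, htgt⟩ := e
      obtain ⟨j', s', hsrc', htgt'⟩ := e'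
      obtain rfl : j = j' := h1
      obtain rfl : s = s' := h2
      obtain rfl := hsrc.unique hsrc'
      obtain ⟨c, -, hc⟩ := snoc_eq hS hw hw' h
      have := ih (hw.2.rmul _) hw'.2 hc
      rw [shape_rmul] at this
      simp [shape, this]

end Word

end Basing

end TorusSystem

namespace TorusSystem

variable {M : Type*} [TopologicalSpace M] {S : TorusSystem M}

namespace Basing

variable {B : S.Basing}

/-! ### Products of words with inverses of words -/

namespace Word

variable {a b c d : S.Vertex}

lemma admits_of_length_eq_zero {w : B.Word a b} (h : w.length = 0) (e : S.Edge b d) :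
    w.Admits e := by
  cases w with
  | nil g => trivial
  | snoc w' e g => simp [length] at h

lemma isReduced_of_length_eq_zero {w : B.Word a b} (h : w.length = 0) : w.IsReduced := by
  cases w with
  | nil g => trivial
  | snoc w' e g => simp [length] at h

lemma exists_eq_nil {w : B.Word a a} (h : w.length = 0) : ∃ g, w = nil g := by
  have key : ∀ {b : S.Vertex} (hb : a = b) (w : B.Word a b), w.length = 0 →
      ∃ g, hb ▸ w = nil g := by
    intro b hb w hw
    cases w with
    | nil g => exact ⟨g, rfl⟩
    | snoc w' e g => simp [length] at hw
  exact key rfl w h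

lemma Admits.congr {w : B.Word a b} {e : S.Edge b d} {d' : S.Vertex} {e' : S.Edge b d'}
    (h : w.Admits e) (h1 : e.torus = e'.torus) (h2 : e.pos = e'.pos) : w.Admits e' := by
  cases w with
  | nil g => trivial
  | snoc w f g => exact fun hr => h ⟨h1.trans hr.1, h2.trans hr.2⟩

/-- The product of a word with the inverse of a word. -/
noncomputable def appInv : ∀ {b : S.Vertex}, B.Word a b → B.Word c b → B.Word a c
  | _, u, nil x => u.rmul x⁻¹
  | _, u, snoc g f x => appInv (snoc (u.rmul x⁻¹) f.rev 1) g

/-- There is no cancellation in the product of a word with the inverse of a word. -/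
def Joins (u : B.Word a b) : B.Word c b → Prop
  | nil _ => True
  | snoc _ f x => (u.rmul x⁻¹).Admits f.rev

@[simp] lemma val_appInv (u : B.Word a b) (g : B.Word c b) :
    (u.appInv g).val = u.val ⬝ g.val.symm := by
  induction g with
  | nil x => rw [appInv, val_rmul, val_nil]; exact congrArg _ (toM_symm B x)
  | snoc g f x ih =>
    rw [appInv, ih, val_snoc, val_snoc, val_rmul, stable_rev]
    have h1 (v : S.Vertex) : B.toM (1 : B.VertexGroup v) = .refl _ := rfl
    have h2 : B.toM x⁻¹ = (B.toM x).symm := toM_symm B x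
    rw [h1, h2]
    simp [Path.Homotopic.Quotient.trans_assoc]

@[simp] lemma length_appInv (u : B.Word a b) (g : B.Word c b) :
    (u.appInv g).length = u.length + g.length := by
  induction g with
  | nil x => simp [appInv, length]
  | snoc g f x ih => rw [appInv, ih]; simp only [length, length_rmul]; omega

lemma shape_appInv (u : B.Word a b) {g : B.Word c b} (h : g.length = 0) :
    (u.appInv g).shape = u.shape := by
  cases g with
  | nil x => simp [appInv]
  | snoc w' e g => simp [length] at h

lemma inv_mem_range_plus {e : S.Edge a b} {x : B.VertexGroup b} (h : x⁻¹ ∈ range (B.plus e)) :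
    x ∈ range (B.plus e) := by
  obtain ⟨y, hy⟩ := h
  refine ⟨y⁻¹, ?_⟩
  have h4 := map_inv (B.sideMonoidHom e.torus e.pos e.tgt) y
  exact h4.trans ((congrArg _ hy).trans (inv_inv x))

lemma plus_congr {a' : S.Vertex} {e : S.Edge a b} {e' : S.Edge a' b} (h1 : e.torus = e'.torus)
    (h2 : e.pos = e'.pos) (c : EdgeGroup) : B.plus e c = B.plus e' c := by
  obtain ⟨j, s, _, _⟩ := e
  obtain ⟨k, s', _, _⟩ := e'
  obtain rfl : j = k := h1
  obtain rfl : s = s' := h2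
  rfl

/-- A pinch at the junction is the same whether it is read at the end of the first word or at the
end of the one to be inverted, since an edge subgroup is closed under inverses. -/
lemma Admits.joins_snoc {u : B.Word a b} {e : S.Edge b d} {g : B.Word c d}
    (h : g.Admits e.rev) : (snoc u e 1).Joins g := by
  cases g with
  | nil x => trivial
  | snoc g f x =>
    intro hr hx
    rw [one_mul] at hx
    have h1 : f.torus = e.torus := hr.1
    have h2 : f.pos = e.pos := by simpa [Edge.rev] using hr.2
    obtain ⟨y, hy⟩ := inv_mem_range_plus hx
    exact h ⟨h1.symm, congrArg not h2.symm⟩ ⟨y, (plus_congr h1 h2 y).trans hy⟩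

lemma joins_of_length_eq_zero (u : B.Word a b) {g : B.Word c b} (h : g.length = 0) :
    u.Joins g := by
  cases g with
  | nil x => trivial
  | snoc w' e g => simp [length] at h

/-- After the first junction, the junctions inside the inverse word are those of `g` read backwards.
-/
lemma IsReduced.appInv {u : B.Word a b} {g : B.Word c b} (hu : u.IsReduced) (hg : g.IsReduced)
    (h : u.Joins g) : (u.appInv g).IsReduced := by
  induction g with
  | nil x => exact hu.rmul _
  | snoc g f x ih =>
    exact ih ⟨h, hu.rmul _⟩ hg.2 (Admits.joins_snoc (hg.1.congr rfl (Bool.not_not _).symm))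

end Word

/-! ### Loops -/

lemma cast_trans_cast {X : Type*} [TopologicalSpace X] {x y z z' : X} (p : PC x y) (q : PC y z)
    (h : z' = z) : p ⬝ q.cast rfl h = (p ⬝ q).cast rfl h := by
  subst h; simp

lemma cast_cast_right {X : Type*} [TopologicalSpace X] {x y y' y'' : X} (p : PC x y)
    (h : y' = y) (h' : y'' = y') : (p.cast rfl h).cast rfl h' = p.cast rfl (h'.trans h) := by
  subst h h'; simp

lemma cast_right_injective {X : Type*} [TopologicalSpace X] {x y y' : X} (h : y' = y) :
    Function.Injective fun p : PC x y => p.cast rfl h := by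
  subst h; intro p q hpq; simpa using hpq

lemma stable_castTgt {a b b' : S.Vertex} (e : S.Edge a b) (h : b = b') :
    B.stable (e.castTgt h) = (B.stable e).cast rfl (by rw [h]) := by
  subst h; exact (Path.Homotopic.Quotient.cast_rfl_rfl _).symm

namespace LoopWord

variable {m : ℕ} (F : B.LoopWord m)

/-- The loop with its indices shifted. -/
def reindex (σ : ZMod (m + 1) → ZMod (m + 1)) (hσ : ∀ i, σ (i + 1) = σ i + 1) :
    B.LoopWord m where
  v i := F.v (σ i)
  e i := (F.e (σ i)).castTgt (by rw [hσ])
  μ i := F.μ (σ i)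

/-- The vertices of the two sides agree only propositionally, so the equality is deduced from that
of the index maps, as a statement about `reindex`. -/
lemma rotate_rotate (k l : ZMod (m + 1)) : (F.rotate k).rotate l = F.rotate (l + k) := by
  have key : ∀ (σ τ : ZMod (m + 1) → ZMod (m + 1)) (hσ hτ), σ = τ →
      F.reindex σ hσ = F.reindex τ hτ := by rintro σ _ _ _ rfl; rfl
  exact key (fun i => i + l + k) (fun i => i + (l + k)) (by intro i; ring) (by intro i; ring)
    (by funext i; ring)

lemma rotate_zero : F.rotate 0 = F := by
  have key : ∀ (σ τ : ZMod (m + 1) → ZMod (m + 1)) (hσ hτ), σ = τ →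
      F.reindex σ hσ = F.reindex τ hτ := by rintro σ _ _ _ rfl; rfl
  exact key (fun i => i + 0) id (by intro i; ring) (by intro i; rfl) (by funext i; simp)

/-- The successor index gets a name of its own, so that it can be replaced by any expression equal
to it. -/
lemma isCyclicallyReduced_iff : F.IsCyclicallyReduced ↔ ∀ i j (h : i + 1 = j),
    (F.e j).IsReverse ((F.e i).castTgt (congrArg F.v h)) →
      F.μ j ∉ range (B.plus ((F.e i).castTgt (congrArg F.v h))) := by
  constructor
  · rintro hF i _ rfl
    exact hF i
  · intro h i
    exact h i _ rfl

variable {F}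

lemma IsCyclicallyReduced.rotate (hF : F.IsCyclicallyReduced) (k : ZMod (m + 1)) :
    (F.rotate k).IsCyclicallyReduced := fun i =>
  F.isCyclicallyReduced_iff.1 hF (i + k) (i + 1 + k) (by ring)

variable (F)

/-- Appending the label and the edge with index `i`. -/
noncomputable def advance {x : M} (i : ZMod (m + 1)) (q : PC x (B.pt (F.v i))) :
    PC x (B.pt (F.v (i + 1))) := q ⬝ B.toM (F.μ i) ⬝ B.stable (F.e i)

lemma advance_cast {x : M} {i j : ZMod (m + 1)} (h : j = i) (q : PC x (B.pt (F.v i))) :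
    F.advance j (q.cast rfl (by rw [h])) = (F.advance i q).cast rfl (by rw [h]) := by
  subst h; simp [advance]

lemma trans_advance {x y : M} {i : ZMod (m + 1)} (p : PC x y) (q : PC y (B.pt (F.v i))) :
    p ⬝ F.advance i q = F.advance i (p ⬝ q) := by
  simp only [advance, Path.Homotopic.Quotient.trans_assoc]

lemma prefixLabel_succ (k : ℕ) : F.prefixLabel (k + 1) =
    (F.advance k (F.prefixLabel k)).cast rfl (by rw [Nat.cast_succ]) := rfl

lemma advance_rotate {x : M} (i k : ZMod (m + 1)) (q : PC x (B.pt (F.v (i + k)))) :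
    (F.rotate k).advance i q = (F.advance (i + k) q).cast rfl
      (congrArg (fun j => B.pt (F.v j)) (add_right_comm i 1 k)) := by
  have := stable_castTgt (B := B) (F.e (i + k))
    (congrArg F.v (add_right_comm i k 1) : F.v (i + k + 1) = F.v (i + 1 + k))
  refine (congrArg (fun s => q ⬝ B.toM (F.μ (i + k)) ⬝ s) this).trans ?_
  exact cast_trans_cast _ _ _

lemma prefixLabel_zero : F.prefixLabel 0 = (.refl (B.pt (F.v 0)) : Pi1 (B.pt (F.v 0))) :=
  Path.Homotopic.Quotient.cast_rfl_rfl _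

lemma prefixLabel_one : F.prefixLabel 1 = (F.advance 0 (.refl _)).cast rfl
    (congrArg (fun j => B.pt (F.v j)) (Nat.cast_succ 0)) :=
  congrArg (fun q : Pi1 (B.pt (F.v 0)) => Path.Homotopic.Quotient.cast (F.advance 0 q) rfl _)
    F.prefixLabel_zero

lemma prefixLabel_natCast_self : F.prefixLabel (m + 1) = F.label.cast rfl
    (congrArg (fun j => B.pt (F.v j)) (ZMod.natCast_self (m + 1))) := by
  rw [label, cast_cast_right]
  exact (Path.Homotopic.Quotient.cast_rfl_rfl _).symm

section Shift

variable {F} {F₁ : B.LoopWord m} (hv : ∀ i, F₁.v i = F.v (i + 1))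
  (hadv : ∀ (i : ZMod (m + 1)) {x : M} (q : PC x (B.pt (F.v (i + 1)))),
    F₁.advance i (q.cast rfl (congrArg B.pt (hv i))) =
      (F.advance (i + 1) q).cast rfl (congrArg B.pt (hv (i + 1))))
  (A : PC (B.pt (F.v 0)) (B.pt (F₁.v 0)))
  (hA : A = (F.advance 0 (.refl _)).cast rfl (congrArg B.pt (hv 0)))
include hadv hA

/-- `F₁` stands for the loop rotated by one step and `A` for the first step. Keeping `F₁` abstract
confines the transports between its vertices and those of `F` to `hv` and `hadv`. -/
lemma trans_prefixLabel_of_shift (k : ℕ) : A ⬝ F₁.prefixLabel k =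
    (F.prefixLabel (k + 1)).cast rfl
      (congrArg B.pt ((hv k).trans (congrArg F.v (Nat.cast_succ k).symm))) := by
  induction k with
  | zero =>
    rw [prefixLabel_one, cast_cast_right]
    refine (congrArg (A ⬝ ·) F₁.prefixLabel_zero).trans ?_
    exact (Path.Homotopic.Quotient.trans_refl A).trans hA
  | succ k ih =>
    have h2 : F.prefixLabel (k + 1) = ((F.prefixLabel (k + 1)).cast rfl
        (congrArg (fun j => B.pt (F.v j)) (Nat.cast_succ k).symm)).cast rfl
        (congrArg (fun j => B.pt (F.v j)) (Nat.cast_succ k)) := by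
      rw [cast_cast_right, Path.Homotopic.Quotient.cast_rfl_rfl]
    have h3 : A ⬝ F₁.prefixLabel k = ((F.prefixLabel (k + 1)).cast rfl
        (congrArg (fun j => B.pt (F.v j)) (Nat.cast_succ k).symm)).cast rfl
        (congrArg B.pt (hv k)) := by
      rw [cast_cast_right, ih]
    rw [prefixLabel_succ, cast_trans_cast, trans_advance, h3, hadv, cast_cast_right,
      F.prefixLabel_succ (k + 1), cast_cast_right]
    conv_rhs => rw [h2]
    rw [advance_cast _ (Nat.cast_succ k), cast_cast_right]

/-- `m + 2` steps along `F` are a full turn followed by the first step, and also the first step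
followed by a full turn along `F₁`. -/
lemma label_of_shift : F.label = A ⬝ F₁.label ⬝ A.symm := by
  have h1 : A ⬝ F₁.label = F.label ⬝ A := by
    have h := trans_prefixLabel_of_shift hv hadv A hA (m + 1)
    rw [F.prefixLabel_succ, prefixLabel_natCast_self, prefixLabel_natCast_self,
      advance_cast _ (ZMod.natCast_self (m + 1)), cast_trans_cast, cast_cast_right,
      cast_cast_right] at h
    have h2 : F.label ⬝ A = (F.advance 0 F.label).cast rfl (congrArg B.pt (hv 0)) := by
      rw [hA, cast_trans_cast, trans_advance, Path.Homotopic.Quotient.trans_refl]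
    apply cast_right_injective (congrArg B.pt (congrArg F₁.v (ZMod.natCast_self (m + 1))))
    dsimp only
    rw [h, h2, cast_cast_right]
  rw [h1, Path.Homotopic.Quotient.trans_assoc]; simp

end Shift

/-- The first edge of the loop. -/
def firstEdge : S.Edge (F.v 0) ((F.rotate 1).v 0) := F.e 0

/-- The class of the first step along the loop. -/
noncomputable def firstStep : PC (B.pt (F.v 0)) (B.pt ((F.rotate 1).v 0)) :=
  B.toM (F.μ 0) ⬝ B.stable F.firstEdge

lemma label_rotate_one :
    F.label = F.firstStep ⬝ (F.rotate 1).label ⬝ F.firstStep.symm := by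
  refine label_of_shift (F₁ := F.rotate 1) (fun i => rfl) (fun i x q => ?_) _ ?_
  · exact (congrArg ((F.rotate 1).advance i) (Path.Homotopic.Quotient.cast_rfl_rfl q)).trans
      (F.advance_rotate i 1 q)
  · refine Eq.trans ?_ (Path.Homotopic.Quotient.cast_rfl_rfl _).symm
    change F.firstStep = .refl _ ⬝ B.toM (F.μ 0) ⬝ B.stable (F.e 0)
    rw [Path.Homotopic.Quotient.refl_trans]
    rfl

end LoopWord

end Basing

end TorusSystem

/-! ### Conjugation of the label of a loop -/

namespace TorusSystem

variable {M : Type*} [TopologicalSpace M] {S : TorusSystem M}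

namespace Basing

variable {B : S.Basing}

namespace LoopWord

variable {m : ℕ} (F : B.LoopWord m) {a : S.Vertex}

/-- The edge with index `k`, between vertices indexed by natural numbers. -/
def edge (k : ℕ) : S.Edge (F.v (k : ZMod (m + 1))) (F.v ((k + 1 : ℕ) : ZMod (m + 1))) :=
  (F.e k).castTgt (congrArg F.v (Nat.cast_succ k).symm)

/-- A word followed by `k` edges of the loop, with their labels. -/
noncomputable def run (w : B.Word a (F.v 0)) : ∀ k : ℕ, B.Word a (F.v (k : ZMod (m + 1)))
  | 0 => w
  | k + 1 => .snoc (run w k) (F.edge k) (F.μ (k + 1 : ℕ))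

/-- The edge which closes the loop. -/
def closingEdge : S.Edge (F.v (m : ZMod (m + 1))) (F.v 0) :=
  (F.e m).castTgt (congrArg F.v ((Nat.cast_succ m).symm.trans (ZMod.natCast_self (m + 1))))

/-- A word followed by all the edges of the loop. -/
noncomputable def fullRun (w : B.Word a (F.v 0)) : B.Word a (F.v 0) :=
  .snoc (F.run w m) F.closingEdge 1

/-- The last coefficient of `w` stands in the place of the label `μ 0`, which therefore has to be
removed from the prefix. -/
lemma val_run (w : B.Word a (F.v 0)) (k : ℕ) :
    (F.run w k).val = w.val ⬝ (B.toM (F.μ 0)).symm ⬝ F.prefixLabel k ⬝ B.toM (F.μ k) := by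
  induction k with
  | zero =>
    have key : ∀ q : Pi1 (B.pt (F.v 0)), q = .refl _ →
        w.val = w.val ⬝ (B.toM (F.μ 0)).symm ⬝ q ⬝ B.toM (F.μ 0) := by
      rintro _ rfl
      simp [Path.Homotopic.Quotient.trans_assoc]
    exact key _ F.prefixLabel_zero
  | succ k ih =>
    rw [run, Word.val_snoc, ih, edge, stable_castTgt, prefixLabel_succ, cast_trans_cast,
      cast_trans_cast, advance]
    simp only [Path.Homotopic.Quotient.trans_assoc]

lemma val_fullRun (w : B.Word a (F.v 0)) :
    (F.fullRun w).val = w.val ⬝ (B.toM (F.μ 0)).symm ⬝ F.label := by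
  have h1 : B.toM (1 : B.VertexGroup (F.v 0)) = .refl _ := rfl
  rw [fullRun, Word.val_snoc, val_run, closingEdge, stable_castTgt, label, prefixLabel_succ,
    cast_cast_right, cast_trans_cast, cast_trans_cast, advance, h1,
    Path.Homotopic.Quotient.trans_refl]
  simp only [Path.Homotopic.Quotient.trans_assoc]

@[simp] lemma length_run (w : B.Word a (F.v 0)) (k : ℕ) :
    (F.run w k).length = w.length + k := by
  induction k with
  | zero => rfl
  | succ k ih => rw [run, Word.length, ih, add_assoc]

lemma length_fullRun (w : B.Word a (F.v 0)) : (F.fullRun w).length = w.length + m + 1 := by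
  rw [fullRun, Word.length, length_run]

variable {F}

lemma run_admits (hF : F.IsCyclicallyReduced) {w : B.Word a (F.v 0)} (h : w.Admits (F.e 0))
    (k : ℕ) : (F.run w k).Admits (F.e k) := by
  cases k with
  | zero => exact h
  | succ k => exact F.isCyclicallyReduced_iff.1 hF k (k + 1 : ℕ) (Nat.cast_succ k).symm

lemma isReduced_run (hF : F.IsCyclicallyReduced) {w : B.Word a (F.v 0)} (hw : w.IsReduced)
    (h : w.Admits (F.e 0)) (k : ℕ) : (F.run w k).IsReduced := by
  induction k with
  | zero => exact hw
  | succ k ih => exact ⟨(run_admits hF h k).congr rfl rfl, ih⟩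

lemma isReduced_fullRun (hF : F.IsCyclicallyReduced) {w : B.Word a (F.v 0)} (hw : w.IsReduced)
    (h : w.Admits (F.e 0)) : (F.fullRun w).IsReduced :=
  ⟨(run_admits hF h m).congr rfl rfl, isReduced_run hF hw h m⟩

lemma conj_trans {X : Type*} [TopologicalSpace X] {x y z : X} (p : PC x y) (q : PC y z)
    (l : PC z z) : p ⬝ (q ⬝ l ⬝ q.symm) ⬝ p.symm = (p ⬝ q) ⬝ l ⬝ (p ⬝ q).symm := by
  simp [Path.Homotopic.Quotient.trans_assoc]

variable (F) in
lemma conj_rotate_one {x : M} {p : PC x (B.pt (F.v 0))} {q : PC x (B.pt ((F.rotate 1).v 0))}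
    (h : q = p ⬝ F.firstStep) :
    p ⬝ F.label ⬝ p.symm = q ⬝ (F.rotate 1).label ⬝ q.symm := by
  rw [h, label_rotate_one, conj_trans]

/-- A conjugate of the label of a cyclically reduced loop is that of a rotated loop by an element
of a vertex group, or it has a longer reduced form. -/
theorem exists_rotate_or_longer (n : ℕ) : ∀ {F : B.LoopWord m}, F.IsCyclicallyReduced →
    ∀ {a : S.Vertex} {g : B.Word a (F.v 0)}, g.IsReduced → g.length = n →
    (∃ (k : ZMod (m + 1)) (g' : B.Word a ((F.rotate k).v 0)), g'.length = 0 ∧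
      g.val ⬝ F.label ⬝ g.val.symm = g'.val ⬝ (F.rotate k).label ⬝ g'.val.symm) ∨
    ∃ u : B.Word a a, u.IsReduced ∧ m + 1 < u.length ∧
      u.val = g.val ⬝ F.label ⬝ g.val.symm := by
  induction n with
  | zero =>
    intro F hF a g hg hn
    refine .inl ⟨0, ?_⟩
    rw [rotate_zero]
    exact ⟨g, hn, rfl⟩
  | succ n ih =>
    intro F hF a g hg hn
    -- Whether `g` cancels against the beginning of the loop.
    by_cases hA : (g.rmul (F.μ 0)).Admits F.firstEdge
    -- The loop is written as a rotation by one, so that its last edge is the first edge of the new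
    -- `F`.
    · obtain ⟨F, rfl⟩ : ∃ F' : B.LoopWord m, F = F'.rotate 1 :=
        ⟨F.rotate (-1), by rw [rotate_rotate, add_neg_cancel, rotate_zero]⟩
      have hF' : F.IsCyclicallyReduced := by
        have := hF.rotate (-1)
        rwa [rotate_rotate, neg_add_cancel, rotate_zero] at this
      -- Whether the end of the loop cancels against `g⁻¹`; if not, the whole product is reduced and
      -- `g` contributes its length twice.
      by_cases hB : g.Admits F.firstEdge.rev
      · right
        let G := F.rotate 1
        have hj : ((G.fullRun (g.rmul (G.μ 0)))).Joins g := by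
          -- The closing edge of `G` has index `m + 1` in `F`, which is `0`.
          have h0 : (0 : ZMod (m + 1)) = m + 1 :=
            ((Nat.cast_succ m).symm.trans (ZMod.natCast_self (m + 1))).symm
          exact Word.Admits.joins_snoc (hB.congr (congrArg (fun i => (F.e i).torus) h0)
            (congrArg (fun i => !(F.e i).pos) h0))
        refine ⟨(G.fullRun (g.rmul (G.μ 0))).appInv g,
          (isReduced_fullRun hF (hg.rmul _) hA).appInv hg hj, ?_, ?_⟩
        · rw [Word.length_appInv, length_fullRun, Word.length_rmul]; omega
        · rw [Word.val_appInv, val_fullRun, Word.val_rmul]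
          simp [Path.Homotopic.Quotient.trans_assoc, G]
      -- Cancellation at the end of the loop: the last edge moves to the front and the conjugator
      -- loses one.
      · obtain ⟨w, hw, hlen, hval⟩ := Word.val_snoc_of_not_admits hg hB
        have hlen' : (w.rmul (F.μ 0)⁻¹).length = n := by rw [Word.length_rmul]; omega
        have h1 : g.val = (w.rmul (F.μ 0)⁻¹).val ⬝ F.firstStep := by
          have h2 : B.toM (F.μ 0)⁻¹ = (B.toM (F.μ 0)).symm := toM_symm B _
          rw [Word.val_rmul, hval, stable_rev, h2, firstStep]
          simp [Path.Homotopic.Quotient.trans_assoc]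
        rw [← F.conj_rotate_one h1]
        rcases ih hF' (hw.rmul _) hlen' with ⟨k, h⟩ | h
        · left
          refine ⟨k + -1, ?_⟩
          rw [rotate_rotate, neg_add_cancel_right]
          exact h
        · exact .inr h
    -- Cancellation at the beginning of the loop: the conjugator absorbs the first step, and the
    -- loop is rotated forwards.
    · obtain ⟨w, hw, hlen, hval⟩ := Word.val_snoc_of_not_admits (hg.rmul _) hA
      have hlen' : w.length = n := by rw [Word.length_rmul] at hlen; omega
      have h1 : w.val = g.val ⬝ F.firstStep := by
        rw [hval, Word.val_rmul, firstStep, Path.Homotopic.Quotient.trans_assoc]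
      rw [F.conj_rotate_one (q := w.val) h1]
      rcases ih (F := F.rotate 1) (hF.rotate 1) hw hlen' with ⟨k, h⟩ | h
      · rw [rotate_rotate] at h
        exact .inl ⟨_, h⟩
      · exact .inr h

variable (hS : ∀ j, PiOneInjective (S.collar j).core) [T2Space M] [LocallyPathConnectedSpace M]
include hS

/-- No reduced word is conjugate to a cyclically reduced loop of greater length. -/
theorem le_length_of_conj (hF : F.IsCyclicallyReduced) {u : B.Word a a} (hu : u.IsReduced)
    (h : LoopConj u.val F.label) : m + 1 ≤ u.length := by
  obtain ⟨p, hp⟩ := h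
  obtain ⟨g, hg, rfl⟩ := Word.exists_isReduced p
  rcases exists_rotate_or_longer _ hF hg rfl with ⟨k, g', hg', h⟩ | ⟨u', hu', hl, h⟩
  -- A rotated label conjugated by an element of a vertex group is the value of a reduced word with
  -- exactly `m + 1` edges.
  · set w := ((F.rotate k).fullRun (g'.rmul ((F.rotate k).μ 0))).appInv g' with hw
    have hwr : w.IsReduced := (isReduced_fullRun (hF.rotate k)
      ((Word.isReduced_of_length_eq_zero hg').rmul _)
      (Word.admits_of_length_eq_zero (by rw [Word.length_rmul, hg']) _)).appInv
      (Word.isReduced_of_length_eq_zero hg') (Word.joins_of_length_eq_zero _ hg')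
    have hwv : u.val = w.val := by
      rw [hp, h, hw, Word.val_appInv, val_fullRun, Word.val_rmul]
      simp [Path.Homotopic.Quotient.trans_assoc]
    rw [Word.length_eq hS hu hwr hwv, hw, Word.length_appInv, length_fullRun, Word.length_rmul]
    omega
  · rw [Word.length_eq hS hu hu' (hp.trans h.symm)]
    omega

end LoopWord

end Basing

end TorusSystem

/-! ### Comparison of conjugate loops -/

namespace TorusSystem

variable {M : Type*} [TopologicalSpace M] {S : TorusSystem M}

namespace Basing

variable {B : S.Basing}

namespace LoopWord

variable {m : ℕ} {F F' : B.LoopWord m} {a a' : S.Vertex}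

lemma edge_data_eq_of_shape_run_eq {w : B.Word a (F.v 0)} {w' : B.Word a' (F'.v 0)} {k : ℕ}
    (h : (F.run w k).shape = (F'.run w' k).shape) (i : ℕ) (hi : i < k) :
    (F.e i).torus = (F'.e i).torus ∧ (F.e i).pos = (F'.e i).pos := by
  induction k with
  | zero => omega
  | succ k ih =>
    rw [run, run, Word.shape, Word.shape, List.cons.injEq, Prod.mk.injEq] at h
    rcases Nat.lt_succ_iff_lt_or_eq.1 hi with hi | rfl
    · exact ih h.2 hi
    · exact h.1

lemma edge_data_eq_of_shape_fullRun_eq {w : B.Word a (F.v 0)} {w' : B.Word a' (F'.v 0)}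
    (h : (F.fullRun w).shape = (F'.fullRun w').shape) (i : ZMod (m + 1)) :
    (F.e i).torus = (F'.e i).torus ∧ (F.e i).pos = (F'.e i).pos := by
  rw [fullRun, fullRun, Word.shape, Word.shape, List.cons.injEq, Prod.mk.injEq] at h
  rw [← ZMod.natCast_zmod_val i]
  rcases Nat.lt_succ_iff_lt_or_eq.1 (ZMod.val_lt i) with hi | hi
  · exact edge_data_eq_of_shape_run_eq h.2 _ hi
  · rw [hi]; exact h.1

/-- A torus and a direction determine the piece from which the edge starts, so the vertices coincide
and only the labels may differ. -/
lemma exists_eq_withLabels (h : ∀ i, (F.e i).torus = (F'.e i).torus ∧ (F.e i).pos = (F'.e i).pos) :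
    ∃ μ' : ∀ i, B.VertexGroup (F.v i), F' = F.withLabels μ' := by
  obtain ⟨v, e, μ⟩ := F
  obtain ⟨v', e', μ'⟩ := F'
  obtain rfl : v = v' := by
    funext i
    have hs := (e i).src
    have hs' := (e' i).src
    obtain ⟨h1, h2⟩ := h i
    simp only at h1 h2
    rw [h1, h2] at hs
    exact hs.unique hs'
  obtain rfl : e = e' := funext fun i => Edge.ext_data (h i).1 (h i).2
  exact ⟨μ', rfl⟩

variable (F) in
lemma val_conj_fullRun (x : B.VertexGroup (F.v 0)) :
    ((F.fullRun (.nil (x * F.μ 0))).rmul x⁻¹).val = B.toM x ⬝ F.label ⬝ (B.toM x).symm := by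
  have h2 : B.toM x⁻¹ = (B.toM x).symm := toM_symm B _
  have h3 : B.toM (x * F.μ 0) = B.toM x ⬝ B.toM (F.μ 0) := toM_trans B _ _
  rw [Word.val_rmul, val_fullRun, Word.val_nil, h2, h3]
  simp [Path.Homotopic.Quotient.trans_assoc]

/-- The label of a loop is that of a reduced word with as many edges. -/
lemma exists_isReduced_label (hF : F.IsCyclicallyReduced) :
    ∃ u : B.Word (F.v 0) (F.v 0), u.IsReduced ∧ u.length = m + 1 ∧ u.val = F.label :=
  ⟨F.fullRun (.nil (F.μ 0)), isReduced_fullRun (w := .nil (F.μ 0)) hF trivial trivial,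
    (F.length_fullRun _).trans (by rw [Word.length, zero_add]), by rw [val_fullRun]; simp⟩

variable (hS : ∀ j, PiOneInjective (S.collar j).core) [T2Space M] [LocallyPathConnectedSpace M]
include hS

/-- Edges are removed from the end by `snoc_eq`. The element found at one edge alters the last
coefficient of what remains, so the statement carries a prescribed element `c₀` for the edge with
index `k`. -/
lemma exists_edge_elements {μ' : ∀ i, B.VertexGroup (F.v i)} (hF : F.IsCyclicallyReduced)
    (hF' : (F.withLabels μ').IsCyclicallyReduced) (w w' : B.VertexGroup (F.v 0)) (k : ℕ)
    (c₀ : EdgeGroup)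
    (h : ((F.run (.nil w) k).rmul (B.minus (F.e k) c₀)).val =
      ((F.withLabels μ').run (.nil w') k).val) :
    ∃ c : ℕ → EdgeGroup, c k = c₀ ∧ w ⬝ B.minus (F.e 0) (c 0) = w' ∧
      ∀ i < k, F.μ (i + 1 : ℕ) ⬝ B.minus (F.e (i + 1 : ℕ)) (c (i + 1)) =
        B.plus (F.edge i) (c i) ⬝ μ' (i + 1 : ℕ) := by
  induction k generalizing c₀ with
  | zero =>
    refine ⟨fun _ => c₀, rfl, ?_, by omega⟩
    exact Word.toM_injective hS h
  | succ k ih =>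
    have hr := (isReduced_run (w := .nil w) hF trivial trivial (k + 1)).rmul
      (B.minus (F.e (k + 1 : ℕ)) c₀)
    have hr' := isReduced_run (w := .nil w') hF' trivial trivial (k + 1)
    obtain ⟨c₁, h1, h2⟩ := Word.snoc_eq (e := F.edge k) hS hr hr' h
    obtain ⟨c, hc, h0, hi⟩ := ih c₁ h2
    refine ⟨Function.update c (k + 1) c₀, by simp, ?_, fun i hik => ?_⟩
    · simpa using h0
    · rcases Nat.lt_succ_iff_lt_or_eq.1 hik with hik | rfl
      · rw [Function.update_of_ne (by omega), Function.update_of_ne (by omega)]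
        exact hi i hik
      · rw [Function.update_self, Function.update_of_ne (by omega), hc]
        exact h1

/-- Both sides are values of reduced words along the same edges. The comparison at the closing edge
identifies the conjugator `x`; the remaining ones give the relations between the labels. -/
lemma compare_labels {μ' : ∀ i, B.VertexGroup (F.v i)} (hF : F.IsCyclicallyReduced)
    (hF' : (F.withLabels μ').IsCyclicallyReduced) (x : B.VertexGroup (F.v 0))
    (h : F.label = B.toM x ⬝ (F.withLabels μ').label ⬝ (B.toM x).symm) :
    ∃ c : ZMod (m + 1) → EdgeGroup,
      (∀ i, F.μ (i + 1) =
        B.plus (F.e i) (c i) ⬝ μ' (i + 1) ⬝ (B.minus (F.e (i + 1)) (c (i + 1))).symm) ∧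
      F.label = B.toM (B.plus F.lastEdge (c (-1))) ⬝ (F.withLabels μ').label ⬝
        (B.toM (B.plus F.lastEdge (c (-1)))).symm := by
  have hr := isReduced_fullRun (w := .nil (F.μ 0)) hF trivial trivial
  have hr' := (isReduced_fullRun (w := .nil (x * μ' 0)) hF' trivial trivial).rmul x⁻¹
  have hval : (F.fullRun (.nil (F.μ 0))).val =
      (((F.withLabels μ').fullRun (.nil (x * μ' 0))).rmul x⁻¹).val := by
    refine Eq.trans ?_ (h.trans ((F.withLabels μ').val_conj_fullRun x).symm)
    rw [val_fullRun]
    simp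
  obtain ⟨c₀, h1, h2⟩ := Word.snoc_eq (e := F.closingEdge) hS hr hr' hval
  obtain ⟨c, hc, h0, hi⟩ := exists_edge_elements hS hF hF' _ _ m c₀ h2
  -- The last coefficients are `1` and `x⁻¹`, and they differ by an element of the closing edge
  -- group.
  have hx : x = B.plus F.closingEdge c₀ := by
    have h3 : 1 = B.plus F.closingEdge c₀ * (1 * x⁻¹) := h1
    rw [one_mul] at h3
    exact (mul_inv_eq_one.1 h3.symm).symm
  have key : ∀ (i j : ZMod (m + 1)) (hij : i + 1 = j) (ci cj : EdgeGroup),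
      F.μ j ⬝ B.minus (F.e j) cj = B.plus ((F.e i).castTgt (congrArg F.v hij)) ci ⬝ μ' j →
      F.μ (i + 1) = B.plus (F.e i) ci ⬝ μ' (i + 1) ⬝ (B.minus (F.e (i + 1)) cj).symm := by
    rintro i _ rfl ci cj hij
    refine Eq.trans ?_ (congrArg (· ⬝ (B.minus (F.e (i + 1)) cj).symm) hij)
    simp [Path.Homotopic.Quotient.trans_assoc]
  have hm : (m : ZMod (m + 1)) + 1 = 0 := (Nat.cast_succ m).symm.trans (ZMod.natCast_self (m + 1))
  refine ⟨fun i => c i.val, fun i => ?_, ?_⟩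
  -- The index `m` is the closing edge, whose successor is `0`: there the relation comes from the
  -- first coefficients, with `x` in place of `c_n⁺`.
  · rcases Nat.lt_succ_iff_lt_or_eq.1 (ZMod.val_lt i) with him | him
    · have h5 : (i + 1).val = i.val + 1 := by
        rw [← ZMod.natCast_zmod_val i, ← Nat.cast_succ, ZMod.val_natCast, ZMod.val_natCast,
          Nat.mod_eq_of_lt (by omega), Nat.mod_eq_of_lt (by omega)]
      have h6 := key (i.val : ℕ) (i.val + 1 : ℕ) (Nat.cast_succ _).symm _ _ (hi i.val him)
      rw [ZMod.natCast_zmod_val] at h6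
      rw [← h5] at h6
      exact h6
    · have h7 : i = (m : ZMod (m + 1)) := 
        (ZMod.natCast_zmod_val i).symm.trans (congrArg Nat.cast him)
      subst h7
      have h8 : ((m : ZMod (m + 1)) + 1).val = (0 : ZMod (m + 1)).val := by rw [hm]
      change _ = _ ⬝ _ ⬝ (B.minus _ (c ((m : ZMod (m + 1)) + 1).val)).symm
      rw [h8]
      refine key m 0 hm _ _ ?_
      have h9 : c (m : ZMod (m + 1)).val = c₀ := by rw [him, hc]
      change _ = B.plus _ (c (m : ZMod (m + 1)).val) ⬝ _
      rw [h9, ZMod.val_zero]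
      exact h0.trans (congrArg (· * μ' 0) hx)
  · have h9 : c (-1 : ZMod (m + 1)).val = c₀ := by rw [ZMod.val_neg_one, hc]
    have h10 : (-1 : ZMod (m + 1)) = m := (eq_neg_of_add_eq_zero_left hm).symm
    have h11 : B.plus F.lastEdge (c (-1 : ZMod (m + 1)).val) = x := by
      rw [h9, hx]
      exact Word.plus_congr (e := F.lastEdge) (e' := F.closingEdge)
        (congrArg (fun i => (F.e i).torus) h10) (congrArg (fun i => (F.e i).pos) h10) c₀
    rw [← h11] at h
    exact h

/-- Conjugate loops of the same length, conjugate by an element of a vertex group. -/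
lemma compare_loops (hF : F.IsCyclicallyReduced) (hF' : F'.IsCyclicallyReduced)
    {g : B.Word (F.v 0) (F'.v 0)} (hg : g.length = 0)
    (h : F.label = g.val ⬝ F'.label ⬝ g.val.symm) :
    ∃ μ' : ∀ i, B.VertexGroup (F.v i), F' = F.withLabels μ' ∧
      ∃ c : ZMod (m + 1) → EdgeGroup,
      (∀ i, F.μ (i + 1) =
        B.plus (F.e i) (c i) ⬝ μ' (i + 1) ⬝ (B.minus (F.e (i + 1)) (c (i + 1))).symm) ∧
      F.label = B.toM (B.plus F.lastEdge (c (-1))) ⬝ (F.withLabels μ').label ⬝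
        (B.toM (B.plus F.lastEdge (c (-1)))).symm := by
  have hr := isReduced_fullRun (w := .nil (F.μ 0)) hF trivial trivial
  have hr' := (isReduced_fullRun hF' ((Word.isReduced_of_length_eq_zero hg).rmul (F'.μ 0))
      (Word.admits_of_length_eq_zero (by rw [Word.length_rmul, hg]) _)).appInv
      (Word.isReduced_of_length_eq_zero hg) (Word.joins_of_length_eq_zero _ hg)
  have hval : (F.fullRun (.nil (F.μ 0))).val = ((F'.fullRun (g.rmul (F'.μ 0))).appInv g).val := by
    rw [Word.val_appInv, val_fullRun, val_fullRun, Word.val_rmul, Word.val_nil]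
    simpa [Path.Homotopic.Quotient.trans_assoc] using h
  have hs := Word.shape_eq hS hr hr' hval
  rw [Word.shape_appInv _ hg] at hs
  obtain ⟨μ', rfl⟩ := exists_eq_withLabels (edge_data_eq_of_shape_fullRun_eq hs)
  refine ⟨μ', rfl, ?_⟩
  obtain ⟨x, rfl⟩ := Word.exists_eq_nil (a := F.v 0) hg
  exact compare_labels hS hF hF' x h

lemma le_of_conj {m' : ℕ} {F' : B.LoopWord m'} (hF : F.IsCyclicallyReduced)
    (hF' : F'.IsCyclicallyReduced) (h : LoopConj F.label F'.label) : m' ≤ m := by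
  obtain ⟨u, hu, hl, hv⟩ := exists_isReduced_label hF
  have := le_length_of_conj hS hF' hu (hv ▸ h)
  omega

/-- Conjugate cyclically reduced loops of the same length agree up to a rotation and elements of
the edge groups. -/
theorem exists_rotate_eq (hF : F.IsCyclicallyReduced) (hF' : F'.IsCyclicallyReduced)
    (h : LoopConj F.label F'.label) :
    ∃ (k : ZMod (m + 1)) (μ' : ∀ i, B.VertexGroup (F.v i)), F'.rotate k = F.withLabels μ' ∧
      ∃ c : ZMod (m + 1) → EdgeGroup,
      (∀ i, F.μ (i + 1) =
        B.plus (F.e i) (c i) ⬝ μ' (i + 1) ⬝ (B.minus (F.e (i + 1)) (c (i + 1))).symm) ∧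
      F.label = B.toM (B.plus F.lastEdge (c (-1))) ⬝ (F.withLabels μ').label ⬝
        (B.toM (B.plus F.lastEdge (c (-1)))).symm := by
  obtain ⟨p, hp⟩ := h
  obtain ⟨g, hg, rfl⟩ := Word.exists_isReduced p
  rcases exists_rotate_or_longer _ hF' hg rfl with ⟨k, g', hg', h⟩ | ⟨u', hu', hl, h⟩
  · exact ⟨k, compare_loops hS hF (hF'.rotate k) hg' (hp.trans h)⟩
  · obtain ⟨u, hu, hlen, hv⟩ := exists_isReduced_label hF
    have := Word.length_eq hS hu hu' (hv.trans (hp.trans h.symm))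
    omega

end LoopWord

/-! ### Conjugacy of elements of the vertex groups -/

/-- Elements of vertex groups joined by a chain of conjugacies and passages through edge groups. -/
inductive Linked : ∀ {v w : S.Vertex}, B.VertexGroup v → B.VertexGroup w → Prop
  | conj {v : S.Vertex} {x y : B.VertexGroup v} (h : LoopConj x y) : Linked x y
  | cross {v u w : S.Vertex} {x : B.VertexGroup v} {y : B.VertexGroup w} (e : S.Edge v u)
      (c : EdgeGroup) (h : LoopConj x (B.minus e c)) (h' : Linked (B.plus e c) y) : Linked x y

lemma _root_.HakenJSJ.LoopConj.symm {X : Type*} [TopologicalSpace X] {x y : X} {p : Pi1 x} {q : Pi1 y}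
    (h : LoopConj p q) : LoopConj q p := by
  obtain ⟨g, rfl⟩ := h
  exact ⟨g.symm, by simp [Path.Homotopic.Quotient.trans_assoc]⟩

section

variable (hS : ∀ j, PiOneInjective (S.collar j).core) [T2Space M] [LocallyPathConnectedSpace M]
include hS

/-- The last edge of `g` must cancel against its inverse in `g y g⁻¹`, as a vertex element has no
reduced form with edges. So the conjugated element lies in the edge group; it crosses the torus, and
`g` is shortened. -/
lemma linked_of_word {v w : S.Vertex} {x : B.VertexGroup w} (g : B.Word w v) (hg : g.IsReduced)
    (y : B.VertexGroup v) (h : B.toM x = g.val ⬝ B.toM y ⬝ g.val.symm) : Linked y x := by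
  induction g with
  | nil a =>
    refine .conj (LoopConj.symm ⟨a, Word.toM_injective hS ?_⟩)
    rw [h, toM_trans, toM_trans, toM_symm, Word.val_nil]
  | @snoc b d g f a ih =>
    have h3 : B.toM (a * y * a⁻¹) = B.toM a ⬝ B.toM y ⬝ (B.toM a).symm := by
      rw [← toM_symm, ← toM_trans, ← toM_trans]; rfl
    by_cases hc : a * y * a⁻¹ ∈ range (B.plus f)
    · obtain ⟨c, hc⟩ := hc
      have h4 : LoopConj y (B.minus f.rev c) := by
        rw [minus_rev]
        exact LoopConj.symm ⟨a, hc⟩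
      refine .cross f.rev c h4 (ih hg.2 _ ?_)
      rw [plus_rev, h, Word.val_snoc]
      have h5 : B.toM (B.minus f c) = B.stable f ⬝ B.toM (B.plus f c) ⬝ (B.stable f).symm := by
        rw [← minus_stable, Path.Homotopic.Quotient.trans_assoc]; simp
      rw [h5, hc, h3]
      simp [Path.Homotopic.Quotient.trans_assoc]
    -- Without a pinch around `y` the product `g y g⁻¹` is reduced and of positive length, but its
    -- value is that of a word without edges.
    · exfalso
      set u := ((Word.snoc g f a).rmul y).appInv (.snoc g f a)
      have hu : u.IsReduced := (hg.rmul y).appInv hg fun _ => hc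
      have hv : (Word.nil x : B.Word w w).val = u.val := by
        rw [Word.val_appInv, Word.val_rmul, Word.val_nil, h]
      have := Word.length_eq hS (w := .nil x) trivial hu hv
      rw [Word.length_appInv] at this
      simp [Word.length] at this

end

/-- An edge followed by the edges of a path. -/
def consEdge {r : ℕ} {v : S.Vertex} {α : Fin (r + 2) → S.Vertex} (e : S.Edge v (α 0))
    (β : ∀ i : Fin (r + 1), S.Edge (α i.castSucc) (α i.succ)) (i : Fin (r + 2)) :
    S.Edge ((Fin.cons v α : Fin (r + 3) → S.Vertex) i.castSucc)
      ((Fin.cons v α : Fin (r + 3) → S.Vertex) i.succ) :=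
  Fin.cases (motive := fun i => S.Edge ((Fin.cons v α : Fin (r + 3) → S.Vertex) i.castSucc)
      ((Fin.cons v α : Fin (r + 3) → S.Vertex) i.succ)) e β i

/-- A chain through edges, indexed. -/
lemma Linked.exists_path {v w : S.Vertex} {x : B.VertexGroup v} {y : B.VertexGroup w}
    (h : Linked x y) : (∃ (u : S.Vertex) (g g' : B.VertexGroup u),
      (⟨v, x⟩ : Σ v, B.VertexGroup v) = ⟨u, g⟩ ∧ (⟨w, y⟩ : Σ v, B.VertexGroup v) = ⟨u, g'⟩ ∧
        LoopConj g g') ∨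
    ∃ (r : ℕ) (α : Fin (r + 2) → S.Vertex)
          (β : ∀ i : Fin (r + 1), S.Edge (α i.castSucc) (α i.succ))
          (c : Fin (r + 1) → EdgeGroup)
          (g : B.VertexGroup (α 0)) (g' : B.VertexGroup (α (Fin.last (r + 1)))),
        (⟨v, x⟩ : Σ v, B.VertexGroup v) = ⟨α 0, g⟩ ∧
        (⟨w, y⟩ : Σ v, B.VertexGroup v) = ⟨α (Fin.last (r + 1)), g'⟩ ∧
        LoopConj g (B.minus (β 0) (c 0)) ∧
        LoopConj g' (B.plus (β (Fin.last r)) (c (Fin.last r))) ∧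
        ∀ i : Fin r, LoopConj (B.plus (β i.castSucc) (c i.castSucc))
          (B.minus (β i.succ) (c i.succ)) := by
  induction h with
  | conj h => exact .inl ⟨_, _, _, rfl, rfl, h⟩
  | @cross v u w x y e c₀ h _ ih =>
    right
    rcases ih with ⟨t, g, g', h1, h2, h3⟩ | ⟨r, α, β, c, g, g', h1, h2, h3, h4, h5⟩
    -- Equality of dependent pairs identifies the vertex and the element at once.
    · cases h1
      cases h2
      refine ⟨0, Fin.cons v fun _ => u, fun | 0 => e, fun _ => c₀, x, g', rfl, rfl, h,
        h3.symm, fun i => i.elim0⟩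
    · cases h1
      refine ⟨r + 1, Fin.cons v α, consEdge e β, Fin.cons c₀ c, x, g', rfl, h2, h, ?_, ?_⟩
      · exact h4
      · intro i
        cases i using Fin.cases with
        | zero => exact h3
        | succ i => exact h5 i

end Basing

end TorusSystem

end HakenJSJ

/-! ### The conjugacy theorem -/

theorem theorem3p1
    {M : Type*} [TopologicalSpace M] [T2Space M] [CompactSpace M] [ConnectedSpace M]
    [ChartedSpace (EuclideanSpace ℝ (Fin 3)) M] [IsManifold (𝓡 3) ∞ M]
    (hor : IsOrientable M) (hM : IsHaken M)
    (S : TorusSystem M) (hS : S.IsJSJ) (B : S.Basing)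
    (Φ Φ' : B.CyclicForm) (hconj : LoopConj Φ.label Φ'.label) :
    Φ.length = Φ'.length ∧
    -- (i)
    ((∃ (v : S.Vertex) (g g' : B.VertexGroup v) (hg : g ≠ .refl _) (hg' : g' ≠ .refl _),
        Φ = .point v g hg ∧ Φ' = .point v g' hg' ∧ LoopConj g g') ∨
    -- (ii): a path with `p = r + 1` edges
      (∃ (r : ℕ) (α : Fin (r + 2) → S.Vertex)
          (β : ∀ i : Fin (r + 1), S.Edge (α i.castSucc) (α i.succ))
          (c : Fin (r + 1) → EdgeGroup)
          (g : B.VertexGroup (α 0)) (g' : B.VertexGroup (α (Fin.last (r + 1))))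
          (hg : g ≠ .refl _) (hg' : g' ≠ .refl _),
        Φ = .point (α 0) g hg ∧ Φ' = .point (α (Fin.last (r + 1))) g' hg' ∧
        LoopConj g (B.minus (β 0) (c 0)) ∧
        LoopConj g' (B.plus (β (Fin.last r)) (c (Fin.last r))) ∧
        ∀ i : Fin r, LoopConj (B.plus (β i.castSucc) (c i.castSucc))
          (B.minus (β i.succ) (c i.succ))) ∨
    -- (iii): `F'` is permuted cyclically so that its loop becomes that of `F`, with labels `μ'`
      (∃ (m : ℕ) (F F' : B.LoopWord m) (hF : F.IsCyclicallyReduced)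
          (hF' : F'.IsCyclicallyReduced),
        Φ = .loop m F hF ∧ Φ' = .loop m F' hF' ∧
        ∃ (k : ZMod (m + 1)) (μ' : ∀ i, B.VertexGroup (F.v i)),
          F'.rotate k = F.withLabels μ' ∧
          ∃ c : ZMod (m + 1) → EdgeGroup,
            (∀ i, F.μ (i + 1) =
              B.plus (F.e i) (c i) ⬝ μ' (i + 1) ⬝ (B.minus (F.e (i + 1)) (c (i + 1))).symm) ∧
            F.label =
              B.toM (B.plus F.lastEdge (c (-1))) ⬝ (F.withLabels μ').label ⬝
                (B.toM (B.plus F.lastEdge (c (-1)))).symm)) := by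
  have hinj := hS.1.1
  have : LocallyPathConnectedSpace M :=
    ChartedSpace.locallyPathConnectedSpace (EuclideanSpace ℝ (Fin 3)) M
  rcases Φ with ⟨v, g, hg⟩ | ⟨m, F, hF⟩ <;> rcases Φ' with ⟨v', g', hg'⟩ | ⟨m', F', hF'⟩
  · refine ⟨rfl, ?_⟩
    -- `linked_of_word` reads the conjugating word from its end, so a word from `v'` to `v` gives a
    -- chain from `v` to `v'`.
    obtain ⟨p, hp⟩ := hconj.symm
    obtain ⟨w, hw, rfl⟩ := TorusSystem.Basing.Word.exists_isReduced p
    rcases (TorusSystem.Basing.linked_of_word hinj w hw g hp).exists_path with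
      ⟨u, x, x', h1, h2, h3⟩ | ⟨r, α, β, c, x, x', h1, h2, h3⟩
    · cases h1
      cases h2
      exact .inl ⟨_, _, _, hg, hg', rfl, rfl, h3⟩
    · cases h1
      cases h2
      exact .inr (.inl ⟨r, α, β, c, _, _, hg, hg', rfl, rfl, h3⟩)
  -- A vertex element is a reduced word of length `0`, too short to be conjugate to a loop.
  · have := TorusSystem.Basing.LoopWord.le_length_of_conj hinj hF' (u := .nil g) trivial hconj
    simp [TorusSystem.Basing.Word.length] at this
  · have := TorusSystem.Basing.LoopWord.le_length_of_conj hinj hF (u := .nil g') trivial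
      hconj.symm
    simp [TorusSystem.Basing.Word.length] at this
  · obtain rfl : m = m' := le_antisymm
      (TorusSystem.Basing.LoopWord.le_of_conj (F := F') (F' := F) hinj hF' hF hconj.symm)
      (TorusSystem.Basing.LoopWord.le_of_conj (F := F) (F' := F') hinj hF hF' hconj)
    refine ⟨rfl, .inr (.inr ⟨m, F, F', hF, hF', rfl, rfl, ?_⟩)⟩
    exact TorusSystem.Basing.LoopWord.exists_rotate_eq hinj hF hF' hconj
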